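/- Let $G$ be a finite simple undirected graph with $n\ge 1$ nodes and $m$ edges. For an integer $k\ge 0$, a $k$-core of $G$ is (the node set of) a maximal connected induced subgraph in which every node has degree at least $k$. The core number $c_G(v)$ of a node $v$ is the largest $k$ such that some $k$-core contains $v$. In the incident-list model, every node has a list of its neighbours in arbitrary order, and an algorithm accesses $G$ only through degree queries (the degree of $v$) and neighbour queries (the $i$-th entry of the list of $v$). The algorithm is a program for a word RAM with words of $w=\Omega(\log n)$ bits. Every word operation, every query and every choice of a uniformly random element of $\{0,\dots,k-1\}$ takes one unit of time. Theorem. There are a single randomized algorithm, with input $n$, an error parameter $\varepsilon\in(0,1]$ and a confidence parameter $c>0$ (both rational), and a universal constant $K$ such that the following holds. For all $\varepsilon$ and $c$ there are constants $\kappa$ and $C$, depending only on $\varepsilon$ and $c$, such that for every graph $G$ as above, given by arbitrary incidence lists, and every word length $w\ge\kappa(\lfloor\log_2 n\rfloor+1)$: 1. Whatever the random choices, the algorithm halts within $C\,(n+\min\{m,\,n\log n\})$ time steps. If $G$ has no isolated nodes, it halts within $C\,\min\{m,\,n\log n\}$ time steps. 2. With probability at least $1-K/n^{c}$, it outputs for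 every node $v$ a rational label $\ell(v)$ with $$\frac{c_G(v)}{1+\varepsilon}\;\le\;\ell(v)\;\le\;(1+\varepsilon)\,c_G(v).$$ -/

import Mathlib

/-! ### Cores of a graph -/

namespace SimpleGraph

variable {V : Type*} (G : SimpleGraph V)

/-- `S` is (the node set of) a `k`-core of `G`: a maximal set of nodes whose induced subgraph is
connected and in which every node has at least `k` neighbours. -/
def IsKCore (k : ℕ) (S : Set V) : Prop :=
  Maximal (fun T : Set V => (G.induce T).Connected ∧ ∀ v ∈ T, k ≤ (G.neighborSet v ∩ T).ncard) S

/-- The core number of `v`: the largest `k` such that some `k`-core of `G` contains `v`. -/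
noncomputable def coreNumber (v : V) : ℕ :=
  sSup {k | ∃ S, G.IsKCore k S ∧ v ∈ S}

/-- On a finite graph the maximum in the definition of the core number is attained. -/
theorem isGreatest_coreNumber [Finite V] (v : V) :
    IsGreatest {k | ∃ S, G.IsKCore k S ∧ v ∈ S} (G.coreNumber v) := by
  have hb : BddAbove {k | ∃ S, G.IsKCore k S ∧ v ∈ S} := by
    refine ⟨(G.neighborSet v).ncard, ?_⟩
    rintro k ⟨S, hS, hv⟩
    exact (hS.prop.2 v hv).trans (Set.ncard_le_ncard Set.inter_subset_left (Set.toFinite _))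
  have hne : {k | ∃ S, G.IsKCore k S ∧ v ∈ S}.Nonempty := by
    have h0 : (G.induce ({v} : Set V)).Connected ∧
        ∀ u ∈ ({v} : Set V), 0 ≤ (G.neighborSet u ∩ {v}).ncard := by
      refine ⟨?_, fun _ _ => Nat.zero_le _⟩
      have : Subsingleton ({v} : Set V) := Set.subsingleton_singleton.coe_sort
      have : Nonempty ({v} : Set V) := ⟨⟨v, rfl⟩⟩
      exact ⟨SimpleGraph.Preconnected.of_subsingleton⟩
    obtain ⟨S, hle, hS⟩ := (Set.toFinite
      {T : Set V | (G.induce T).Connected ∧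
        ∀ u ∈ T, 0 ≤ (G.neighborSet u ∩ T).ncard}).exists_le_maximal h0
    exact ⟨0, S, hS, hle rfl⟩
  exact ⟨Nat.sSup_mem hne hb, fun k hk => le_csSup hb hk⟩

end SimpleGraph

/-! ### The incident-list model -/

/-- An incident-list representation of a graph: for every node, a list of its neighbours without
repetition, in an arbitrary order. -/
structure IncidenceLists {n : ℕ} (G : SimpleGraph (Fin n)) where
  list : Fin n → List (Fin n)
  nodup : ∀ v, (list v).Nodup
  mem_list : ∀ v u, u ∈ list v ↔ G.Adj v u

namespace IncidenceLists

variable {n : ℕ} {G : SimpleGraph (Fin n)} (I : IncidenceLists G)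

/-- The answer to the degree query for node `v` (`0` if `v` is not a node). -/
def degreeQuery (v : ℕ) : ℕ :=
  if h : v < n then (I.list ⟨v, h⟩).length else 0

/-- The answer to the neighbour query `(v, i)`: the `i`-th entry of the list of `v`, counted
from `0` (`0` if `v` is not a node or the list is too short). -/
def neighborQuery (v i : ℕ) : ℕ :=
  if h : v < n then
    if h' : i < (I.list ⟨v, h⟩).length then ((I.list ⟨v, h⟩)[i] : ℕ) else 0
  else 0

end IncidenceLists

/-! ### A word RAM with random choices and incident-list queries -/

namespace QueryRAM

/-- The binary word operations. -/
inductive BinOp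
  | plus | monus | times | quot | less | equal

/-- Value of a binary operation, before it is reduced to the word length. The subtraction is
truncated at `0`, the division is the integer division, comparisons return `1` or `0`. -/
def BinOp.eval : BinOp → ℕ → ℕ → ℕ
  | plus, a, b => a + b
  | monus, a, b => a - b
  | times, a, b => a * b
  | quot, a, b => a / b
  | less, a, b => if a < b then 1 else 0
  | equal, a, b => if a = b then 1 else 0

/-- Expressions: constants, word variables, array entries, binary operations. -/
inductive Expr
  | lit (k : ℕ)
  | var (x : ℕ)
  | get (a : ℕ) (i : Expr)
  | bin (o : BinOp) (e f : Expr)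

/-- Programs. `assign x e` is `x := e`; `store a i e` is `a[i] := e`; `degree x v` and
`neighbor x v i` store the answer to a query in `x`; `random x k` stores in `x` a fresh uniformly
random element of `{0, …, k - 1}`; in `cond` and `loop` a non-zero value means true. -/
inductive Program
  | skip
  | assign (x : ℕ) (e : Expr)
  | store (a : ℕ) (i e : Expr)
  | degree (x : ℕ) (v : Expr)
  | neighbor (x : ℕ) (v i : Expr)
  | random (x : ℕ) (k : Expr)
  | seq (p q : Program)
  | cond (e : Expr) (p q : Program)
  | loop (e : Expr) (p : Program)

/-- The memory: word variables, and arrays of words indexed by words. A program mentions only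
finitely many variables and arrays. -/
structure Memory where
  var : ℕ → ℕ
  arr : ℕ → ℕ → ℕ

/-- The memory after `x := a`, for words of `w` bits. -/
def Memory.assign (w : ℕ) (s : Memory) (x a : ℕ) : Memory :=
  { s with var := Function.update s.var x (a % 2 ^ w) }

/-- The memory after `b[i] := a`, for words of `w` bits. -/
def Memory.store (w : ℕ) (s : Memory) (b i a : ℕ) : Memory :=
  { s with arr := Function.update s.arr b (Function.update (s.arr b) i (a % 2 ^ w)) }

/-- The value of an expression; all arithmetic is modulo `2 ^ w`. -/
def Expr.eval (w : ℕ) (s : Memory) : Expr → ℕ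
  | lit k => k % 2 ^ w
  | var x => s.var x
  | get a i => s.arr a (i.eval w s)
  | bin o e f => o.eval (e.eval w s) (f.eval w s) % 2 ^ w

/-- The uniform distribution on `{0, …, k - 1}`; by convention the result is `0` if `k = 0`. -/
noncomputable def uniformBelow (k : ℕ) : PMF ℕ :=
  if h : k = 0 then PMF.pure 0
  else PMF.uniformOfFinset (Finset.range k) (Finset.nonempty_range_iff.mpr h)

/-- A configuration: the stack of the programs still to be executed, and the memory. The machine
has halted when the stack is empty. -/
abbrev Config := List Program × Memory

/-- The distribution of the configuration after one time step. A step executes one elementary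
command, which evaluates at most two expressions of the program (their size does not depend on
the input), makes at most one query and at most one random choice, or it evaluates one test of a
branching or a loop, or it unfolds one composition. -/
noncomputable def step {n : ℕ} {G : SimpleGraph (Fin n)} (I : IncidenceLists G) (w : ℕ) :
    Config → PMF Config
  | ([], s) => PMF.pure ([], s)
  | (.skip :: K, s) => PMF.pure (K, s)
  | (.assign x e :: K, s) => PMF.pure (K, s.assign w x (e.eval w s))
  | (.store a i e :: K, s) => PMF.pure (K, s.store w a (i.eval w s) (e.eval w s))
  | (.degree x v :: K, s) => PMF.pure (K, s.assign w x (I.degreeQuery (v.eval w s)))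
  | (.neighbor x v i :: K, s) =>
      PMF.pure (K, s.assign w x (I.neighborQuery (v.eval w s) (i.eval w s)))
  | (.random x k :: K, s) => (uniformBelow (k.eval w s)).map fun a => (K, s.assign w x a)
  | (.seq p q :: K, s) => PMF.pure (p :: q :: K, s)
  | (.cond e p q :: K, s) => PMF.pure ((if e.eval w s ≠ 0 then p else q) :: K, s)
  | (.loop e p :: K, s) =>
      PMF.pure (if e.eval w s ≠ 0 then p :: .loop e p :: K else K, s)

/-- The distribution of the configuration after `t` time steps. -/
noncomputable def run {n : ℕ} {G : SimpleGraph (Fin n)} (I : IncidenceLists G) (w : ℕ) :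
    ℕ → Config → PMF Config
  | 0, cfg => PMF.pure cfg
  | t + 1, cfg => (step I w cfg).bind (run I w t)

/-- The initial configuration of `P`: variables `0, …, 4` contain the number of nodes and the
numerators and denominators of the parameters `ε` and `c`; the rest of the memory is `0`. -/
def init (w : ℕ) (P : Program) (n : ℕ) (ε c : ℚ) : Config :=
  ([P],
    { var := fun x =>
        (match x with
          | 0 => n
          | 1 => ε.num.natAbs
          | 2 => ε.den
          | 3 => c.num.natAbs
          | 4 => c.den
          | _ => 0) % 2 ^ w
      arr := fun _ _ => 0 })

/-- The outputs are the labels `a[v] / b[v]`, where `a` and `b` are the arrays `0` and `1`.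
They are correct if each of them is within a factor `1 + ε` of the core number of `v`. -/
def CorrectLabels {n : ℕ} (G : SimpleGraph (Fin n)) (ε : ℝ) (s : Memory) : Prop :=
  ∀ v : Fin n, 0 < s.arr 1 v ∧
    (G.coreNumber v : ℝ) / (1 + ε) ≤ (s.arr 0 v : ℝ) / (s.arr 1 v : ℝ) ∧
    (s.arr 0 v : ℝ) / (s.arr 1 v : ℝ) ≤ (1 + ε) * (G.coreNumber v : ℝ)

end QueryRAM

/-! Call a set of nodes stable at level k if each of its nodes has at least k neighbours inside the
set. Then `k ≤ c(v)` holds exactly if `v` lies in a set stable at level k (`le_coreNumber_iff`), so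
connectedness and maximality play no further role. Repeatedly removing a suitable node of minimum
core number gives an order ρ along which core numbers do not decrease and in which `v` has at most
`c(v)` neighbours that do not precede it (`exists_degeneracy_order`).

Let `g = ⌊log₂ n⌋ + 1`. If the degree sum is at most `n g`, exact peeling takes linear time.
Otherwise levels k descend geometrically from n. Let b be the denominator of ε, so that `1 / b ≤ ε`.
At level k every unlabelled node `v` draws `⌊d(v) L / k⌋` random neighbours; unlabelled nodes with
fewer than τ sampled arcs to surviving or labelled nodes are peeled off, and the survivors get the
label k. Here `L = 2 (b + 1) X` and `τ = (2 b + 1) X` for a scale X of order `log n`. If `c(v) ≥ k`,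
then `v` has k neighbours of core number at least k and expects, up to rounding, at least `L = τ +
X` hits among them. If `c(v) < k b / (b + 1)`, then `v` expects at most `2 b X = τ - X` hits among
the neighbours that do not precede it in ρ. Both target sets depend on the graph only, so
exponential tail bounds (`lower_tail`, `upper_tail`) apply at each level whatever happened before.
Without large deviations all nodes of the first kind survive (`IsPeeled.core_lt`), and a first
surviving node of the second kind would have too few arcs (`IsPeeled.le_core`). A union bound over
at most n levels and n nodes gives the failure probability.

An unlabelled node at level k has `c(v) ≤ 2 k` as long as all labels are good, so by a geometric sum
it draws `O(L d(v) / c(v))` samples for fixed b. Since `∑ d(v) / c(v) ≤ 2 n` (`sum_div_core_le`),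
the total is `O(n log n)`. A hard cap on the samples makes the time bound certain; by `spent_step`
and `spent_le_budget` the cap is not reached in good executions.

The program is verified with an expectation transformer `wp` that is infinite if time may run out. A
finite bound for the expected indicator of a wrong output therefore proves certain halting and the
error probability at once. `Surely` and `Samples` are program rules for this transformer; `Samples`
replaces the random choices by the explicit average `sampleExpect`, and `wp_levels_le` is the
induction over the levels. -/

open scoped ENNReal

/-! ### Expectations of nonnegative functions -/

namespace PMF

variable {α β : Type*}

/-- The expectation of a function with values in `ℝ≥0∞`. -/
noncomputable def expect (μ : PMF α) (h : α → ℝ≥0∞) : ℝ≥0∞ := ∑' a, μ a * h a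

theorem expect_pure (a : α) (h : α → ℝ≥0∞) : (PMF.pure a).expect h = h a := by
  rw [expect, tsum_eq_single a]
  · simp
  · intro b hb
    simp [hb]

theorem expect_bind (μ : PMF α) (g : α → PMF β) (h : β → ℝ≥0∞) :
    (μ.bind g).expect h = μ.expect fun a => (g a).expect h := by
  simp only [expect, PMF.bind_apply, ← ENNReal.tsum_mul_right, ← ENNReal.tsum_mul_left]
  rw [ENNReal.tsum_comm]
  simp only [mul_assoc]

theorem expect_map (μ : PMF α) (g : α → β) (h : β → ℝ≥0∞) :
    (μ.map g).expect h = μ.expect fun a => h (g a) := by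
  rw [← PMF.bind_pure_comp, expect_bind]
  simp [expect_pure]

/-- Markov's inequality for the complement of `S`: pointwise `1 ≤ 1_S + h`, and summation bounds the
measure of `S` from below. -/
theorem le_one_sub_of_expect_le (μ : PMF α) (S : Set α) {h : α → ℝ≥0∞}
    (H : ∀ a, a ∉ S → 1 ≤ h a) {x : ℝ} (hx : 0 ≤ x) (hμ : μ.expect h ≤ ENNReal.ofReal x) :
    1 - x ≤ (μ.toOuterMeasure S).toReal := by
  have h1 : (1 : ℝ≥0∞) ≤ μ.toOuterMeasure S + ENNReal.ofReal x := by
    refine le_trans ?_ (add_le_add_right hμ _)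
    rw [← PMF.tsum_coe μ, PMF.toOuterMeasure_apply, expect, ← ENNReal.tsum_add]
    refine ENNReal.tsum_le_tsum fun a => ?_
    by_cases ha : a ∈ S
    · simp [ha]
    · simpa [ha] using mul_le_mul_right (H a ha) (μ a)
  have hS : μ.toOuterMeasure S ≠ ⊤ := by
    refine ne_top_of_le_ne_top ENNReal.one_ne_top ?_
    rw [← PMF.tsum_coe μ, PMF.toOuterMeasure_apply]
    exact ENNReal.tsum_le_tsum fun a => Set.indicator_le_self _ _ a
  have h2 := ENNReal.toReal_mono (by simp [hS]) h1
  rw [ENNReal.toReal_add hS ENNReal.ofReal_ne_top, ENNReal.toReal_ofReal hx] at h2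
  simp at h2
  linarith

end PMF

namespace QueryRAM

/-- The average of `F` over `{0, …, d - 1}`. -/
noncomputable def avg (d : ℕ) (F : ℕ → ℝ≥0∞) : ℝ≥0∞ :=
  ∑ r ∈ Finset.range d, (d : ℝ≥0∞)⁻¹ * F r

/-- Positivity of `d` matters: for `d = 0` the machine returns `0`, whereas `avg 0 F` is an empty
sum. -/
theorem expect_uniformBelow {d : ℕ} (hd : 0 < d) (F : ℕ → ℝ≥0∞) :
    (uniformBelow d).expect F = avg d F := by
  rw [uniformBelow, dif_neg hd.ne', PMF.expect, avg,
    tsum_eq_sum (s := Finset.range d)]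
  · refine Finset.sum_congr rfl fun r hr => ?_
    rw [PMF.uniformOfFinset_apply_of_mem _ hr, Finset.card_range]
  · intro r hr
    rw [PMF.uniformOfFinset_apply_of_notMem _ hr, zero_mul]

/-! ### Values of expressions without overflow -/

/-- The value of an expression if no overflow occurs. -/
def Expr.val (s : Memory) : Expr → ℕ
  | lit k => k
  | var x => s.var x
  | get a i => s.arr a (i.val s)
  | bin o e f => o.eval (e.val s) (f.val s)

/-- All values in the evaluation of an expression are less than `W`. -/
def Expr.Fits (W : ℕ) (s : Memory) : Expr → Prop
  | lit k => k < W
  | var _ => True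
  | get _ i => i.Fits W s
  | bin o e f => e.Fits W s ∧ f.Fits W s ∧ o.eval (e.val s) (f.val s) < W

/-- This removes modular arithmetic from all later arguments: they compute in ℕ, and the word length
enters only through `Fits`. -/
theorem Expr.eval_eq_val {w : ℕ} {s : Memory} {e : Expr} (h : e.Fits (2 ^ w) s) :
    e.eval w s = e.val s := by
  induction e with
  | lit k => exact Nat.mod_eq_of_lt h
  | var x => rfl
  | get a i ih => rw [eval, val, ih h]
  | bin o e f he hf => rw [eval, val, he h.1, hf h.2.1, Nat.mod_eq_of_lt h.2.2]

/-- The memory after `x := a`, if `a` is a word. -/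
def Memory.set (s : Memory) (x a : ℕ) : Memory :=
  { s with var := Function.update s.var x a }

/-- The memory after `b[i] := a`, if `a` is a word. -/
def Memory.put (s : Memory) (b i a : ℕ) : Memory :=
  { s with arr := Function.update s.arr b (Function.update (s.arr b) i a) }

@[simp] theorem Memory.set_var (s : Memory) (x a y : ℕ) :
    (s.set x a).var y = if y = x then a else s.var y := by
  simp [Memory.set, Function.update_apply]

@[simp] theorem Memory.set_arr (s : Memory) (x a : ℕ) : (s.set x a).arr = s.arr := rfl

@[simp] theorem Memory.put_var (s : Memory) (b i a : ℕ) : (s.put b i a).var = s.var := rfl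

@[simp] theorem Memory.put_arr (s : Memory) (b i a c : ℕ) :
    (s.put b i a).arr c = if c = b then Function.update (s.arr b) i a else s.arr c := by
  simp only [Memory.put, Function.update_apply]

theorem Memory.assign_eq {w x a : ℕ} (s : Memory) (h : a < 2 ^ w) : s.assign w x a = s.set x a := by
  rw [assign, set, Nat.mod_eq_of_lt h]

theorem Memory.store_eq {w b i a : ℕ} (s : Memory) (h : a < 2 ^ w) :
    s.store w b i a = s.put b i a := by
  rw [store, put, Nat.mod_eq_of_lt h]

/-! ### Expectation transformer -/

section

variable {n : ℕ} {G : SimpleGraph (Fin n)} (I : IncidenceLists G) (w : ℕ)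

/-- The expectation of `f` (a function of the final memory and of the number of unused steps)
after the execution of a stack of programs with at most `t` steps; it is infinite if with positive
probability more steps are needed. -/
noncomputable def expectRun : ℕ → List Program → Memory → (Memory → ℕ → ℝ≥0∞) → ℝ≥0∞
  | t, [], s, f => f s t
  | 0, _ :: _, _, _ => ⊤
  | t + 1, p :: K, s, f => (step I w (p :: K, s)).expect fun c => expectRun t c.1 c.2 f

/-- Only the head of the stack is inspected, so the programs waiting below it are carried along
unchanged. -/
theorem step_append (p : Program) (K K' : List Program) (s : Memory) :
    step I w (p :: (K ++ K'), s) = (step I w (p :: K, s)).map fun c => (c.1 ++ K', c.2) := by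
  cases p <;> simp [step, PMF.pure_map, PMF.map_comp, Function.comp_def]
  split_ifs <;> simp

/-- The sequencing law behind all program rules. It holds because the continuation receives the
number of unused steps and takes it as its own time limit. -/
theorem expectRun_append (t : ℕ) (K K' : List Program) (s : Memory) (f : Memory → ℕ → ℝ≥0∞) :
    expectRun I w t (K ++ K') s f =
      expectRun I w t K s fun s' t' => expectRun I w t' K' s' f := by
  induction t generalizing K s with
  | zero => cases K <;> simp [expectRun]
  | succ t ih =>
    cases K with
    | nil => simp [expectRun]
    | cons p K =>
      simp only [List.cons_append, expectRun]
      rw [step_append, PMF.expect_map]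
      simp only [ih]

/-- The run of the machine, as seen by `expectRun`. -/
theorem expect_run (t : ℕ) (K : List Program) (s : Memory) (f : Memory → ℝ≥0∞) :
    (run I w t (K, s)).expect (fun c => if c.1 = [] then f c.2 else ⊤) =
      expectRun I w t K s fun s' _ => f s' := by
  induction t generalizing K s with
  | zero => cases K <;> simp [run, expectRun, PMF.expect_pure]
  | succ t ih =>
    rw [run, PMF.expect_bind]
    cases K with
    | nil =>
      rw [step, PMF.expect_pure, ih]
      cases t <;> simp [expectRun]
    | cons p K =>
      rw [expectRun]
      congr 1
      ext c
      exact ih c.1 c.2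

/-- `expectRun` for a single program. -/
noncomputable def wp (p : Program) (f : Memory → ℕ → ℝ≥0∞) (s : Memory) (t : ℕ) : ℝ≥0∞ :=
  expectRun I w t [p] s f

theorem expectRun_singleton (p : Program) (f : Memory → ℕ → ℝ≥0∞) (s : Memory) (t : ℕ) :
    expectRun I w t [p] s f = wp I w p f s t := rfl

theorem expectRun_cons (p : Program) (K : List Program) (f : Memory → ℕ → ℝ≥0∞) (s : Memory)
    (t : ℕ) : expectRun I w t (p :: K) s f = wp I w p (fun s' t' => expectRun I w t' K s' f) s t :=
  expectRun_append I w t [p] K s f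

theorem expectRun_nil (f : Memory → ℕ → ℝ≥0∞) (s : Memory) (t : ℕ) :
    expectRun I w t [] s f = f s t := by
  cases t <;> rfl

variable (f : Memory → ℕ → ℝ≥0∞) (s : Memory) (t : ℕ)

theorem wp_succ (p : Program) : wp I w p f s (t + 1) =
    (step I w ([p], s)).expect fun c => expectRun I w t c.1 c.2 f := rfl

theorem wp_seq (p q : Program) :
    wp I w (.seq p q) f s (t + 1) = wp I w p (wp I w q f) s t := by
  rw [wp_succ, step, PMF.expect_pure, expectRun_cons]
  rfl

theorem wp_loop (e : Expr) (p : Program) :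
    wp I w (.loop e p) f s (t + 1) =
      if e.eval w s ≠ 0 then wp I w p (wp I w (.loop e p) f) s t else f s t := by
  rw [wp_succ, step, PMF.expect_pure]
  split_ifs
  · rw [expectRun_cons]
    rfl
  · rw [expectRun_nil]

theorem wp_random {x : ℕ} {e : Expr} (he : e.Fits (2 ^ w) s) (h0 : 0 < e.val s)
    (h : e.val s < 2 ^ w) :
    wp I w (.random x e) f s (t + 1) = avg (e.val s) fun a => f (s.set x a) t := by
  rw [wp_succ, step, PMF.expect_map, Expr.eval_eq_val he, expect_uniformBelow h0, avg, avg]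
  refine Finset.sum_congr rfl fun a ha => ?_
  rw [expectRun_nil, Memory.assign_eq s ((Finset.mem_range.1 ha).trans h)]


/-- Whatever the random choices, the execution of `p` from the memory `s` takes at most `t` steps,
and the final memory and the number of unused steps satisfy `Q`. -/
def Surely (p : Program) (Q : Memory → ℕ → Prop) : Prop :=
  ∀ (f : Memory → ℕ → ℝ≥0∞) (x : ℝ≥0∞), (∀ s' t', t' ≤ t → Q s' t' → f s' t' ≤ x) →
    wp I w p f s t ≤ x

variable {I w s t}

theorem Surely.mono {p : Program} {Q R : Memory → ℕ → Prop} (h : Surely I w s t p Q)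
    (hQR : ∀ s' t', t' ≤ t → Q s' t' → R s' t') : Surely I w s t p R :=
  fun f x hf => h f x fun s' t' ht hQ => hf s' t' ht (hQR s' t' ht hQ)

theorem Surely.seq {p q : Program} {Q : Memory → ℕ → Prop} (ht : 0 < t)
    (h : Surely I w s (t - 1) p fun s' t' => Surely I w s' t' q Q) :
    Surely I w s t (.seq p q) Q := by
  obtain ⟨t, rfl⟩ : ∃ t', t = t' + 1 := ⟨t - 1, by omega⟩
  intro f x hf
  rw [wp_seq]
  exact h _ _ fun s' t' ht' hq => hq f x fun s'' t'' ht'' hQ => hf s'' t'' (by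
    simp at ht'; omega) hQ

/-- No separate variant is needed: every test costs a step, so the remaining time decreases
strictly. Time bounds are written into the invariant. -/
theorem Surely.loop {e : Expr} {p : Program} {Q : Memory → ℕ → Prop} (Inv : Memory → ℕ → Prop)
    (h : ∀ s t, Inv s t → e.Fits (2 ^ w) s ∧ 0 < t ∧ (e.val s = 0 → Q s (t - 1)) ∧
      (e.val s ≠ 0 → Surely I w s (t - 1) p Inv)) (h0 : Inv s t) :
    Surely I w s t (.loop e p) Q := by
  intro f x hf
  induction t using Nat.strong_induction_on generalizing s with
  | _ t ih =>
    obtain ⟨he, ht, h1, h2⟩ := h s t h0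
    obtain ⟨t, rfl⟩ : ∃ t', t = t' + 1 := ⟨t - 1, by omega⟩
    rw [wp_loop, Expr.eval_eq_val he]
    split_ifs with hv
    · refine h2 hv _ _ fun s' t' ht' hI => ih t' (by simp at ht'; omega) hI fun s'' t'' ht'' hQ =>
          ?_
      exact hf s'' t'' (by simp at ht'; omega) hQ
    · exact hf _ _ (by omega) (h1 (by simpa using hv))

/-! ### Verification conditions for programs without loops and random choices -/

/-- The number of steps of a program without loops. -/
def Program.cost : Program → ℕ
  | .seq p q => p.cost + q.cost + 1
  | .cond _ p q => max p.cost q.cost + 1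
  | _ => 1

variable (I) in
/-- The weakest precondition of `Q` for a program without loops and random choices,
if all values are less than `W`. -/
def Program.Pre (W : ℕ) : Program → Memory → (Memory → Prop) → Prop
  | .skip, s, Q => Q s
  | .assign x e, s, Q => e.Fits W s ∧ e.val s < W ∧ Q (s.set x (e.val s))
  | .store a i e, s, Q =>
      i.Fits W s ∧ e.Fits W s ∧ e.val s < W ∧ Q (s.put a (i.val s) (e.val s))
  | .degree x v, s, Q =>
      v.Fits W s ∧ I.degreeQuery (v.val s) < W ∧ Q (s.set x (I.degreeQuery (v.val s)))
  | .neighbor x v i, s, Q => v.Fits W s ∧ i.Fits W s ∧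
      I.neighborQuery (v.val s) (i.val s) < W ∧
      Q (s.set x (I.neighborQuery (v.val s) (i.val s)))
  | .seq p q, s, Q => p.Pre W s fun s' => q.Pre W s' Q
  | .cond e p q, s, Q => e.Fits W s ∧ (e.val s ≠ 0 → p.Pre W s Q) ∧ (e.val s = 0 → q.Pre W s Q)
  | .random _ _, _, _ => False
  | .loop _ _, _, _ => False

theorem Surely.of_step {p : Program} {Q : Memory → ℕ → Prop} {s' : Memory}
    (h : step I w ([p], s) = PMF.pure ([], s')) (ht : 1 ≤ t) (hQ : Q s' (t - 1)) :
    Surely I w s t p Q := by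
  intro f x hf
  obtain ⟨t, rfl⟩ : ∃ t', t = t' + 1 := ⟨t - 1, by omega⟩
  rw [wp_succ, h, PMF.expect_pure, expectRun_nil]
  exact hf _ _ (by omega) hQ

theorem Surely.cond {e : Expr} {p q : Program} {Q : Memory → ℕ → Prop} (he : e.Fits (2 ^ w) s)
    (ht : 0 < t) (hp : e.val s ≠ 0 → Surely I w s (t - 1) p Q)
    (hq : e.val s = 0 → Surely I w s (t - 1) q Q) : Surely I w s t (.cond e p q) Q := by
  intro f x hf
  obtain ⟨t, rfl⟩ : ∃ t', t = t' + 1 := ⟨t - 1, by omega⟩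
  rw [wp_succ, step, PMF.expect_pure, Expr.eval_eq_val he, expectRun_singleton]
  split_ifs with h
  · exact hp h f x fun s' t' ht' => hf s' t' (by omega)
  · exact hq (by simpa using h) f x fun s' t' ht' => hf s' t' (by omega)

/-- Loop-free code is verified by unfolding `Program.Pre`; its time is bounded syntactically by
`Program.cost`. -/
theorem Surely.of_pre {p : Program} {Q : Memory → ℕ → Prop} (R : Memory → Prop)
    (h : p.Pre I (2 ^ w) s R) (ht : p.cost ≤ t) (hR : ∀ s' t', R s' → t ≤ t' + p.cost → Q s' t') :
    Surely I w s t p Q := by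
  induction p generalizing s t Q R with
  | skip => exact .of_step rfl ht (hR _ _ h (Nat.le_add_of_sub_le le_rfl))
  | assign x e =>
    refine .of_step ?_ ht (hR _ _ h.2.2 (Nat.le_add_of_sub_le le_rfl))
    rw [step, Expr.eval_eq_val h.1, Memory.assign_eq _ h.2.1]
  | store a i e =>
    refine .of_step ?_ ht (hR _ _ h.2.2.2 (Nat.le_add_of_sub_le le_rfl))
    rw [step, Expr.eval_eq_val h.1, Expr.eval_eq_val h.2.1, Memory.store_eq _ h.2.2.1]
  | degree x v =>
    refine .of_step ?_ ht (hR _ _ h.2.2 (Nat.le_add_of_sub_le le_rfl))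
    rw [step, Expr.eval_eq_val h.1, Memory.assign_eq _ h.2.1]
  | neighbor x v i =>
    refine .of_step ?_ ht (hR _ _ h.2.2.2 (Nat.le_add_of_sub_le le_rfl))
    rw [step, Expr.eval_eq_val h.1, Expr.eval_eq_val h.2.1, Memory.assign_eq _ h.2.2.1]
  | random => exact h.elim
  | loop => exact h.elim
  | seq p q hp hq =>
    simp only [Program.cost] at ht hR
    refine .seq (by omega) (hp (fun s' => q.Pre I (2 ^ w) s' R) h (by omega) fun s' t' hs ht' => ?_)
    exact hq R hs (by omega) fun s'' t'' h1 h2 => hR _ _ h1 (by omega)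
  | cond e p q hp hq =>
    simp only [Program.cost] at ht hR
    refine .cond h.1 (by omega) (fun he => ?_) fun he => ?_
    · exact hp R (h.2.1 he) (by omega) fun s' t' h1 h2 => hR _ _ h1 (by omega)
    · exact hq R (h.2.2 he) (by omega) fun s' t' h1 h2 => hR _ _ h1 (by omega)

end

/-! ### Graphs given by lists of natural numbers -/

open scoped Classical in
/-- The number of entries of a list that belong to `S`. -/
noncomputable def hits (l : List ℕ) (S : Set ℕ) : ℕ := l.countP (· ∈ S)

@[simp] theorem hits_nil (S : Set ℕ) : hits [] S = 0 := rfl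

open scoped Classical in
theorem hits_cons (a : ℕ) (l : List ℕ) (S : Set ℕ) :
    hits (a :: l) S = hits l S + if a ∈ S then 1 else 0 := by
  simp [hits, List.countP_cons]

theorem hits_mono (l : List ℕ) {S T : Set ℕ} (h : ∀ a ∈ l, a ∈ S → a ∈ T) :
    hits l S ≤ hits l T :=
  List.countP_mono_left fun a ha hS => by simpa using h a ha (by simpa using hS)

theorem hits_congr (l : List ℕ) {S T : Set ℕ} (h : ∀ a ∈ l, a ∈ S ↔ a ∈ T) :
    hits l S = hits l T :=
  le_antisymm (hits_mono l fun a ha hS => (h a ha).1 hS) (hits_mono l fun a ha hT => (h a ha).2 hT)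

theorem hits_le_length (l : List ℕ) (S : Set ℕ) : hits l S ≤ l.length := List.countP_le_length

theorem hits_univ (l : List ℕ) : hits l Set.univ = l.length := by
  simp [hits]

theorem hits_union (l : List ℕ) {S T : Set ℕ} (h : Disjoint S T) :
    hits l (S ∪ T) = hits l S + hits l T := by
  induction l with
  | nil => rfl
  | cons a l ih =>
    have := fun hS : a ∈ S => Set.disjoint_left.1 h hS
    by_cases h1 : a ∈ S <;> by_cases h2 : a ∈ T <;> simp_all [hits_cons] <;> try omega

open scoped Classical in
theorem hits_eq_sum {n : ℕ} {l : List ℕ} (hl : l.Nodup) (hn : ∀ a ∈ l, a < n) (S : Set ℕ) :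
    hits l S = ∑ a ∈ Finset.range n, if a ∈ l ∧ a ∈ S then 1 else 0 := by
  rw [← Finset.card_filter, hits, List.countP_eq_length_filter,
    ← List.toFinset_card_of_nodup (hl.filter _)]
  congr 1
  ext a
  simp only [List.mem_toFinset, List.mem_filter, decide_eq_true_eq, Finset.mem_filter,
    Finset.mem_range]
  exact ⟨fun h => ⟨hn a h.1, h⟩, fun h => h.2⟩

/-- `nb` lists the neighbours of the nodes of a simple graph with node set `{0, …, n - 1}`, and
`c` is its core number function. -/
structure IsCoreGraph (n : ℕ) (nb : ℕ → List ℕ) (c : ℕ → ℕ) : Prop where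
  lt : ∀ v, ∀ u ∈ nb v, u < n
  nodup : ∀ v, (nb v).Nodup
  symm : ∀ v, ∀ u ∈ nb v, v ∈ nb u
  core : ∀ v < n, ∀ k, k ≤ c v ↔ ∃ S : Set ℕ, v ∈ S ∧ ∀ u ∈ S, u < n ∧ k ≤ hits (nb u) S

namespace IsCoreGraph

variable {n : ℕ} {nb : ℕ → List ℕ} {c : ℕ → ℕ} (hG : IsCoreGraph n nb c)
include hG

theorem le_core_of_stable {S : Set ℕ} {k : ℕ} (hS : ∀ u ∈ S, u < n ∧ k ≤ hits (nb u) S) {v : ℕ}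
    (hv : v ∈ S) : k ≤ c v :=
  (hG.core v (hS v hv).1 k).2 ⟨S, hv, hS⟩

/-- All members of a stable set that witnesses `k ≤ c v` have core number at least `k` themselves,
so the witness can be enlarged to the set of all such nodes, which does not depend on `v`. -/
theorem le_hits_core {v k : ℕ} (hv : v < n) (hk : k ≤ c v) :
    k ≤ hits (nb v) {u | u < n ∧ k ≤ c u} := by
  obtain ⟨S, hvS, hS⟩ := (hG.core v hv k).1 hk
  exact (hS v hvS).2.trans (hits_mono _ fun a _ ha => ⟨(hS a ha).1, hG.le_core_of_stable hS ha⟩)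

theorem core_le_length {v : ℕ} (hv : v < n) : c v ≤ (nb v).length :=
  (hG.le_hits_core hv le_rfl).trans (hits_le_length _ _)

theorem length_le (v : ℕ) : (nb v).length ≤ n := by
  have h := (List.subperm_of_subset (hG.nodup v)
    (fun u hu => List.mem_range.2 (hG.lt v u hu))).length_le
  simpa using h

theorem one_le_core {v : ℕ} (hd : 0 < (nb v).length) : 1 ≤ c v := by
  obtain ⟨u, hu⟩ := List.exists_mem_of_length_pos hd
  have hvu := hG.symm v u hu
  refine hG.le_core_of_stable (S := {v, u}) ?_ (by simp)
  intro x hx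
  have key : ∀ l : List ℕ, ∀ a ∈ l, a ∈ ({v, u} : Set ℕ) → 1 ≤ hits l {v, u} := by
    intro l a ha haS
    exact List.countP_pos_iff.2 ⟨a, ha, by simpa using haS⟩
  rcases hx with rfl | rfl
  · exact ⟨hG.lt _ _ hvu, key _ _ hu (by simp)⟩
  · exact ⟨hG.lt _ _ hu, key _ _ hvu (by simp)⟩

/-- Peeling one node at a time: some node of minimum core number in `W` has at most that many
neighbours in `W`. It comes first, and the rest is ordered by induction. -/
theorem exists_order (W : Finset ℕ) (hW : ∀ v ∈ W, v < n) : ∃ ρ : ℕ → ℕ, ∀ v ∈ W,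
    hits (nb v) {u | u ∈ W ∧ ρ v ≤ ρ u} ≤ c v ∧ ∀ u ∈ W, ρ u ≤ ρ v → c u ≤ c v := by
  induction hm : W.card generalizing W with
  | zero =>
    rw [Finset.card_eq_zero] at hm
    exact ⟨id, by simp [hm]⟩
  | succ m ih =>
    have hne : W.Nonempty := Finset.card_pos.1 (by omega)
    obtain ⟨x, hx, hmin⟩ := W.exists_min_image c hne
    obtain ⟨v, hv, hcv, hdeg⟩ : ∃ v ∈ W, c v = c x ∧ hits (nb v) W ≤ c v := by
      by_contra! hcon
      have : c x + 1 ≤ c x := by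
        -- If every node of minimum core number had more neighbours in `W` than this minimum, then
        -- `W` together with all nodes of larger core number would be stable one level higher.
        refine hG.le_core_of_stable (S := (W : Set ℕ) ∪ {u | u < n ∧ c x + 1 ≤ c u}) ?_
          (Or.inl hx)
        have high : ∀ u, u < n → c x + 1 ≤ c u →
            c x + 1 ≤ hits (nb u) ((W : Set ℕ) ∪ {u | u < n ∧ c x + 1 ≤ c u}) :=
          fun u h1 h2 => (hG.le_hits_core h1 h2).trans (hits_mono _ fun a _ ha => Or.inr ha)
        rintro u (hu | hu)
        · refine ⟨hW u hu, ?_⟩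
          rcases (hmin u hu).eq_or_lt with h | h
          · have h1 := hcon u hu h.symm
            have h2 := hits_mono (nb u) (S := W)
              (T := (W : Set ℕ) ∪ {u | u < n ∧ c x + 1 ≤ c u}) fun a _ ha => Or.inl ha
            omega
          · exact high u (hW u hu) h
        · exact ⟨hu.1, high u hu.1 hu.2⟩
      omega
    obtain ⟨ρ, hρ⟩ := ih (W.erase v) (fun u hu => hW u (Finset.mem_of_mem_erase hu))
      (by rw [Finset.card_erase_of_mem hv]; omega)
    -- Position `0` is reserved for `v`; the shift keeps it strictly before all other nodes of `W`.
    refine ⟨fun u => if u = v then 0 else ρ u + 1, fun u hu => ?_⟩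
    by_cases huv : u = v
    · subst huv
      refine ⟨?_, ?_⟩
      · simpa using hdeg
      · intro y hy hle
        simp only [if_true] at hle
        split_ifs at hle with h
        · rw [h]
        · omega
    · have hu' : u ∈ W.erase v := Finset.mem_erase.2 ⟨huv, hu⟩
      refine ⟨(hits_mono _ ?_).trans (hρ u hu').1, ?_⟩
      · rintro a - ⟨ha1, ha2⟩
        simp only [huv, if_false] at ha2
        split_ifs at ha2 with h
        · omega
        · exact ⟨Finset.mem_erase.2 ⟨h, ha1⟩, by omega⟩
      · intro y hy hle
        simp only [huv, if_false] at hle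
        split_ifs at hle with h
        · rw [h, hcv]
          exact hmin u hu
        · exact (hρ u hu').2 y (Finset.mem_erase.2 ⟨h, hy⟩) (by omega)

/-- A degeneracy order along which the core numbers are monotone. -/
theorem exists_degeneracy_order : ∃ ρ : ℕ → ℕ, ∀ v < n,
    hits (nb v) {u | ρ v ≤ ρ u} ≤ c v ∧ ∀ u < n, ρ u ≤ ρ v → c u ≤ c v := by
  obtain ⟨ρ, hρ⟩ := hG.exists_order (Finset.range n) (by simp)
  refine ⟨ρ, fun v hv => ?_⟩
  have h := hρ v (by simpa using hv)
  refine ⟨le_trans (hits_mono _ fun a ha h' => ?_) h.1, fun u hu => h.2 u (by simpa using hu)⟩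
  exact ⟨by simpa using hG.lt v a ha, h'⟩

/-- Charge each edge to the endpoint that comes first in the degeneracy order. The core number is
smaller there, so its reciprocal dominates both contributions of the edge. As `v` has at most `c v`
neighbours that do not precede it, the charges at `v` sum to at most `1` for each of the two
directions. -/
theorem sum_div_core_le :
    ∑ v ∈ Finset.range n, ((nb v).length : ℝ) / c v ≤ 2 * n := by
  classical
  obtain ⟨ρ, hρ⟩ := hG.exists_degeneracy_order
  set A : ℕ → ℕ → ℝ := fun v u => if u ∈ nb v ∧ ρ v ≤ ρ u then (c v : ℝ)⁻¹ else 0 with hA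
  have hA0 : ∀ v u, 0 ≤ A v u := fun v u => by simp only [hA]; split_ifs <;> positivity
  have h1 : ∀ v ∈ Finset.range n, ∑ u ∈ Finset.range n, A v u ≤ 1 := by
    intro v hv
    have h2 := (hρ v (by simpa using hv)).1
    rw [hits_eq_sum (hG.nodup v) (hG.lt v)] at h2
    have h3 : ∑ u ∈ Finset.range n, A v u =
        (c v : ℝ)⁻¹ * (∑ u ∈ Finset.range n, if u ∈ nb v ∧ u ∈ {u | ρ v ≤ ρ u} then 1 else 0 : ℕ)
          := by
      push_cast
      rw [Finset.mul_sum]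
      refine Finset.sum_congr rfl fun u _ => ?_
      simp [hA]
    rw [h3]
    refine (mul_le_mul_of_nonneg_left (Nat.cast_le.2 ?_) (by positivity)).trans
      (inv_mul_le_one (a := (c v : ℝ)))
    -- The two sides differ only in the instances that decide membership.
    convert h2
  have h2 : ∀ v ∈ Finset.range n, ((nb v).length : ℝ) / c v ≤
      ∑ u ∈ Finset.range n, (A v u + A u v) := by
    intro v hv
    rw [← hits_univ, hits_eq_sum (hG.nodup v) (hG.lt v), div_eq_mul_inv]
    push_cast
    rw [Finset.sum_mul]
    refine Finset.sum_le_sum fun u hu => ?_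
    by_cases huv : u ∈ nb v
    · have hvu := hG.symm v u huv
      rcases le_total (ρ v) (ρ u) with h | h
      · have := hA0 u v
        have h4 : A v u = (c v : ℝ)⁻¹ := by simp [hA, huv, h]
        simp [huv]
        linarith
      · have := hA0 v u
        have h4 : A u v = (c u : ℝ)⁻¹ := by simp [hA, hvu, h]
        have h5 : c u ≤ c v := (hρ v (by simpa using hv)).2 u (by simpa using hu) h
        have h6 : 1 ≤ c u := hG.one_le_core (List.length_pos_of_mem hvu)
        have h7 : (c v : ℝ)⁻¹ ≤ (c u : ℝ)⁻¹ := by gcongr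
        simp [huv]
        linarith
    · simpa [huv] using add_nonneg (hA0 v u) (hA0 u v)
  calc _ ≤ ∑ v ∈ Finset.range n, ∑ u ∈ Finset.range n, (A v u + A u v) := Finset.sum_le_sum h2
    _ = 2 * ∑ v ∈ Finset.range n, ∑ u ∈ Finset.range n, A v u := by
      simp only [Finset.sum_add_distrib]
      rw [Finset.sum_comm (f := fun v u => A u v)]
      ring
    _ ≤ 2 * ∑ v ∈ Finset.range n, (1 : ℝ) := by
      gcongr with v hv
      exact h1 v hv
    _ = 2 * n := by simp

end IsCoreGraph

/-! ### The lists and core numbers of a graph on `Fin n` -/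

section Bridge

variable {n : ℕ} {G : SimpleGraph (Fin n)}

/-- In a stable set, the component of `v` is connected and its nodes lose no neighbours, since
adjacent nodes of the set share a component. By finiteness this component extends to a maximal set
of the same kind, that is, to a core. -/
theorem le_coreNumber_iff (v : Fin n) (k : ℕ) :
    k ≤ G.coreNumber v ↔ ∃ S : Set (Fin n), v ∈ S ∧ ∀ u ∈ S, k ≤ (G.neighborSet u ∩ S).ncard := by
  have hg := G.isGreatest_coreNumber v
  constructor
  · intro hk
    obtain ⟨S, hS, hv⟩ := hg.1
    exact ⟨S, hv, fun u hu => hk.trans (hS.prop.2 u hu)⟩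
  · rintro ⟨S, hv, hS⟩
    let C := (G.induce S).connectedComponentMk ⟨v, hv⟩
    let T : Set (Fin n) := Subtype.val '' C.supp
    have hT : (G.induce T).Connected := by
      let φ : C.toSimpleGraph →g G.induce T :=
        { toFun := fun x => ⟨x.1.1, x.1, x.2, rfl⟩
          map_rel' := fun {a b} h => h }
      refine SimpleGraph.Connected.map φ ?_ C.connected_toSimpleGraph
      rintro ⟨_, x, hx, rfl⟩
      exact ⟨⟨x, hx⟩, rfl⟩
    have hmin : ∀ u ∈ T, k ≤ (G.neighborSet u ∩ T).ncard := by
      rintro _ ⟨u, hu, rfl⟩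
      refine (hS u u.2).trans (Set.ncard_le_ncard ?_ (Set.toFinite _))
      rintro x ⟨hx, hxS⟩
      refine ⟨hx, ⟨x, hxS⟩, ?_, rfl⟩
      have : (G.induce S).Adj u ⟨x, hxS⟩ := hx
      exact (C.mem_supp_congr_adj this).1 hu
    obtain ⟨U, hle, hU⟩ := (Set.toFinite
      {T : Set (Fin n) | (G.induce T).Connected ∧
        ∀ u ∈ T, k ≤ (G.neighborSet u ∩ T).ncard}).exists_le_maximal ⟨hT, hmin⟩
    exact hg.2 ⟨U, hU, hle ⟨⟨v, hv⟩, rfl, rfl⟩⟩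

/-- The list of neighbours of `v`, as natural numbers. -/
def nbrs (I : IncidenceLists G) (v : ℕ) : List ℕ :=
  if h : v < n then (I.list ⟨v, h⟩).map Fin.val else []

/-- The core number of `v`, as a function on the natural numbers. -/
noncomputable def coreFun (G : SimpleGraph (Fin n)) (v : ℕ) : ℕ :=
  if h : v < n then G.coreNumber ⟨v, h⟩ else 0

theorem degreeQuery_eq (I : IncidenceLists G) (v : ℕ) :
    I.degreeQuery v = (nbrs I v).length := by
  unfold IncidenceLists.degreeQuery nbrs
  split_ifs <;> simp

theorem neighborQuery_eq (I : IncidenceLists G) (v i : ℕ) :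
    I.neighborQuery v i = (nbrs I v).getD i 0 := by
  unfold IncidenceLists.neighborQuery nbrs
  split_ifs with h1 h2
  · simp [h2]
  · simp [h2]
  · simp

theorem mem_nbrs (I : IncidenceLists G) (v u : Fin n) : (u : ℕ) ∈ nbrs I v ↔ G.Adj v u := by
  simp [nbrs, I.mem_list, Fin.val_inj]

theorem hits_nbrs (I : IncidenceLists G) (v : Fin n) (S : Set ℕ) :
    hits (nbrs I v) S = (G.neighborSet v ∩ {u | (u : ℕ) ∈ S}).ncard := by
  classical
  have : G.neighborSet v ∩ {u | (u : ℕ) ∈ S} =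
      (((I.list v).filter fun u : Fin n => decide ((u : ℕ) ∈ S)).toFinset : Set (Fin n)) := by
    ext u
    simp [I.mem_list]
  rw [this, Set.ncard_coe_finset, List.toFinset_card_of_nodup ((I.nodup v).filter _)]
  simp only [hits, nbrs, v.2, dif_pos, List.countP_map, ← List.countP_eq_length_filter]
  rfl

theorem isCoreGraph (I : IncidenceLists G) : IsCoreGraph n (nbrs I) (coreFun G) where
  lt v u hu := by
    unfold nbrs at hu
    split_ifs at hu
    · obtain ⟨x, -, rfl⟩ := List.mem_map.1 hu
      exact x.2
    · simp at hu
  nodup v := by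
    unfold nbrs
    split_ifs
    · exact (I.nodup _).map Fin.val_injective
    · simp
  symm v u hu := by
    unfold nbrs at hu
    split_ifs at hu with h
    · obtain ⟨x, hx, rfl⟩ := List.mem_map.1 hu
      exact (mem_nbrs I x ⟨v, h⟩).2 ((I.mem_list _ _).1 hx).symm
    · simp at hu
  core v hv k := by
    rw [coreFun, dif_pos hv, le_coreNumber_iff]
    constructor
    · rintro ⟨S, hvS, hS⟩
      refine ⟨Fin.val '' S, ⟨_, hvS, rfl⟩, ?_⟩
      rintro _ ⟨u, hu, rfl⟩
      refine ⟨u.2, ?_⟩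
      rw [hits_nbrs]
      simpa [Fin.val_inj] using hS u hu
    · rintro ⟨S, hvS, hS⟩
      exact ⟨{u | (u : ℕ) ∈ S}, hvS, fun u hu => by simpa [hits_nbrs] using (hS u hu).2⟩

theorem sum_length_nbrs (I : IncidenceLists G) :
    ∑ v ∈ Finset.range n, (nbrs I v).length = 2 * G.edgeSet.ncard := by
  classical
  rw [Finset.sum_range]
  have : ∀ v : Fin n, (nbrs I v).length = G.degree v := by
    intro v
    rw [← hits_univ, hits_nbrs, ← SimpleGraph.card_neighborSet_eq_degree, ←
      Nat.card_eq_fintype_card]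
    simp [Set.ncard_def, Set.encard, Nat.card]
  simp only [this]
  rw [SimpleGraph.sum_degrees_eq_twice_card_edges, ← SimpleGraph.coe_edgeFinset,
    Set.ncard_coe_finset]

end Bridge

/-! ### Samples of neighbours -/

/-- Only an inequality, because the average over an empty range is `0`. The same defect appears in
`sampleExpect` for nodes without neighbours; upper bounds are all that is needed. -/
theorem avg_const_le (d : ℕ) (x : ℝ≥0∞) : avg d (fun _ => x) ≤ x := by
  rw [avg, Finset.sum_const, Finset.card_range, nsmul_eq_mul, ← mul_assoc]
  exact mul_le_of_le_one_left (zero_le) (ENNReal.mul_inv_le_one _)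

theorem avg_mono {d : ℕ} {F H : ℕ → ℝ≥0∞} (h : ∀ r < d, F r ≤ H r) : avg d F ≤ avg d H :=
  Finset.sum_le_sum fun r hr => mul_le_mul_right (h r (Finset.mem_range.1 hr)) _

theorem avg_add (d : ℕ) (F H : ℕ → ℝ≥0∞) : avg d (fun r => F r + H r) = avg d F + avg d H := by
  simp only [avg, mul_add, Finset.sum_add_distrib]

theorem avg_const_mul (d : ℕ) (x : ℝ≥0∞) (F : ℕ → ℝ≥0∞) :
    avg d (fun r => x * F r) = x * avg d F := by
  simp only [avg, Finset.mul_sum, mul_left_comm]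

/-- The expectation of `F` after a uniformly random neighbour of each node of a list has been
drawn. The pairs of a node and its neighbour are collected in the list `cs`. -/
noncomputable def sampleExpect (nb : ℕ → List ℕ) :
    List ℕ → List (ℕ × ℕ) → (List (ℕ × ℕ) → ℝ≥0∞) → ℝ≥0∞
  | [], cs, F => F cs
  | v :: vs, cs, F =>
      avg (nb v).length fun r => sampleExpect nb vs ((v, (nb v).getD r 0) :: cs) F

section

variable {nb : ℕ → List ℕ}

theorem sampleExpect_append (vs vs' : List ℕ) (cs : List (ℕ × ℕ)) (F : List (ℕ × ℕ) → ℝ≥0∞) :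
    sampleExpect nb (vs ++ vs') cs F =
      sampleExpect nb vs cs fun cs' => sampleExpect nb vs' cs' F := by
  induction vs generalizing cs with
  | nil => rfl
  | cons v vs ih => simp only [List.cons_append, sampleExpect, ih]

theorem sampleExpect_mono (vs : List ℕ) (cs : List (ℕ × ℕ)) {F H : List (ℕ × ℕ) → ℝ≥0∞}
    (h : ∀ cs, F cs ≤ H cs) : sampleExpect nb vs cs F ≤ sampleExpect nb vs cs H := by
  induction vs generalizing cs with
  | nil => exact h cs
  | cons v vs ih => exact avg_mono fun r _ => ih _

theorem sampleExpect_const_le (vs : List ℕ) (cs : List (ℕ × ℕ)) (x : ℝ≥0∞) :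
    sampleExpect nb vs cs (fun _ => x) ≤ x := by
  induction vs generalizing cs with
  | nil => exact le_rfl
  | cons v vs ih => exact (avg_mono fun r _ => ih _).trans (avg_const_le _ _)

theorem sampleExpect_add (vs : List ℕ) (cs : List (ℕ × ℕ)) (F H : List (ℕ × ℕ) → ℝ≥0∞) :
    sampleExpect nb vs cs (fun cs => F cs + H cs) =
      sampleExpect nb vs cs F + sampleExpect nb vs cs H := by
  induction vs generalizing cs with
  | nil => rfl
  | cons v vs ih => simp only [sampleExpect, ih, avg_add]

theorem sampleExpect_const_mul (vs : List ℕ) (cs : List (ℕ × ℕ)) (x : ℝ≥0∞)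
    (F : List (ℕ × ℕ) → ℝ≥0∞) :
    sampleExpect nb vs cs (fun cs => x * F cs) = x * sampleExpect nb vs cs F := by
  induction vs generalizing cs with
  | nil => rfl
  | cons v vs ih => simp only [sampleExpect, ih, avg_const_mul]

theorem sampleExpect_sum {ι : Type*} (A : Finset ι) (vs : List ℕ) (cs : List (ℕ × ℕ))
    (F : ι → List (ℕ × ℕ) → ℝ≥0∞) :
    sampleExpect nb vs cs (fun cs => ∑ i ∈ A, F i cs) ≤
      ∑ i ∈ A, sampleExpect nb vs cs (F i) := by
  classical
  induction A using Finset.induction_on with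
  | empty => simpa using sampleExpect_const_le vs cs 0
  | insert i A hi ih =>
    simp only [Finset.sum_insert hi, sampleExpect_add]
    gcongr

/-- The second components of the pairs with first component `v`. -/
def targets : List (ℕ × ℕ) → ℕ → List ℕ
  | [], _ => []
  | c :: cs, v => if c.1 = v then c.2 :: targets cs v else targets cs v

-- The samples are independent, so the generating function of the number of hits is bounded by a
-- product: every sample of `v` contributes at most `y`, and samples of other nodes do not affect
-- the count.
open scoped Classical in
theorem sampleExpect_pow_hits_le (v : ℕ) (S : Set ℕ) {x y : ℝ≥0∞}
    (hy : avg (nb v).length (fun r => if (nb v).getD r 0 ∈ S then x else 1) ≤ y) (vs : List ℕ)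
    (cs : List (ℕ × ℕ)) :
    sampleExpect nb vs cs (fun cs => x ^ hits (targets cs v) S) ≤
      x ^ hits (targets cs v) S * y ^ vs.count v := by
  induction vs generalizing cs with
  | nil => simp [sampleExpect]
  | cons u vs ih =>
    rw [sampleExpect]
    refine (avg_mono fun r _ => ih _).trans ?_
    by_cases huv : u = v
    · subst huv
      have : ∀ r, x ^ hits (targets ((u, (nb u).getD r 0) :: cs) u) S * y ^ vs.count u =
          x ^ hits (targets cs u) S * y ^ vs.count u *
            if (nb u).getD r 0 ∈ S then x else 1 := by
        intro r
        simp only [targets, if_true, hits_cons]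
        split_ifs <;> ring
      simp only [this, avg_const_mul, List.count_cons_self, pow_succ]
      rw [← mul_assoc]
      gcongr
    · simp only [targets, huv, if_false, List.count_cons_of_ne huv]
      exact avg_const_le _ _

open scoped Classical in
theorem sum_getD_mem (l : List ℕ) (S : Set ℕ) (x : ℝ) :
    ∑ r ∈ Finset.range l.length, (if l.getD r 0 ∈ S then x else 1) =
      l.length + hits l S * (x - 1) := by
  induction l with
  | nil => simp
  | cons a l ih =>
    rw [List.length_cons, Finset.sum_range_succ']
    simp only [List.getD_cons_succ, List.getD_cons_zero, ih, hits_cons]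
    split_ifs <;> push_cast <;> ring

open scoped Classical in
/-- An exponential tail bound: the probability of an event that forces `z ≤ x ^ h` for the
number `h` of samples of `v` in `S`. -/
theorem sampleExpect_tail_le (v : ℕ) (S : Set ℕ) (vs : List ℕ) {x : ℝ} (hx : 0 < x) {z η : ℝ}
    (hz : 0 < z) (bad : ℕ → Prop) [DecidablePred bad] (hbad : ∀ h, bad h → z ≤ x ^ h)
    (hη : Real.exp (hits (nb v) S / (nb v).length * (x - 1) * vs.count v) ≤ η * z) :
    sampleExpect nb vs [] (fun cs => if bad (hits (targets cs v) S) then 1 else 0) ≤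
      ENNReal.ofReal η := by
  set q : ℝ := hits (nb v) S / (nb v).length * (x - 1) with hq
  have h1 : sampleExpect nb vs [] (fun cs => ENNReal.ofReal x ^ hits (targets cs v) S) ≤
      ENNReal.ofReal (Real.exp q) ^ vs.count v := by
    have := sampleExpect_pow_hits_le (nb := nb) v S (x := ENNReal.ofReal x)
      (y := ENNReal.ofReal (Real.exp q)) ?_ vs []
    · simpa [targets] using this
    · rcases Nat.eq_zero_or_pos (nb v).length with h0 | h0
      · simp [avg, h0]
      have h0' : (0 : ℝ) < (nb v).length := by exact_mod_cast h0
      have : avg (nb v).length (fun r => if (nb v).getD r 0 ∈ S then ENNReal.ofReal x else 1) =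
          ENNReal.ofReal (((nb v).length : ℝ)⁻¹ *
            ∑ r ∈ Finset.range (nb v).length, if (nb v).getD r 0 ∈ S then x else 1) := by
        rw [avg, Finset.mul_sum, ENNReal.ofReal_sum_of_nonneg]
        · refine Finset.sum_congr rfl fun r _ => ?_
          rw [ENNReal.ofReal_mul (by positivity), ENNReal.ofReal_inv_of_pos h0',
            ENNReal.ofReal_natCast]
          split_ifs <;> simp
        · intro r _
          split_ifs <;> positivity
      rw [this, sum_getD_mem]
      refine ENNReal.ofReal_le_ofReal ?_
      have h2 : ((nb v).length : ℝ)⁻¹ * ((nb v).length + hits (nb v) S * (x - 1)) = q + 1 := by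
        rw [hq]
        field_simp
        ring
      rw [h2]
      exact Real.add_one_le_exp q
  -- Markov's inequality for `x ^ h`, multiplied by the positive number `z`, which is cancelled at
  -- the end. The same argument serves the lower tail (`x < 1`) and the upper tail (`x > 1`).
  have h2 : ENNReal.ofReal z *
      sampleExpect nb vs [] (fun cs => if bad (hits (targets cs v) S) then 1 else 0) ≤
        ENNReal.ofReal z * ENNReal.ofReal η := by
    rw [← sampleExpect_const_mul]
    refine (sampleExpect_mono vs [] fun cs => ?_).trans (h1.trans ?_)
    · split_ifs with h
      · rw [mul_one, ← ENNReal.ofReal_pow hx.le]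
        exact ENNReal.ofReal_le_ofReal (hbad _ h)
      · simp
    · rw [← ENNReal.ofReal_pow (Real.exp_pos _).le, ← Real.exp_nat_mul, ← ENNReal.ofReal_mul hz.le]
      refine ENNReal.ofReal_le_ofReal ?_
      rw [mul_comm z, mul_comm _ q]
      exact hη
  exact (ENNReal.mul_le_mul_iff_right (by simpa using hz) ENNReal.ofReal_ne_top).1 h2

/-- From `1 + y ≤ exp y` at `y = δ + 2 δ²`, because `(1 - δ) (1 + δ + 2 δ²) = 1 + δ² (1 - 2 δ)`. -/
theorem exp_le_one_sub {δ : ℝ} (h0 : 0 ≤ δ) (h1 : δ ≤ 1 / 2) :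
    Real.exp (-(δ + 2 * δ ^ 2)) ≤ 1 - δ := by
  rw [Real.exp_neg, inv_le_comm₀ (Real.exp_pos _) (by linarith)]
  have h2 := Real.add_one_le_exp (δ + 2 * δ ^ 2)
  refine le_trans ?_ h2
  rw [inv_le_iff_one_le_mul₀ (by linarith)]
  nlinarith [mul_nonneg h0 h0, mul_nonneg (mul_nonneg h0 h0) (by linarith : (0:ℝ) ≤ 1 - 2 * δ)]

/-- From `1 + y ≤ exp y` at `y = -(δ - δ²)`, because `(1 + δ) (1 - δ + δ²) = 1 + δ³`. For `δ ≥ 1`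
the left side is at most `1`. -/
theorem exp_le_one_add {δ : ℝ} (h0 : 0 ≤ δ) : Real.exp (δ - δ ^ 2) ≤ 1 + δ := by
  have h2 := Real.add_one_le_exp (-(δ - δ ^ 2))
  rw [Real.exp_neg] at h2
  have h3 := Real.exp_pos (δ - δ ^ 2)
  by_cases h1 : δ < 1
  · have h4 : 0 < -(δ - δ ^ 2) + 1 := by nlinarith
    have h5 := (le_inv_comm₀ h4 h3).1 h2
    refine h5.trans ?_
    rw [inv_le_iff_one_le_mul₀ h4]
    nlinarith [mul_nonneg h0 (mul_nonneg h0 h0)]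
  · have : Real.exp (δ - δ ^ 2) ≤ Real.exp 0 := Real.exp_le_exp.2 (by nlinarith)
    rw [Real.exp_zero] at this
    linarith

end

/-! ### Parameters -/

/-- Scale of the sample sizes, for accuracy `1 / b`, confidence `p` and `g ≥ log n`. -/
def scale (b p g : ℕ) : ℕ := 8 * (2 * b + 1) * (p + 3) * g

/-- The expected number of samples that hit a set of `k` neighbours at level `k`. -/
def rate (b p g : ℕ) : ℕ := 2 * (b + 1) * scale b p g

/-- The peeling threshold. -/
def threshold (b p g : ℕ) : ℕ := (2 * b + 1) * scale b p g

/-- The total number of samples. -/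
def budget (n b p g : ℕ) : ℕ := 8 * rate b p g * (b + 2) * n

/-- The level after `k`. -/
def nextLevel (b k : ℕ) : ℕ := k - 1 - k / (b + 2)

/-- The failure probability for one node at one level. -/
noncomputable def failure (p g : ℕ) : ℝ := Real.exp (-((p + 3) * g))

theorem nextLevel_lt {b k : ℕ} (hk : k ≠ 0) : nextLevel b k < k := by
  unfold nextLevel
  generalize k / (b + 2) = q
  omega

/-- The number of levels from `k` on. -/
def numLevels (b k : ℕ) : ℕ := if h : k = 0 then 0 else numLevels b (nextLevel b k) + 1
termination_by k
decreasing_by exact nextLevel_lt h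

theorem cast_div_lt_div_add_one (m k : ℕ) : (m : ℝ) / k < (m / k : ℕ) + 1 := by
  rw [← Nat.floor_div_eq_div (K := ℝ)]
  exact Nat.lt_floor_add_one _

/-- The extra `1` subtracted in `nextLevel` makes up for the rounding, so the levels decrease by at
least the exact factor. -/
theorem nextLevel_le (b : ℕ) {k : ℕ} (hk : 1 ≤ k) :
    (nextLevel b k : ℝ) ≤ k * (1 - 1 / (b + 2)) := by
  have h1 : (k : ℝ) / (b + 2) < (k / (b + 2) : ℕ) + 1 := by
    exact_mod_cast cast_div_lt_div_add_one k (b + 2)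
  have h2 : nextLevel b k + 1 + k / (b + 2) = k := by
    have : k / (b + 2) < k := Nat.div_lt_self (by omega) (by omega)
    unfold nextLevel
    generalize k / (b + 2) = q at *
    omega
  have h3 : (nextLevel b k : ℝ) + 1 + (k / (b + 2) : ℕ) = k := by exact_mod_cast h2
  have h4 : (k : ℝ) * (1 - 1 / (b + 2)) = k - k / (b + 2) := by ring
  linarith

/-- Every level lowers the logarithm by at least `1 / (b + 2)`. -/
theorem numLevels_le (b : ℕ) {k : ℕ} (hk : 1 ≤ k) :
    (numLevels b k : ℝ) ≤ 1 + (b + 2) * Real.log k := by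
  induction k using Nat.strong_induction_on with
  | _ k ih =>
    rw [numLevels, dif_neg (by omega)]
    push_cast
    have hlog : 0 ≤ Real.log k := Real.log_natCast_nonneg k
    rcases Nat.eq_zero_or_pos (nextLevel b k) with h | h
    · rw [h, numLevels]
      simp
      positivity
    · have h1 := ih _ (nextLevel_lt (by omega)) h
      have h2 := nextLevel_le b hk
      have hk' : (0 : ℝ) < k := by exact_mod_cast hk
      have h' : (0 : ℝ) < nextLevel b k := by exact_mod_cast h
      have h3 : (0 : ℝ) < 1 - 1 / (b + 2) := by
        by_contra hcon
        nlinarith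
      have h4 : Real.log (nextLevel b k) ≤ Real.log k - 1 / (b + 2) := by
        refine (Real.log_le_log h' h2).trans ?_
        rw [Real.log_mul hk'.ne' h3.ne']
        have := Real.log_le_sub_one_of_pos h3
        linarith
      have h5 : ((b : ℝ) + 2) * (1 / (b + 2)) = 1 := by field_simp
      nlinarith

/-- The levels must not fall too fast either: a core number just missed by level `k` has to be
within the factor `(b + 1) / b` of the next level. This rests on `(b + 1) ⌊k / (b + 2)⌋ ≤ k - 1`. -/
theorem core_nextLevel {b k x : ℕ} (h : x < k) : x * b ≤ (b + 1) * nextLevel b k := by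
  have h1 : (b + 1) * (k / (b + 2)) ≤ k - 1 := by
    have := Nat.mul_div_le k (b + 2)
    rcases Nat.eq_zero_or_pos (k / (b + 2)) with h0 | h0
    · simp [h0]
    · have : (b + 2) * (k / (b + 2)) = (b + 1) * (k / (b + 2)) + k / (b + 2) := by ring
      omega
  obtain ⟨q, hq⟩ : ∃ q, q = k / (b + 2) := ⟨_, rfl⟩
  unfold nextLevel
  rw [← hq] at h1 ⊢
  obtain ⟨m, rfl⟩ : ∃ m, k = m + 1 := ⟨k - 1, by omega⟩
  have h2 : q ≤ m := by
    simp only [add_tsub_cancel_right] at h1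
    nlinarith
  obtain ⟨r, rfl⟩ := Nat.exists_eq_add_of_le h2
  simp only [add_tsub_cancel_right, add_tsub_cancel_left] at h1 ⊢
  calc x * b ≤ (q + r) * b := Nat.mul_le_mul_right _ (by omega)
    _ ≤ (b + 1) * r := by nlinarith

/-! ### Tail bounds -/

section Tail

variable {n : ℕ} {nb : ℕ → List ℕ} {c : ℕ → ℕ} {b p g k : ℕ}

/-- With `δ = 1 / (4 (2 b + 1))` the gap between mean and threshold is worth `δ * scale` in the
exponent, twice the required `(p + 3) g`. The surplus pays for second-order terms. -/
theorem scale_eq (b p g : ℕ) :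
    (1 / (4 * (2 * b + 1)) : ℝ) * scale b p g = 2 * ((p + 3) * g) := by
  unfold scale
  push_cast
  field_simp
  ring

/-- At least `k` neighbours of `v` have core number at least `k`, so up to rounding the mean is at
least `rate`, which exceeds the threshold by `scale`. -/
theorem lower_tail (hG : IsCoreGraph n nb c) (hg : 1 ≤ g) (hk : 1 ≤ k) {v : ℕ} (hv : v < n)
    (hkc : k ≤ c v) {vs : List ℕ}
    (hvs : vs.count v = (nb v).length * rate b p g / k) :
    sampleExpect nb vs [] (fun cs => if hits (targets cs v) {u | u < n ∧ k ≤ c u} <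
      threshold b p g then 1 else 0) ≤ ENNReal.ofReal (failure p g) := by
  set δ : ℝ := 1 / (4 * (2 * b + 1)) with hδ
  have hδ0 : 0 < δ := by positivity
  have hδ1 : δ ≤ 1 / 2 := by
    rw [hδ, div_le_div_iff₀ (by positivity) (by norm_num)]
    linarith [(Nat.cast_nonneg b : (0 : ℝ) ≤ b)]
  have hX : 1 ≤ scale b p g := Nat.succ_le_of_lt (by unfold scale; positivity)
  have hτ : 1 ≤ threshold b p g := Nat.succ_le_of_lt (by unfold threshold; positivity)
  have hh := hG.le_hits_core hv hkc
  have hhd := hits_le_length (nb v) {u | u < n ∧ k ≤ c u}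
  -- Fewer hits than the threshold means at most the threshold minus one. This one hit compensates
  -- for the draw lost by rounding down the number of samples.
  refine sampleExpect_tail_le v _ vs (x := 1 - δ) (by linarith)
    (z := (1 - δ) ^ (threshold b p g - 1)) (by apply pow_pos; linarith)
    (fun h => h < threshold b p g) ?_ ?_
  · intro h hlt
    exact pow_le_pow_of_le_one (by linarith) (by linarith) (by omega)
  set h : ℕ := hits (nb v) {u | u < n ∧ k ≤ c u}
  set d : ℕ := (nb v).length
  have hz : Real.exp (-(δ + 2 * δ ^ 2) * (threshold b p g - 1)) ≤
      (1 - δ) ^ (threshold b p g - 1) := by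
    have : Real.exp (-(δ + 2 * δ ^ 2) * (threshold b p g - 1)) =
        Real.exp (-(δ + 2 * δ ^ 2)) ^ (threshold b p g - 1) := by
      rw [← Real.exp_nat_mul, Nat.cast_sub hτ]
      push_cast
      ring_nf
    rw [this]
    exact pow_le_pow_left₀ (Real.exp_pos _).le (exp_le_one_sub hδ0.le hδ1) _
  refine le_trans ?_ (mul_le_mul_of_nonneg_left hz (Real.exp_pos _).le)
  rw [failure, ← Real.exp_add, Real.exp_le_exp, hvs]
  have hd0 : (0 : ℝ) < d := by exact_mod_cast (by omega : 0 < d)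
  have hk0 : (0 : ℝ) < k := by exact_mod_cast hk
  have hhk : (k : ℝ) ≤ h := by exact_mod_cast hh
  have hhd' : (h : ℝ) ≤ d := by exact_mod_cast hhd
  have h1 : ((d * rate b p g : ℕ) : ℝ) / k < (d * rate b p g / k : ℕ) + 1 :=
    cast_div_lt_div_add_one _ _
  push_cast at h1
  -- Rounding loses less than one draw, and a draw is a hit with probability `h / d ≤ 1`.
  have h2 : (rate b p g : ℝ) - 1 ≤ h / d * (d * rate b p g / k : ℕ) := by
    have h3 : (h : ℝ) / d * (d * rate b p g / k - 1) ≤ h / d * (d * rate b p g / k : ℕ) := by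
      gcongr
      linarith
    have h4 : (h : ℝ) / d * (d * rate b p g / k - 1) = h / k * rate b p g - h / d := by
      field_simp
    have h5 : (1 : ℝ) ≤ h / k := (one_le_div hk0).2 hhk
    have h6 : (h : ℝ) / d ≤ 1 := (div_le_one hd0).2 hhd'
    have h7 : (rate b p g : ℝ) ≤ h / k * rate b p g := le_mul_of_one_le_left (by positivity) h5
    linarith
  have h3 := scale_eq b p g
  rw [← hδ] at h3
  have h4 : (rate b p g : ℝ) = threshold b p g + scale b p g := by
    unfold rate threshold
    push_cast
    ring
  -- The choice of `δ` makes the second-order term exactly half of the gain, so `(p + 3) g` is left.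
  have h5 : 2 * δ ^ 2 * threshold b p g = δ * scale b p g / 2 := by
    have : 4 * δ * (2 * b + 1) = 1 := by
      rw [hδ]
      field_simp
    unfold threshold
    push_cast
    linear_combination (δ * scale b p g / 2) * this
  have h6 : δ * (rate b p g - 1) ≤ δ * (h / d * (d * rate b p g / k : ℕ)) := by gcongr
  nlinarith [sq_nonneg δ]

/-- At most `c v` neighbours of `v` lie in `S`, so the mean is at most `2 b * scale`, which is
`scale` below the threshold. Here rounding down only helps. -/
theorem upper_tail (hk : 1 ≤ k) {v : ℕ} {S : Set ℕ} (hS : hits (nb v) S ≤ c v)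
    (hkc : c v * (b + 1) < k * b) {vs : List ℕ}
    (hvs : vs.count v = (nb v).length * rate b p g / k) :
    sampleExpect nb vs [] (fun cs => if threshold b p g ≤ hits (targets cs v) S
      then 1 else 0) ≤ ENNReal.ofReal (failure p g) := by
  set δ : ℝ := 1 / (4 * (2 * b + 1)) with hδ
  have hδ0 : 0 < δ := by positivity
  refine sampleExpect_tail_le v _ vs (x := 1 + δ) (by linarith)
    (z := (1 + δ) ^ threshold b p g) (by positivity) (fun h => threshold b p g ≤ h) ?_ ?_
  · intro h hle
    exact pow_le_pow_right₀ (by linarith) hle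
  set h : ℕ := hits (nb v) S
  set d : ℕ := (nb v).length
  have hz : Real.exp ((δ - δ ^ 2) * threshold b p g) ≤ (1 + δ) ^ threshold b p g := by
    rw [mul_comm, Real.exp_nat_mul]
    exact pow_le_pow_left₀ (Real.exp_pos _).le (exp_le_one_add hδ0.le) _
  refine le_trans ?_ (mul_le_mul_of_nonneg_left hz (Real.exp_pos _).le)
  rw [failure, ← Real.exp_add, Real.exp_le_exp, hvs]
  have hk0 : (0 : ℝ) < k := by exact_mod_cast hk
  have h1 : ((d * rate b p g / k : ℕ) : ℝ) ≤ d * rate b p g / k := by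
    have := Nat.cast_div_le (α := ℝ) (m := d * rate b p g) (n := k)
    push_cast at this
    exact this
  have hhc : (h : ℝ) * (b + 1) ≤ k * b := by
    exact_mod_cast (Nat.mul_le_mul_right (b + 1) hS).trans hkc.le
  have h2 : (h : ℝ) / d * (d * rate b p g / k : ℕ) ≤ 2 * b * scale b p g := by
    have h3 : (h : ℝ) / d * (d * rate b p g / k : ℕ) ≤ h / d * (d * rate b p g / k) := by gcongr
    have h4 : (h : ℝ) / d * (d * rate b p g / k) ≤ h * rate b p g / k := by
      rcases Nat.eq_zero_or_pos d with h0 | h0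
      · rw [h0]
        simp
        positivity
      · have : (0 : ℝ) < d := by exact_mod_cast h0
        apply le_of_eq
        field_simp
    refine h3.trans (h4.trans ?_)
    rw [div_le_iff₀ hk0]
    unfold rate
    push_cast
    have hX : (0 : ℝ) ≤ scale b p g := by positivity
    nlinarith [mul_le_mul_of_nonneg_right hhc hX]
  have h3 := scale_eq b p g
  rw [← hδ] at h3
  have h5 : 2 * δ ^ 2 * threshold b p g = δ * scale b p g / 2 := by
    have : 4 * δ * (2 * b + 1) = 1 := by
      rw [hδ]
      field_simp
    unfold threshold
    push_cast
    linear_combination (δ * scale b p g / 2) * this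
  have h4 : (threshold b p g : ℝ) = 2 * b * scale b p g + scale b p g := by
    unfold threshold
    push_cast
    ring
  have h6 : δ * (h / d * (d * rate b p g / k : ℕ)) ≤ δ * (2 * b * scale b p g) := by gcongr
  have h7 : 0 ≤ δ * scale b p g := by positivity
  nlinarith

end Tail

/-! ### Peeling -/

section Peeling

variable {n : ℕ} {nb : ℕ → List ℕ} {c : ℕ → ℕ} {act : ℕ → Prop} {τ : ℕ} {cs : List (ℕ × ℕ)}

/-- In the multigraph `cs`, all nodes of `S` are active and have `τ` arcs to nodes of `S` or to
inactive nodes. -/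
def ArcStable (act : ℕ → Prop) (τ : ℕ) (cs : List (ℕ × ℕ)) (S : Set ℕ) : Prop :=
  ∀ v ∈ S, act v ∧ τ ≤ hits (targets cs v) {u | u ∈ S ∨ ¬ act u}

/-- `P` is a set of active nodes whose removal is the result of peeling with threshold `τ`. -/
structure IsPeeled (n : ℕ) (act : ℕ → Prop) (τ : ℕ) (cs : List (ℕ × ℕ)) (P : Finset ℕ) : Prop where
  active : ∀ v ∈ P, act v
  keep : ∀ v < n, act v → v ∉ P → τ ≤ hits (targets cs v) {u | u ∉ P}
  drop : ∀ S, ArcStable act τ cs S → ∀ v ∈ S, v ∉ P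

/-- When all nodes are active and the arcs are all edges, the survivors form a stable set and
contain every stable set, so peeling is exact. -/
theorem IsPeeled.notMem_iff (hG : IsCoreGraph n nb c) {P : Finset ℕ}
    (hP : IsPeeled n (· < n) τ cs P) (hcs : ∀ v S, hits (targets cs v) S = hits (nb v) S) {v : ℕ}
    (hv : v < n) : v ∉ P ↔ τ ≤ c v := by
  constructor
  · intro h
    refine hG.le_core_of_stable (S := {u | u < n ∧ u ∉ P}) ?_ ⟨hv, h⟩
    rintro u ⟨hu, huP⟩
    refine ⟨hu, (hP.keep u hu hu huP).trans ?_⟩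
    rw [hcs]
    exact hits_mono _ fun a ha haP => ⟨hG.lt u a ha, haP⟩
  · intro h
    refine hP.drop {u | u < n ∧ τ ≤ c u} ?_ v ⟨hv, h⟩
    rintro u ⟨hu, hτ⟩
    refine ⟨hu, ?_⟩
    rw [hcs]
    exact (hG.le_hits_core hu hτ).trans (hits_mono _ fun a _ ha => Or.inl ha)

/-- The samples `cs` of the active nodes represent the graph well at level `k`. -/
def GoodSample (n : ℕ) (c ρ : ℕ → ℕ) (act : ℕ → Prop) (b k τ : ℕ) (cs : List (ℕ × ℕ)) : Prop :=
  ∀ v < n, act v → (k ≤ c v → τ ≤ hits (targets cs v) {u | u < n ∧ k ≤ c u}) ∧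
    (c v * (b + 1) < k * b → hits (targets cs v) {u | ρ v ≤ ρ u} < τ)

variable {ρ : ℕ → ℕ} {b k : ℕ}

/-- Every active node of large core number survives. -/
theorem IsPeeled.core_lt {P : Finset ℕ} (hP : IsPeeled n act τ cs P)
    (hn : ∀ v, act v → v < n) (hgood : GoodSample n c ρ act b k τ cs) {v : ℕ} (hv : v ∈ P) :
    c v < k := by
  by_contra! hk
  -- Each good hit of such a node is either active, hence in this set, or inactive; so the set is
  -- arc-stable.
  refine hP.drop {u | act u ∧ k ≤ c u} ?_ v ⟨hP.active v hv, hk⟩ hv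
  rintro u ⟨hu, huk⟩
  refine ⟨hu, ((hgood u (hn u hu) hu).1 huk).trans (hits_mono _ fun a _ ha => ?_)⟩
  by_cases h : act a
  · exact Or.inl ⟨h, ha.2⟩
  · exact Or.inr h

/-- Every active node of small core number is removed. -/
theorem IsPeeled.le_core {P : Finset ℕ} (hP : IsPeeled n act τ cs P)
    (hgood : GoodSample n c ρ act b k τ cs)
    (hρ : ∀ v < n, ∀ u < n, ρ u ≤ ρ v → c u ≤ c v)
    (hcs : ∀ v, ∀ u ∈ targets cs v, u < n)
    (hold : ∀ v < n, ¬ act v → k * b ≤ c v * (b + 1)) {v : ℕ} (hvn : v < n)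
    (hv : v ∉ P) : k * b ≤ c v * (b + 1) := by
  classical
  by_contra! hlow
  -- Among the survivors of too small core number take the one that comes first in the order. A
  -- survivor strictly before it would also have small core number, so all its arcs to survivors go
  -- to nodes that do not precede it, and there are too few of these.
  obtain ⟨x, hx, hmin⟩ := ((Finset.range n).filter
    (fun u => u ∉ P ∧ c u * (b + 1) < k * b)).exists_min_image ρ
      ⟨v, by simp [hvn, hv, hlow]⟩
  simp only [Finset.mem_filter, Finset.mem_range] at hx hmin
  obtain ⟨hxn, hxP, hxlow⟩ := hx
  have hact : act x := by
    by_contra h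
    exact absurd (hold x hxn h) (by omega)
  have h1 := hP.keep x hxn hact hxP
  have h2 := (hgood x hxn hact).2 hxlow
  have h3 : hits (targets cs x) {u | u ∉ P} ≤ hits (targets cs x) {u | ρ x ≤ ρ u} := by
    refine hits_mono _ fun a ha haP => ?_
    have han := hcs x a ha
    by_contra hlt
    simp only [Set.mem_ofPred_eq, not_le] at hlt
    have := hρ x hxn a han hlt.le
    have := hmin a ⟨han, haP, lt_of_le_of_lt (Nat.mul_le_mul_right _ this) hxlow⟩
    omega
  omega

-- A union bound over the nodes. In the application `x` bounds the failure probability of all later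
-- levels, and `1` is the trivial bound after a bad sample.
open scoped Classical in
theorem sampleExpect_goodSample_le (hG : IsCoreGraph n nb c) {p g : ℕ} (hg : 1 ≤ g) (hk : 1 ≤ k)
    (hρ : ∀ v < n, hits (nb v) {u | ρ v ≤ ρ u} ≤ c v) (vs : List ℕ)
    (hvs : ∀ v < n, act v → vs.count v = (nb v).length * rate b p g / k) (x : ℝ≥0∞) :
    sampleExpect nb vs [] (fun cs =>
      if GoodSample n c ρ act b k (threshold b p g) cs then x else 1) ≤
      x + n * ENNReal.ofReal (failure p g) := by
  let bad : ℕ → List (ℕ × ℕ) → ℝ≥0∞ := fun v cs =>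
    if act v ∧ ((k ≤ c v ∧ hits (targets cs v) {u | u < n ∧ k ≤ c u} < threshold b p g) ∨
      (c v * (b + 1) < k * b ∧ threshold b p g ≤ hits (targets cs v) {u | ρ v ≤ ρ u})) then 1 else 0
  have h1 : ∀ cs, (if GoodSample n c ρ act b k (threshold b p g) cs then x else 1) ≤
      x + ∑ v ∈ Finset.range n, bad v cs := by
    intro cs
    split_ifs with h
    · exact le_self_add
    · unfold GoodSample at h
      push Not at h
      obtain ⟨v, hv, hact, h⟩ := h
      have : bad v cs = 1 := by
        simp only [bad]
        rw [if_pos]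
        refine ⟨hact, ?_⟩
        by_cases hkc : k ≤ c v ∧ hits (targets cs v) {u | u < n ∧ k ≤ c u} < threshold b p g
        · exact Or.inl hkc
        · exact Or.inr (h fun h' => by by_contra h''; exact hkc ⟨h', by omega⟩)
      rw [← this]
      exact (Finset.single_le_sum (f := fun v => bad v cs) (fun _ _ => zero_le)
        (Finset.mem_range.2 hv)).trans le_add_self
  refine (sampleExpect_mono vs [] h1).trans ?_
  rw [sampleExpect_add]
  refine add_le_add (sampleExpect_const_le _ _ _) ((sampleExpect_sum _ _ _ _).trans ?_)
  have h2 : ∀ v ∈ Finset.range n, sampleExpect nb vs [] (bad v) ≤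
      ENNReal.ofReal (failure p g) := by
    intro v hv
    have hv := Finset.mem_range.1 hv
    by_cases hact : act v
    · by_cases hkc : k ≤ c v
      · refine (sampleExpect_mono vs [] fun cs => ?_).trans
          (lower_tail hG hg hk hv hkc (hvs v hv hact))
        -- The two bad events concern disjoint ranges of core numbers, so each node contributes
        -- `failure` at most once. Nodes between the two ranges are unconstrained.
        have : ¬ c v * (b + 1) < k * b := by
          have := Nat.mul_le_mul hkc (Nat.le_add_right b 1)
          omega
        simp only [bad, hact, hkc, this, true_and, false_and, or_false]
        exact le_rfl
      · by_cases hlow : c v * (b + 1) < k * b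
        · refine (sampleExpect_mono vs [] fun cs => ?_).trans
            (upper_tail hk (hρ v hv) hlow (hvs v hv hact))
          simp only [bad, hact, hkc, hlow, true_and, false_and, false_or]
          exact le_rfl
        · simp only [bad, hkc, hlow, false_and, or_false, and_false, if_false]
          exact (sampleExpect_const_le _ _ _).trans zero_le
    · simp only [bad, hact, false_and, if_false]
      exact (sampleExpect_const_le _ _ _).trans zero_le
  refine (Finset.sum_le_sum h2).trans ?_
  simp

end Peeling

/-! ### Requests for samples within the budget -/

/-- The list of the nodes that draw samples, with multiplicities: the nodes of a list draw `q v`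
samples each, except for those that would exceed the budget. -/
def requests (q : ℕ → ℕ) (B : ℕ) : ℕ → List ℕ → List ℕ
  | _, [] => []
  | tot, v :: vs =>
      if tot + q v ≤ B then List.replicate (q v) v ++ requests q B (tot + q v) vs
      else requests q B tot vs

theorem mem_requests {q : ℕ → ℕ} {B tot v : ℕ} {vs : List ℕ} (h : v ∈ requests q B tot vs) :
    v ∈ vs := by
  induction vs generalizing tot with
  | nil => exact h
  | cons u vs ih =>
    rw [requests] at h
    split_ifs at h
    · rcases List.mem_append.1 h with h | h
      · simp [(List.mem_replicate.1 h).2]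
      · exact List.mem_cons_of_mem _ (ih h)
    · exact List.mem_cons_of_mem _ (ih h)

/-- If the total demand fits into the budget, no request is refused, and the sample sizes are those
required by the tail bounds. -/
theorem count_requests {q : ℕ → ℕ} {B tot : ℕ} {vs : List ℕ} (hvs : vs.Nodup)
    (hB : tot + (vs.map q).sum ≤ B) {v : ℕ} (hv : v ∈ vs) : (requests q B tot vs).count v = q v :=
      by
  induction vs generalizing tot with
  | nil => simp at hv
  | cons u vs ih =>
    simp only [List.map_cons, List.sum_cons] at hB
    rw [requests, if_pos (by omega), List.count_append, List.count_replicate]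
    rw [List.nodup_cons] at hvs
    by_cases huv : u = v
    · subst huv
      have : List.count u (requests q B (tot + q u) vs) = 0 :=
        List.count_eq_zero.2 fun h => hvs.1 (mem_requests h)
      simp [this]
    · have hv' : v ∈ vs := by
        rcases List.mem_cons.1 hv with h | h
        · exact absurd h.symm huv
        · exact h
      simpa [huv] using ih hvs.2 (by omega) hv'

/-- A bound for the number of samples drawn above level `k`. -/
noncomputable def spent (n : ℕ) (nb : ℕ → List ℕ) (c : ℕ → ℕ) (b p g k : ℕ) : ℝ :=
  rate b p g * (b + 2) * ∑ v ∈ Finset.range n, ((nb v).length : ℝ) / max (k : ℝ) (c v / 4)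

section Spent

variable {n : ℕ} {nb : ℕ → List ℕ} {c : ℕ → ℕ} (hG : IsCoreGraph n nb c) {b p g k : ℕ}
include hG

/-- Replacing the maximum by `c v / 4` reduces this to `∑ d / c ≤ 2 n`; the factor `8` in `budget`
is `4 * 2`. -/
theorem spent_le_budget : spent n nb c b p g k ≤ budget n b p g := by
  have h1 : ∑ v ∈ Finset.range n, ((nb v).length : ℝ) / max (k : ℝ) (c v / 4) ≤ 4 * (2 * n) := by
    refine le_trans ?_ (mul_le_mul_of_nonneg_left hG.sum_div_core_le (by norm_num))
    rw [Finset.mul_sum]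
    refine Finset.sum_le_sum fun v _ => ?_
    rcases Nat.eq_zero_or_pos (nb v).length with h | h
    · simp [h]
    · have hc : (0 : ℝ) < c v := by exact_mod_cast hG.one_le_core h
      calc ((nb v).length : ℝ) / max (k : ℝ) (c v / 4) ≤ (nb v).length / (c v / 4) := by
            gcongr
            exact le_max_right _ _
        _ = 4 * ((nb v).length / c v) := by field_simp
  unfold spent budget
  push_cast
  calc _ ≤ (rate b p g : ℝ) * (b + 2) * (4 * (2 * n)) := by gcongr
    _ = _ := by ring

-- `spent` is a potential: when the level drops, the term of an active node grows by at least its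
-- number of new samples. An active node has `c v ≤ 2 k`, so the cutoff `c v / 4` does not yet stop
-- the growth. After labelling the cutoff keeps the term bounded.
open scoped Classical in
theorem spent_step {act : ℕ → Prop} (hb : 1 ≤ b) (hk : 1 ≤ k)
    (hact : ∀ v < n, act v → c v * b ≤ (b + 1) * k) :
    spent n nb c b p g k +
      ∑ v ∈ Finset.range n, ((if act v then (nb v).length * rate b p g / k else 0 : ℕ) : ℝ) ≤
      spent n nb c b p g (nextLevel b k) := by
  have hk0 : (0 : ℝ) < k := by exact_mod_cast hk
  have hk' := nextLevel_le b hk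
  unfold spent
  rw [Finset.mul_sum, Finset.mul_sum, ← Finset.sum_add_distrib]
  refine Finset.sum_le_sum fun v hv => ?_
  rcases Nat.eq_zero_or_pos (nb v).length with h | h
  · simp [h]
  have hc : (0 : ℝ) < c v := by exact_mod_cast hG.one_le_core h
  have hm : 0 < max (nextLevel b k : ℝ) (c v / 4) := lt_max_of_lt_right (by positivity)
  have hlt : (nextLevel b k : ℝ) ≤ k := by exact_mod_cast (nextLevel_lt (by omega)).le
  split_ifs with hv'
  · have h2 : ((c v * b : ℕ) : ℝ) ≤ ((b + 1) * k : ℕ) := by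
      exact_mod_cast hact v (by simpa using hv) hv'
    push_cast at h2
    have hb' : (1 : ℝ) ≤ b := by exact_mod_cast hb
    have h3 : (c v : ℝ) ≤ 2 * k := by
      by_contra! hcon
      nlinarith
    have h4 : max (k : ℝ) (c v / 4) = k := max_eq_left (by linarith)
    have h5 : max (nextLevel b k : ℝ) (c v / 4) ≤ k * (1 - 1 / (b + 2)) := by
      refine max_le hk' ?_
      have : (1 : ℝ) / (b + 2) ≤ 1 / 2 := by
        rw [div_le_div_iff₀ (by positivity) (by norm_num)]
        linarith
      nlinarith
    have h6 : (((nb v).length * rate b p g / k : ℕ) : ℝ) ≤ (nb v).length * rate b p g / k := by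
      have := Nat.cast_div_le (α := ℝ) (m := (nb v).length * rate b p g) (n := k)
      push_cast at this
      exact this
    rw [h4]
    -- Both entries of the maximum are at most `k (b + 1) / (b + 2)`, and `(b + 3) (b + 1) ≤ (b +
    -- 2)²`.
    have h7 : ((b : ℝ) + 3) / k ≤ (b + 2) / max (nextLevel b k : ℝ) (c v / 4) := by
      rw [div_le_div_iff₀ hk0 hm]
      calc ((b : ℝ) + 3) * max (nextLevel b k : ℝ) (c v / 4)
          ≤ (b + 3) * (k * (1 - 1 / (b + 2))) := by gcongr
        _ ≤ (b + 2) * k := by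
          have : (1 : ℝ) - 1 / (b + 2) = (b + 1) / (b + 2) := by field_simp; ring
          rw [this, ← mul_div_assoc, ← mul_div_assoc, div_le_iff₀ (by positivity)]
          nlinarith
    calc _ ≤ (rate b p g : ℝ) * (b + 2) * ((nb v).length / k) + (nb v).length * rate b p g / k := by
          gcongr
      _ = rate b p g * (nb v).length * ((b + 3) / k) := by
          field_simp
          ring
      _ ≤ rate b p g * (nb v).length * ((b + 2) / max (nextLevel b k : ℝ) (c v / 4)) := by gcongr
      _ = _ := by ring
  · simp only [Nat.cast_zero, add_zero]
    gcongr

end Spent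

/-! ### Notation for expressions -/

instance : Add Expr := ⟨.bin .plus⟩
instance : Sub Expr := ⟨.bin .monus⟩
instance : Mul Expr := ⟨.bin .times⟩
instance : Div Expr := ⟨.bin .quot⟩

/-- The comparison of two expressions. -/
def Expr.lt (e f : Expr) : Expr := .bin .less e f

section

variable (W : ℕ) (s : Memory) (e f : Expr) (k x a : ℕ)

@[simp] theorem Expr.val_add : (e + f).val s = e.val s + f.val s := rfl
@[simp] theorem Expr.val_sub : (e - f).val s = e.val s - f.val s := rfl
@[simp] theorem Expr.val_mul : (e * f).val s = e.val s * f.val s := rfl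
@[simp] theorem Expr.val_div : (e / f).val s = e.val s / f.val s := rfl
@[simp] theorem Expr.val_lt : (e.lt f).val s = if e.val s < f.val s then 1 else 0 := rfl
@[simp] theorem Expr.val_lit : (Expr.lit k).val s = k := rfl
@[simp] theorem Expr.val_var : (Expr.var x).val s = s.var x := rfl
@[simp] theorem Expr.val_get : (Expr.get a e).val s = s.arr a (e.val s) := rfl

@[simp] theorem Expr.fits_add :
    (e + f).Fits W s ↔ e.Fits W s ∧ f.Fits W s ∧ e.val s + f.val s < W := Iff.rfl
@[simp] theorem Expr.fits_mul :
    (e * f).Fits W s ↔ e.Fits W s ∧ f.Fits W s ∧ e.val s * f.val s < W := Iff.rfl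
@[simp] theorem Expr.fits_sub :
    (e - f).Fits W s ↔ e.Fits W s ∧ f.Fits W s ∧ e.val s - f.val s < W := Iff.rfl
@[simp] theorem Expr.fits_div :
    (e / f).Fits W s ↔ e.Fits W s ∧ f.Fits W s ∧ e.val s / f.val s < W := Iff.rfl
@[simp] theorem Expr.fits_lt :
    (e.lt f).Fits W s ↔ e.Fits W s ∧ f.Fits W s ∧ (if e.val s < f.val s then 1 else 0) < W :=
  Iff.rfl
@[simp] theorem Expr.fits_lit : (Expr.lit k).Fits W s ↔ k < W := Iff.rfl
@[simp] theorem Expr.fits_var : (Expr.var x).Fits W s ↔ True := Iff.rfl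
@[simp] theorem Expr.fits_get : (Expr.get a e).Fits W s ↔ e.Fits W s := Iff.rfl

theorem Expr.fits_lt_var (y : ℕ) (hW : 1 < W) : ((Expr.var x).lt (.var y)).Fits W s := by
  refine ⟨trivial, trivial, ?_⟩
  simp only [BinOp.eval]
  split_ifs <;> omega

end

theorem Program.Pre.mono {n : ℕ} {G : SimpleGraph (Fin n)} {I : IncidenceLists G} {W : ℕ}
    {p : Program} {s : Memory} {Q R : Memory → Prop} (h : p.Pre I W s Q) (hQR : ∀ s, Q s → R s) :
    p.Pre I W s R := by
  induction p generalizing s Q R with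
  | skip => exact hQR _ h
  | assign x e => exact ⟨h.1, h.2.1, hQR _ h.2.2⟩
  | store a i e => exact ⟨h.1, h.2.1, h.2.2.1, hQR _ h.2.2.2⟩
  | degree x v => exact ⟨h.1, h.2.1, hQR _ h.2.2⟩
  | neighbor x v i => exact ⟨h.1, h.2.1, h.2.2.1, hQR _ h.2.2.2⟩
  | random => exact h.elim
  | loop => exact h.elim
  | seq p q hp hq => exact hp h fun s' h' => hq h' hQR
  | cond e p q hp hq => exact ⟨h.1, fun he => hp (h.2.1 he) hQR, fun he => hq (h.2.2 he) hQR⟩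

/-- Only the variables in `xs` and the arrays in `as` change from `s` to `s'`. -/
structure Frame (xs as : List ℕ) (s s' : Memory) : Prop where
  var : ∀ x, x ∉ xs → s'.var x = s.var x
  arr : ∀ a, a ∉ as → s'.arr a = s.arr a

theorem Frame.rfl {xs as : List ℕ} {s : Memory} : Frame xs as s s :=
  ⟨fun _ _ => _root_.rfl, fun _ _ => _root_.rfl⟩

theorem Frame.trans {xs as xs' as' xs'' as'' : List ℕ} {s s' s'' : Memory}
    (h : Frame xs as s s') (h' : Frame xs' as' s' s'') (hx : xs ⊆ xs'' := by decide)
    (hx' : xs' ⊆ xs'' := by decide) (ha : as ⊆ as'' := by decide)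
    (ha' : as' ⊆ as'' := by decide) : Frame xs'' as'' s s'' :=
  ⟨fun x h1 => (h'.var x fun h2 => h1 (hx' h2)).trans (h.var x fun h2 => h1 (hx h2)),
    fun a h1 => (h'.arr a fun h2 => h1 (ha' h2)).trans (h.arr a fun h2 => h1 (ha h2))⟩

/-! ### Lists of arcs in the memory

The variables `0, …, 4` hold the input. The other variables are: `5` (`⌊log₂ n⌋ + 1`), `6` (the sum
of the degrees), `7` (the rate), `8` (the peeling threshold), `9` (the level), `10` (the number of
samples), `11` (the budget), `12`, `15` (the ends of an arc), `13` (a counter), `14` (a degree),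
`16` (a number of samples), `17` (the number of arcs), `18` (an arc), `19` (the size of the stack),
`20` (the size of the list of remaining nodes), `21` (a counter), `22` (a random number).

The arrays are: `0`, `1` (the labels), `2` (the first arc of a node), `3` (the next arc with the
same end), `4` (the start of an arc), `5` (the number of the remaining arcs of a node), `6` (the
marks of the removed nodes), `7` (the stack), `8` (the list of remaining nodes). -/

/-- The number of the most recent arc with end `u`, or `0`. The arcs are numbered from `1`, the
most recent arc is the head of the list. -/
def lastArc : List (ℕ × ℕ) → ℕ → ℕ
  | [], _ => 0
  | c :: cs, u => if c.2 = u then cs.length + 1 else lastArc cs u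

/-- The representation of a list of arcs in the memory. -/
structure ArcsRep (n : ℕ) (s : Memory) (cs : List (ℕ × ℕ)) : Prop where
  length : s.var 17 = cs.length
  src : ∀ c cs', c :: cs' <:+ cs → s.arr 4 (cs'.length + 1) = c.1
  next : ∀ c cs', c :: cs' <:+ cs → s.arr 3 (cs'.length + 1) = lastArc cs' c.2
  last : ∀ u < n, s.arr 2 u = lastArc cs u

theorem lastArc_le (cs : List (ℕ × ℕ)) (u : ℕ) : lastArc cs u ≤ cs.length := by
  induction cs with
  | nil => simp [lastArc]
  | cons c cs ih =>
    simp only [lastArc, List.length_cons]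
    split_ifs <;> omega

theorem hits_targets_cons (c : ℕ × ℕ) (cs : List (ℕ × ℕ)) (v : ℕ) (S : Set ℕ) :
    hits (targets (c :: cs) v) S = (if c.1 = v then hits [c.2] S else 0) + hits (targets cs v) S :=
      by
  rw [targets]
  split_ifs
  · rw [hits_cons, hits_cons, hits_nil]
    omega
  · omega

theorem hits_targets_suffix {cs' cs : List (ℕ × ℕ)} (h : cs' <:+ cs) (v : ℕ) (S : Set ℕ) :
    hits (targets cs' v) S ≤ hits (targets cs v) S := by
  induction cs with
  | nil => rw [List.suffix_nil.1 h]
  | cons c cs ih =>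
    rcases List.suffix_cons_iff.1 h with rfl | h
    · exact le_rfl
    · exact (ih h).trans (by rw [hits_targets_cons]; omega)

theorem length_targets_le (cs : List (ℕ × ℕ)) (v : ℕ) : (targets cs v).length ≤ cs.length := by
  induction cs with
  | nil => simp [targets]
  | cons c cs ih =>
    rw [targets]
    split_ifs <;> simp <;> omega

/-- Splits the first entry off the linked list of arcs into `u`; passing from `cs` to `cs'` means
following one link. Arcs are numbered by their position from the end, so suffixes of `cs` keep their
numbers. -/
theorem lastArc_cases (cs : List (ℕ × ℕ)) (u : ℕ) :
    (lastArc cs u = 0 ∧ ∀ v, hits (targets cs v) {u} = 0) ∨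
      ∃ v cs', (v, u) :: cs' <:+ cs ∧ lastArc cs u = cs'.length + 1 ∧
        (∀ x, hits (targets cs x) {u} = (if v = x then 1 else 0) + hits (targets cs' x) {u}) ∧
        hits (cs.map Prod.snd) {u} = hits (cs'.map Prod.snd) {u} + 1 := by
  induction cs with
  | nil => exact Or.inl ⟨rfl, fun v => rfl⟩
  | cons c cs ih =>
    obtain ⟨a, x⟩ := c
    by_cases hx : x = u
    · subst hx
      refine Or.inr ⟨a, cs, List.suffix_rfl, by simp [lastArc], fun y => ?_, ?_⟩
      · rw [hits_targets_cons]
        simp [hits_cons]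
      · simp [hits_cons]
    · have h0 : hits [x] {u} = 0 := by simp [hits_cons, hx]
      rcases ih with ⟨h1, h2⟩ | ⟨v, cs', h1, h2, h3, h4⟩
      · refine Or.inl ⟨by simp [lastArc, hx, h1], fun v => ?_⟩
        simp [hits_targets_cons, h2, h0]
      · refine Or.inr ⟨v, cs', h1.trans (List.suffix_cons _ _), by simp [lastArc, hx, h2],
          fun y => ?_, ?_⟩
        · rw [hits_targets_cons, h0, ← h3]
          simp
        · simp [hits_cons, hx, h4]

/-- Adds an arc. -/
def addArc : Program :=
  .seq (.assign 17 (.var 17 + .lit 1)) <| .seq (.store 4 (.var 17) (.var 12)) <|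
  .seq (.store 3 (.var 17) (.get 2 (.var 15))) <| .seq (.store 2 (.var 15) (.var 17)) <|
  .store 5 (.var 12) (.get 5 (.var 12) + .lit 1)

section

variable {n : ℕ} {G : SimpleGraph (Fin n)} {I : IncidenceLists G} {W : ℕ}

theorem ArcsRep.congr {s s' : Memory} {cs : List (ℕ × ℕ)} (h : ArcsRep n s cs)
    (h17 : s'.var 17 = s.var 17) (h2 : s'.arr 2 = s.arr 2) (h3 : s'.arr 3 = s.arr 3)
    (h4 : s'.arr 4 = s.arr 4) : ArcsRep n s' cs :=
  ⟨h17 ▸ h.length, h4 ▸ h.src, h3 ▸ h.next, h2 ▸ h.last⟩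

theorem pre_addArc {s : Memory} {cs : List (ℕ × ℕ)} (hs : ArcsRep n s cs)
    (hcnt : ∀ v < n, s.arr 5 v = (targets cs v).length) {v u : ℕ} (hv : s.var 12 = v)
    (hu : s.var 15 = u) (hvn : v < n) (hun : u < n) (hw : n < W) (hcs : cs.length + 1 < W) :
    addArc.Pre I W s fun s' => ArcsRep n s' ((v, u) :: cs) ∧
      (∀ x < n, s'.arr 5 x = (targets ((v, u) :: cs) x).length) ∧ Frame [17] [2, 3, 4, 5] s s' := by
  have h1 := hs.length
  have h2 := hs.last u hun
  have h3 := lastArc_le cs u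
  have h4 := hcnt v hvn
  have h5 := length_targets_le cs v
  simp [addArc, Program.Pre, hv, hu, h1, h2, h4, Function.update_apply]
  and_intros
  all_goals try omega
  · refine ⟨by simp, fun c cs' h => ?_, fun c cs' h => ?_, fun x hx => ?_⟩
    · rcases List.suffix_cons_iff.1 h with h | h
      · simp only [List.cons.injEq] at h
        simp [h.1, h.2]
      · have := h.length_le
        have h6 := hs.src _ _ h
        simp only [List.length_cons] at this
        simp [Function.update_apply, h6]
        omega
    · rcases List.suffix_cons_iff.1 h with h | h
      · simp only [List.cons.injEq] at h
        simp [h.1, h.2]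
      · have := h.length_le
        have h6 := hs.next _ _ h
        simp only [List.length_cons] at this
        simp [Function.update_apply, h6]
        omega
    · have := hs.last x hx
      by_cases h : u = x
      · simp [lastArc, h]
      · simp [lastArc, h, Ne.symm h, this]
  · intro x hx
    have := hcnt x hx
    by_cases h : v = x
    · simp [targets, h]
    · simp [targets, h, Ne.symm h, this]
  · exact ⟨fun x hx => by simp at hx; simp [hx], fun a ha => by simp at ha; simp [ha]⟩

end

/-! ### Peeling -/

/-- The representation of a stack, its top is the head of the list. -/
def StackRep (a : ℕ → ℕ) : List ℕ → Prop
  | [] => True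
  | u :: l => a l.length = u ∧ StackRep a l

theorem StackRep.congr {a a' : ℕ → ℕ} {l : List ℕ} (h : StackRep a l)
    (ha : ∀ i < l.length, a' i = a i) : StackRep a' l := by
  induction l with
  | nil => trivial
  | cons u l ih =>
    simp only [List.length_cons] at ha
    exact ⟨(ha _ (by omega)).trans h.1, ih h.2 fun i hi => ha i (by omega)⟩

/-- The state of the peeling process: the nodes in `P` and on the stack `l` have been removed, the
arcs to nodes in `P` have been removed. -/
structure PeelState (n : ℕ) (act : ℕ → Prop) (τ : ℕ) (cs : List (ℕ × ℕ)) (s : Memory)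
    (P : Finset ℕ) (l : List ℕ) : Prop where
  nodup : l.Nodup
  stack : ∀ x ∈ l, x < n ∧ act x ∧ x ∉ P
  done : ∀ x ∈ P, x < n ∧ act x
  size : s.var 19 = l.length
  stackRep : StackRep (s.arr 7) l
  mark : ∀ v < n, s.arr 6 v = if v ∈ P ∨ v ∈ l then 1 else 0
  drop : ∀ S, ArcStable act τ cs S → ∀ v ∈ S, v ∉ P ∧ v ∉ l

theorem PeelState.congr {n τ : ℕ} {act : ℕ → Prop} {cs : List (ℕ × ℕ)} {s s' : Memory}
    {P : Finset ℕ} {l : List ℕ} (h : PeelState n act τ cs s P l) (h19 : s'.var 19 = s.var 19)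
    (h6 : s'.arr 6 = s.arr 6) (h7 : s'.arr 7 = s.arr 7) : PeelState n act τ cs s' P l :=
  { h with
    size := h19 ▸ h.size
    stackRep := h7 ▸ h.stackRep
    mark := h6 ▸ h.mark }

theorem length_lt_of_notMem {n v : ℕ} {l : List ℕ} (hl : l.Nodup) (hn : ∀ x ∈ l, x < n)
    (hv : v < n) (hvl : v ∉ l) : l.length < n := by
  have h := (List.subperm_of_subset (List.nodup_cons.2 ⟨hvl, hl⟩)
    (l₂ := List.range n) (fun u hu => List.mem_range.2 ?_)).length_le
  · simpa using h
  · rcases List.mem_cons.1 hu with rfl | hu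
    · exact hv
    · exact hn u hu

/-- Removes the node in the variable `12`. -/
def markNode : Program :=
  .seq (.store 6 (.var 12) (.lit 1)) <| .seq (.store 7 (.var 19) (.var 12)) <|
  .assign 19 (.var 19 + .lit 1)

/-- Processes all arcs to a node, beginning with the arc in the variable `18`. -/
def removeArcs : Program :=
  .loop (.var 18) <|
    .seq (.assign 12 (.get 4 (.var 18))) <|
    .seq (.store 5 (.var 12) (.get 5 (.var 12) - .lit 1)) <|
    .seq (.assign 18 (.get 3 (.var 18))) <|
    .cond (.get 6 (.var 12)) .skip <| .cond ((Expr.get 5 (.var 12)).lt (.var 8)) markNode .skip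

/-- Peels, beginning with the nodes on the stack. -/
def peel : Program :=
  .loop (.var 19) <|
    .seq (.seq (.assign 19 (.var 19 - .lit 1)) <| .seq (.assign 15 (.get 7 (.var 19))) <|
      .assign 18 (.get 2 (.var 15)))
    removeArcs

section

variable {n : ℕ} {G : SimpleGraph (Fin n)} {I : IncidenceLists G} {W : ℕ}
  {act : ℕ → Prop} {τ : ℕ} {cs : List (ℕ × ℕ)}

theorem pre_markNode {s : Memory} {P : Finset ℕ} {l : List ℕ} (h : PeelState n act τ cs s P l)
    {v : ℕ} (hv : s.var 12 = v) (hvn : v < n) (hact : act v) (hP : v ∉ P) (hl : v ∉ l)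
    (hdrop : ∀ S, ArcStable act τ cs S → v ∉ S) (hW : n < W) :
    markNode.Pre I W s fun s' => PeelState n act τ cs s' P (v :: l) ∧ Frame [19] [6, 7] s s' := by
  have h1 := h.size
  have h2 := length_lt_of_notMem h.nodup (fun x hx => (h.stack x hx).1) hvn hl
  simp [markNode, Program.Pre, hv, h1]
  and_intros
  all_goals try omega
  · refine ⟨List.nodup_cons.2 ⟨hl, h.nodup⟩, ?_, h.done, by simp, ⟨by simp, ?_⟩, ?_, ?_⟩
    · intro x hx
      rcases List.mem_cons.1 hx with rfl | hx
      · exact ⟨hvn, hact, hP⟩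
      · exact h.stack x hx
    · refine h.stackRep.congr fun i hi => ?_
      simp [hi.ne]
    · intro x hx
      have := h.mark x hx
      by_cases hxv : x = v
      · simp [hxv]
      · simp [hxv, this]
    · intro S hS x hx
      refine ⟨(h.drop S hS x hx).1, fun hxl => ?_⟩
      rcases List.mem_cons.1 hxl with rfl | hxl
      · exact hdrop S hS hx
      · exact (h.drop S hS x hx).2 hxl
  · exact ⟨fun x hx => by simp at hx; simp [hx], fun a ha => by simp at ha; simp [ha]⟩

/-- The number of arcs to nodes in `S`. -/
noncomputable def arcsTo (cs : List (ℕ × ℕ)) (S : Set ℕ) : ℕ := hits (cs.map Prod.snd) S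

/-- The properties of the memory during the peeling process that do not depend on the order in
which the nodes are processed. -/
structure PeelInv (n : ℕ) (act : ℕ → Prop) (τ : ℕ) (cs : List (ℕ × ℕ)) (s₀ s : Memory)
    (P : Finset ℕ) (l : List ℕ) : Prop where
  arcs : ArcsRep n s cs
  state : PeelState n act τ cs s P l
  keep : ∀ v < n, act v → v ∉ P → v ∉ l → τ ≤ s.arr 5 v
  frame : Frame [12, 15, 18, 19] [5, 6, 7] s₀ s

/-- The node `u` already belongs to `P` while its incoming arcs are being visited. Hence the counter
of `v` is its number of arcs avoiding `P` plus its number of arcs to `u` in the unvisited suffix.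
Each arc has a credit of 20 steps. -/
theorem surely_removeArcs {w : ℕ} (hW : n < 2 ^ w) (hcsW : cs.length + 1 < 2 ^ w)
    (hcs : ∀ c ∈ cs, c.1 < n ∧ act c.1 ∧ c.2 < n)
    {s₀ : Memory} (hτ : s₀.var 8 = τ) {P : Finset ℕ} {u : ℕ} (hu : u ∈ P)
    (R : ℕ) {Q : Memory → ℕ → Prop}
    (hQ : ∀ s' t' l', PeelInv n act τ cs s₀ s' P l' →
      (∀ v < n, s'.arr 5 v = hits (targets cs v) {x | x ∉ P}) → R ≤ t' → Q s' t')
    {s : Memory} {t : ℕ} {l : List ℕ} (h : PeelInv n act τ cs s₀ s P l)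
      (he : s.var 18 = lastArc cs u)
    (hcnt : ∀ v < n, s.arr 5 v = hits (targets cs v) {x | x ∉ P} + hits (targets cs v) {u})
    (ht : 20 * arcsTo cs {u} + R + 1 ≤ t) :
    Surely I w s t removeArcs Q := by
  refine Surely.loop (fun s t => ∃ l cs', PeelInv n act τ cs s₀ s P l ∧ cs' <:+ cs ∧
    s.var 18 = lastArc cs' u ∧
    (∀ v < n, s.arr 5 v = hits (targets cs v) {x | x ∉ P} + hits (targets cs' v) {u}) ∧
    20 * arcsTo cs' {u} + R + 1 ≤ t) ?_ ⟨l, cs, h, List.suffix_rfl, he, hcnt, ht⟩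
  rintro s t ⟨l, cs', hI, hsuf, he, hcnt, ht⟩
  refine ⟨trivial, by omega, fun h0 => ?_, fun h0 => ?_⟩
  · simp only [Expr.val_var] at h0
    rcases lastArc_cases cs' u with ⟨h1, h2⟩ | ⟨v, cs'', h1, h2, h3, h4⟩
    · exact hQ _ _ l hI (fun v hv => by rw [hcnt v hv, h2]; omega) (by omega)
    · omega
  · simp only [Expr.val_var] at h0
    rcases lastArc_cases cs' u with ⟨h1, h2⟩ | ⟨v, cs'', h1, h2, h3, h4⟩
    · omega
    have hsuf' := h1.trans hsuf
    have hvu : (v, u) ∈ cs := hsuf'.mem List.mem_cons_self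
    have hvn : v < n := (hcs _ hvu).1
    have hact : act v := (hcs _ hvu).2.1
    have hsrc : s.arr 4 (cs''.length + 1) = v := hI.arcs.src _ _ hsuf'
    have hnext : s.arr 3 (cs''.length + 1) = lastArc cs'' u := hI.arcs.next _ _ hsuf'
    have hlen := hsuf'.length_le
    have hlen' := lastArc_le cs'' u
    have hcv := hcnt v hvn
    rw [h3 v, if_pos rfl] at hcv
    have hcvle : s.arr 5 v ≤ cs.length := by
      have h5 := hits_union (targets cs v) (S := {x | x ∉ P}) (T := {u})
        (Set.disjoint_singleton_right.2 fun h => h hu)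
      have h6 := hits_le_length (targets cs v) ({x | x ∉ P} ∪ {u})
      have h7 := length_targets_le cs v
      have h8 := hits_targets_suffix hsuf v {u}
      have h9 := hcnt v hvn
      omega
    have hmark := hI.state.mark v hvn
    have hτ' : s.var 8 = τ := (hI.frame.var 8 (by simp)).trans hτ
    simp only [List.length_cons] at hlen
    set s₁ := ((s.set 12 v).put 5 v (s.arr 5 v - 1)).set 18 (lastArc cs'' u) with hs₁
    have key : PeelState n act τ cs s₁ P l := hI.state.congr (by simp [hs₁]) (by simp [hs₁])
      (by simp [hs₁])
    have harcs : ArcsRep n s₁ cs := hI.arcs.congr (by simp [hs₁]) (by simp [hs₁])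
      (by simp [hs₁]) (by simp [hs₁])
    have hframe : Frame [12, 15, 18, 19] [5, 6, 7] s₀ s₁ :=
      ⟨fun x hx => by rw [← hI.frame.var x hx]; simp at hx; simp [hs₁, hx],
        fun a ha => by rw [← hI.frame.arr a ha]; simp at ha; simp [hs₁, ha]⟩
    have hcnt₁ : ∀ x < n, s₁.arr 5 x =
        hits (targets cs x) {x | x ∉ P} + hits (targets cs'' x) {u} := by
      intro x hx
      have hx' := hcnt x hx
      rw [h3 x] at hx'
      by_cases hxv : v = x
      · subst hxv
        simp [hs₁, hx']
        omega
      · simp [hs₁, Ne.symm hxv, hx', hxv]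
    refine Surely.of_pre (fun s' => ∃ l', PeelInv n act τ cs s₀ s' P l' ∧
      s'.var 18 = s₁.var 18 ∧ s'.arr 5 = s₁.arr 5) ?_ ?_ ?_
    · have hkeep : ∀ x < n, act x → x ∉ P → x ∉ l → x ≠ v → τ ≤ s₁.arr 5 x := by
        intro x h1 h2 h3 h4 h5
        have := hI.keep x h1 h2 h3 h4
        simpa [hs₁, h5] using this
      have e1 : s₁.arr 6 = s.arr 6 := by simp [hs₁]
      have e2 : s₁.var 12 = v := by simp [hs₁]
      have e3 : s₁.var 8 = τ := by simp [hs₁, hτ']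
      have e4 : s₁.arr 5 v = s.arr 5 v - 1 := by simp [hs₁]
      generalize 2 ^ w = W at *
      simp [Program.Pre, he, h2, hsrc, hnext, ← hs₁, e1, e2, e3, e4]
      and_intros
      all_goals try omega
      · intro hm
        refine ⟨l, harcs, key, fun x hx1 hx2 hx3 hx4 => ?_, hframe⟩
        refine hkeep x hx1 hx2 hx3 hx4 ?_
        rintro rfl
        rw [hmark] at hm
        simp [hx3, hx4] at hm
      · intro hm
        have hm' : v ∉ P ∧ v ∉ l := by
          by_contra hcon
          rw [if_pos (by tauto)] at hmark
          omega
        and_intros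
        · split_ifs <;> omega
        · intro hlt
          refine (pre_markNode key (v := v) (by simp [hs₁]) hvn hact hm'.1 hm'.2 ?_ hW).mono ?_
          -- Nodes of a stable set and inactive nodes are never in `P`. A node with fewer than `τ`
          -- arcs avoiding `P` is thus in no stable set, and it is safe to remove it.
          · intro S hS hvS
            have h5 := (hS v hvS).2
            have h6 := hcnt₁ v hvn
            have h7 : hits (targets cs v) {x | x ∈ S ∨ ¬ act x} ≤
                hits (targets cs v) {x | x ∉ P} := by
              refine hits_mono _ fun a _ ha haP => ?_
              rcases ha with ha | ha
              · exact (hI.state.drop S hS a ha).1 haP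
              · exact ha (hI.state.done a haP).2
            simp [hs₁] at h6
            omega
          · rintro s' ⟨hs', hf⟩
            refine ⟨⟨v :: l, ?_, hs', ?_, hframe.trans hf⟩, hf.var 18 (by simp), hf.arr 5 (by simp)⟩
            · exact harcs.congr (hf.var 17 (by simp)) (hf.arr 2 (by simp)) (hf.arr 3 (by simp))
                (hf.arr 4 (by simp))
            · intro x hx1 hx2 hx3 hx4
              simp only [List.mem_cons, not_or] at hx4
              rw [hf.arr 5 (by simp)]
              exact hkeep x hx1 hx2 hx3 hx4.2 hx4.1
        · intro hge
          refine ⟨l, harcs, key, fun x hx1 hx2 hx3 hx4 => ?_, hframe⟩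
          by_cases hxv : x = v
          · subst hxv
            simpa [hs₁] using hge
          · exact hkeep x hx1 hx2 hx3 hx4 hxv
    · have : Program.cost (Program.seq (.assign 12 (.get 4 (.var 18))) <|
        .seq (.store 5 (.var 12) (.get 5 (.var 12) - .lit 1)) <|
        .seq (.assign 18 (.get 3 (.var 18))) <|
        .cond (.get 6 (.var 12)) .skip <|
          .cond ((Expr.get 5 (.var 12)).lt (.var 8)) markNode .skip) ≤ 18 := by decide
      simp only [arcsTo] at ht
      omega
    · rintro s' t' ⟨l', h5, h6, h7⟩ ht'
      have : Program.cost (Program.seq (.assign 12 (.get 4 (.var 18))) <|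
        .seq (.store 5 (.var 12) (.get 5 (.var 12) - .lit 1)) <|
        .seq (.assign 18 (.get 3 (.var 18))) <|
        .cond (.get 6 (.var 12)) .skip <|
          .cond ((Expr.get 5 (.var 12)).lt (.var 8)) markNode .skip) ≤ 18 := by decide
      refine ⟨l', cs'', h5, (List.suffix_cons _ _).trans hsuf', by simp [h6, hs₁],
        fun x hx => by rw [h7, hcnt₁ x hx], ?_⟩
      simp only [arcsTo] at ht ⊢
      omega

theorem PeelState.pop {s : Memory} {P : Finset ℕ} {u : ℕ} {l : List ℕ}
    (h : PeelState n act τ cs s P (u :: l)) {s' : Memory} (h19 : s'.var 19 = l.length)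
    (h6 : s'.arr 6 = s.arr 6) (h7 : s'.arr 7 = s.arr 7) :
    PeelState n act τ cs s' (insert u P) l where
  nodup := (List.nodup_cons.1 h.nodup).2
  stack x hx := by
    have h1 := h.stack x (List.mem_cons_of_mem _ hx)
    refine ⟨h1.1, h1.2.1, fun h2 => ?_⟩
    rcases Finset.mem_insert.1 h2 with rfl | h2
    · exact (List.nodup_cons.1 h.nodup).1 hx
    · exact h1.2.2 h2
  done x hx := by
    rcases Finset.mem_insert.1 hx with rfl | hx
    · have h1 := h.stack x List.mem_cons_self
      exact ⟨h1.1, h1.2.1⟩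
    · exact h.done x hx
  size := h19
  stackRep := h7 ▸ h.stackRep.2
  mark x hx := by
    have h1 : (x ∈ P ∨ x ∈ u :: l) ↔ (x ∈ insert u P ∨ x ∈ l) := by
      rw [Finset.mem_insert, List.mem_cons]
      tauto
    rw [h6, h.mark x hx]
    simp only [h1]
  drop S hS x hx := by
    have h1 := h.drop S hS x hx
    rw [List.mem_cons] at h1
    rw [Finset.mem_insert]
    tauto

/-- Every node is popped at most once and every arc is removed at most once, with its end. The
potential grants 40 steps to each node outside `P` and 20 steps to each arc whose end is outside
`P`. -/
theorem surely_peel {w : ℕ} (hW : n < 2 ^ w) (hcsW : cs.length + 1 < 2 ^ w)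
    (hcs : ∀ c ∈ cs, c.1 < n ∧ act c.1 ∧ c.2 < n)
    {s₀ : Memory} (hτ : s₀.var 8 = τ) (R : ℕ) {Q : Memory → ℕ → Prop}
    (hQ : ∀ s' t' P', PeelInv n act τ cs s₀ s' P' [] →
      (∀ v < n, s'.arr 5 v = hits (targets cs v) {x | x ∉ P'}) →
      40 * (n - P'.card) + 20 * arcsTo cs {x | x ∉ P'} + R ≤ t' → Q s' t')
    {s : Memory} {t : ℕ} {P : Finset ℕ} {l : List ℕ} (h : PeelInv n act τ cs s₀ s P l)
    (hcnt : ∀ v < n, s.arr 5 v = hits (targets cs v) {x | x ∉ P})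
    (ht : 40 * (n - P.card) + 20 * arcsTo cs {x | x ∉ P} + R + 1 ≤ t) :
    Surely I w s t peel Q := by
  refine Surely.loop (fun s t => ∃ P l, PeelInv n act τ cs s₀ s P l ∧
    (∀ v < n, s.arr 5 v = hits (targets cs v) {x | x ∉ P}) ∧
    40 * (n - P.card) + 20 * arcsTo cs {x | x ∉ P} + R + 1 ≤ t) ?_ ⟨P, l, h, hcnt, ht⟩
  rintro s t ⟨P, l, hI, hcnt, ht⟩
  refine ⟨trivial, by omega, fun h0 => ?_, fun h0 => ?_⟩
  · simp only [Expr.val_var, hI.state.size, List.length_eq_zero_iff] at h0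
    subst h0
    exact hQ _ _ P hI hcnt (by omega)
  · simp only [Expr.val_var, hI.state.size] at h0
    obtain ⟨u, l, rfl⟩ := List.exists_cons_of_ne_nil (l := l)
      (List.ne_nil_of_length_pos (Nat.pos_of_ne_zero h0))
    obtain ⟨hun, hact, huP⟩ := hI.state.stack u List.mem_cons_self
    have hsize := hI.state.size
    have hlast := hI.arcs.last u hun
    have hstk : s.arr 7 l.length = u := hI.state.stackRep.1
    have hlen := lastArc_le cs u
    have hlenl := length_lt_of_notMem (List.nodup_cons.1 hI.state.nodup).2
      (fun x hx => (hI.state.stack x (List.mem_cons_of_mem _ hx)).1) hun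
      (List.nodup_cons.1 hI.state.nodup).1
    simp only [List.length_cons] at hsize
    have hcard : P.card + 1 ≤ n := by
      have := Finset.card_le_card (s := insert u P) (t := Finset.range n) (by
        intro x hx
        rcases Finset.mem_insert.1 hx with rfl | hx
        · exact Finset.mem_range.2 hun
        · exact Finset.mem_range.2 (hI.state.done x hx).1)
      rwa [Finset.card_insert_of_notMem huP, Finset.card_range] at this
    have hsplit : ∀ l, hits l {x | x ∉ P} = hits l {x | x ∉ insert u P} + hits l {u} := by
      intro l
      rw [← hits_union _ (Set.disjoint_singleton_right.2 (by simp))]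
      refine hits_congr _ fun a _ => ?_
      simp only [Set.mem_union, Set.mem_ofPred_eq, Finset.mem_insert, Set.mem_singleton_iff]
      by_cases hau : a = u
      · simp [hau, huP]
      · simp [hau]
    refine Surely.seq (by omega) (Surely.of_pre
      (fun s' => s' = ((s.set 19 l.length).set 15 u).set 18 (lastArc cs u)) ?_ ?_ ?_)
    · generalize 2 ^ w = W at *
      simp [Program.Pre, hsize, hstk, hlast]
      omega
    · have : Program.cost (Program.seq (.assign 19 (.var 19 - .lit 1)) <|
        .seq (.assign 15 (.get 7 (.var 19))) <| .assign 18 (.get 2 (.var 15))) = 5 := by decide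
      omega
    · rintro s' t' rfl ht'
      have : Program.cost (Program.seq (.assign 19 (.var 19 - .lit 1)) <|
        .seq (.assign 15 (.get 7 (.var 19))) <| .assign 18 (.get 2 (.var 15))) = 5 := by decide
      have hcard' : (insert u P).card = P.card + 1 := Finset.card_insert_of_notMem huP
      refine surely_removeArcs hW hcsW hcs hτ (P := insert u P) (Finset.mem_insert_self _ _)
        (40 * (n - (insert u P).card) + 20 * arcsTo cs {x | x ∉ insert u P} + R + 1) ?_ (l := l)
        ⟨hI.arcs.congr (by simp) (by simp) (by simp) (by simp),
          hI.state.pop (by simp) (by simp) (by simp), ?_, ?_⟩ (by simp) ?_ ?_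
      · exact fun s' t' l' h1 h2 h3 => ⟨_, l', h1, h2, h3⟩
      · intro v h1 h2 h3 h4
        have := hI.keep v h1 h2 (fun h => h3 (Finset.mem_insert_of_mem h))
          (fun h => by
            rcases List.mem_cons.1 h with rfl | h
            · exact h3 (Finset.mem_insert_self _ _)
            · exact h4 h)
        simpa using this
      · exact ⟨fun x hx => by rw [← hI.frame.var x hx]; simp at hx; simp [hx],
          fun a ha => by rw [← hI.frame.arr a ha]; simp⟩
      · intro v hv
        rw [← hsplit]
        simpa using hcnt v hv
      · have := hsplit (cs.map Prod.snd)
        unfold arcsTo at *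
        omega

end

/-! ### The exact algorithm -/

/-- Adds arcs from `v` to the elements of a list. -/
def pushArcs (v : ℕ) (l : List ℕ) (cs : List (ℕ × ℕ)) : List (ℕ × ℕ) :=
  l.foldl (fun cs u => (v, u) :: cs) cs

/-- The arcs from the nodes less than `v` to all their neighbours. -/
def allArcs (nb : ℕ → List ℕ) (v : ℕ) : List (ℕ × ℕ) :=
  (List.range v).foldl (fun cs v => pushArcs v (nb v) cs) []

theorem allArcs_succ (nb : ℕ → List ℕ) (v : ℕ) :
    allArcs nb (v + 1) = pushArcs v (nb v) (allArcs nb v) := by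
  simp [allArcs, List.range_succ]

theorem pushArcs_append (v : ℕ) (l l' : List ℕ) (cs : List (ℕ × ℕ)) :
    pushArcs v (l ++ l') cs = pushArcs v l' (pushArcs v l cs) := by
  simp [pushArcs]

theorem length_pushArcs (v : ℕ) (l : List ℕ) (cs : List (ℕ × ℕ)) :
    (pushArcs v l cs).length = cs.length + l.length := by
  induction l generalizing cs with
  | nil => rfl
  | cons u l ih =>
    rw [pushArcs, List.foldl_cons]
    refine (ih _).trans ?_
    simp
    omega

theorem hits_targets_pushArcs (v : ℕ) (l : List ℕ) (cs : List (ℕ × ℕ)) (x : ℕ) (S : Set ℕ) :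
    hits (targets (pushArcs v l cs) x) S =
      (if v = x then hits l S else 0) + hits (targets cs x) S := by
  induction l generalizing cs with
  | nil => simp [pushArcs]
  | cons u l ih =>
    rw [pushArcs, List.foldl_cons]
    refine (ih _).trans ?_
    rw [hits_targets_cons]
    split_ifs
    · simp only [hits_cons, hits_nil]
      omega
    · omega

theorem mem_pushArcs {v : ℕ} {l : List ℕ} {cs : List (ℕ × ℕ)} {c : ℕ × ℕ}
    (h : c ∈ pushArcs v l cs) : (c.1 = v ∧ c.2 ∈ l) ∨ c ∈ cs := by
  induction l generalizing cs with
  | nil => exact Or.inr h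
  | cons u l ih =>
    rcases ih (cs := (v, u) :: cs) h with h | h
    · exact Or.inl ⟨h.1, List.mem_cons_of_mem _ h.2⟩
    · rcases List.mem_cons.1 h with rfl | h
      · exact Or.inl ⟨rfl, List.mem_cons_self⟩
      · exact Or.inr h

theorem length_allArcs_mono (nb : ℕ → List ℕ) : Monotone fun v => (allArcs nb v).length :=
  monotone_nat_of_le_succ fun v => by simp only [allArcs_succ, length_pushArcs]; omega

theorem length_allArcs (nb : ℕ → List ℕ) (n : ℕ) :
    (allArcs nb n).length = ∑ v ∈ Finset.range n, (nb v).length := by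
  induction n with
  | zero => rfl
  | succ n ih => rw [allArcs_succ, length_pushArcs, ih, Finset.sum_range_succ]

theorem hits_targets_allArcs (nb : ℕ → List ℕ) (n x : ℕ) (S : Set ℕ) :
    hits (targets (allArcs nb n) x) S = if x < n then hits (nb x) S else 0 := by
  induction n with
  | zero => rfl
  | succ n ih =>
    rw [allArcs_succ, hits_targets_pushArcs, ih]
    rcases lt_trichotomy x n with h | rfl | h
    · simp [h, h.ne', Nat.lt_succ_of_lt h]
    · simp
    · simp [h.ne, not_lt.2 h.le, not_lt.2 (Nat.succ_le_of_lt h)]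

theorem mem_allArcs {nb : ℕ → List ℕ} {n : ℕ} {c : ℕ × ℕ} (h : c ∈ allArcs nb n) :
    c.1 < n ∧ c.2 ∈ nb c.1 := by
  induction n with
  | zero => simp [allArcs] at h
  | succ n ih =>
    rw [allArcs_succ] at h
    rcases mem_pushArcs h with ⟨h1, h2⟩ | h
    · rw [h1]
      exact ⟨Nat.lt_succ_self _, h2⟩
    · exact ⟨(ih h).1.trans (Nat.lt_succ_self _), (ih h).2⟩

/-- Adds the arcs from the node in the variable `12` to all its neighbours. -/
def addNeighbors : Program :=
  .loop ((Expr.var 13).lt (.var 14)) <|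
    .seq (.neighbor 15 (.var 12) (.var 13)) <| .seq addArc <| .assign 13 (.var 13 + .lit 1)

/-- Adds all arcs. -/
def addAllArcs : Program :=
  .seq (.assign 12 (.lit 0)) <| .loop ((Expr.var 12).lt (.var 0)) <|
    .seq (.seq (.degree 14 (.var 12)) (.assign 13 (.lit 0))) <|
    .seq addNeighbors <| .assign 12 (.var 12 + .lit 1)

section

variable {n : ℕ} {G : SimpleGraph (Fin n)} {I : IncidenceLists G} {w : ℕ}

theorem surely_addNeighbors (hW : n < 2 ^ w) (R : ℕ) {Q : Memory → ℕ → Prop} {s₀ s : Memory}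
    {t v : ℕ} {cs : List (ℕ × ℕ)} (hvn : v < n) (hv : s₀.var 12 = v)
    (hd : s₀.var 14 = (nbrs I v).length)
    (hcsW : cs.length + (nbrs I v).length < 2 ^ w)
    (hQ : ∀ s' t', ArcsRep n s' (pushArcs v (nbrs I v) cs) →
      (∀ x < n, s'.arr 5 x = (targets (pushArcs v (nbrs I v) cs) x).length) →
      Frame [13, 15, 17] [2, 3, 4, 5] s₀ s' → R ≤ t' → Q s' t')
    (hs : ArcsRep n s cs) (hcnt : ∀ x < n, s.arr 5 x = (targets cs x).length)
    (hf : Frame [13, 15, 17] [2, 3, 4, 5] s₀ s) (hj : s.var 13 = 0)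
    (ht : 20 * (nbrs I v).length + R + 1 ≤ t) : Surely I w s t addNeighbors Q := by
  have hG := isCoreGraph I
  refine Surely.loop (fun s t => ∃ j ≤ (nbrs I v).length,
    ArcsRep n s (pushArcs v ((nbrs I v).take j) cs) ∧
    (∀ x < n, s.arr 5 x = (targets (pushArcs v ((nbrs I v).take j) cs) x).length) ∧
    Frame [13, 15, 17] [2, 3, 4, 5] s₀ s ∧ s.var 13 = j ∧
    20 * ((nbrs I v).length - j) + R + 1 ≤ t) ?_ ⟨0, by omega, hs, hcnt, hf, hj, by omega⟩
  rintro s t ⟨j, hjd, hs, hcnt, hf, hj, ht⟩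
  have hv' := (hf.var 12 (by simp)).trans hv
  have hd' := (hf.var 14 (by simp)).trans hd
  have hdn := hG.length_le v
  refine ⟨Expr.fits_lt_var _ _ _ _ (by omega), by omega, fun h0 => ?_, fun h0 => ?_⟩
  · simp [hd', hj] at h0
    obtain rfl : j = (nbrs I v).length := by omega
    rw [List.take_length] at hs hcnt
    exact hQ s _ hs hcnt hf (by omega)
  · simp [hd', hj] at h0
    have hcost : Program.cost (Program.seq (.neighbor 15 (.var 12) (.var 13)) <|
      .seq addArc <| .assign 13 (.var 13 + .lit 1)) ≤ 15 := by decide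
    have hu : (nbrs I v).getD j 0 = (nbrs I v)[j] := by simp [h0]
    have hun := hG.lt v _ (List.getElem_mem h0)
    have htake : (nbrs I v).take (j + 1) = (nbrs I v).take j ++ [(nbrs I v)[j]] := by simp
    have hpush : pushArcs v ((nbrs I v).take (j + 1)) cs =
        (v, (nbrs I v)[j]) :: pushArcs v ((nbrs I v).take j) cs := by
      rw [htake, pushArcs_append]
      rfl
    refine Surely.of_pre (fun s' => ArcsRep n s' (pushArcs v ((nbrs I v).take (j + 1)) cs) ∧
      (∀ x < n, s'.arr 5 x = (targets (pushArcs v ((nbrs I v).take (j + 1)) cs) x).length) ∧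
      Frame [13, 15, 17] [2, 3, 4, 5] s₀ s' ∧ s'.var 13 = j + 1) ?_ (by omega) ?_
    · rw [hpush]
      generalize 2 ^ w = W at *
      simp only [Program.Pre, Expr.fits_var, Expr.val_var, hv', hj, neighborQuery_eq, hu, true_and]
      refine ⟨by omega, (pre_addArc (v := v) (u := (nbrs I v)[j]) (s := s.set 15 _)
        (hs.congr ?_ ?_ ?_ ?_) ?_ ?_ ?_ hvn hun hW ?_).mono ?_⟩
      · simp
      · simp
      · simp
      · simp
      · simpa using hcnt
      · simp [hv']
      · simp
      · rw [length_pushArcs, List.length_take]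
        omega
      · rintro s' ⟨h1, h2, h3⟩
        have hj' : s'.var 13 = j := by rw [h3.var 13 (by simp)]; simp [hj]
        simp [hj']
        and_intros
        all_goals try omega
        · exact h1.congr (by simp) (by simp) (by simp) (by simp)
        · refine ⟨fun x hx => ?_, fun a ha => ?_⟩
          · rw [← hf.var x hx]
            have := h3.var x (by simp at hx; simp [hx])
            simp at hx
            simpa [hx] using this
          · rw [← hf.arr a ha]
            simpa using h3.arr a ha
    · rintro s' t' ⟨h1, h2, h3, h4⟩ ht'
      exact ⟨j + 1, by omega, h1, h2, h3, h4, by omega⟩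

theorem surely_addAllArcs (hn0 : 0 < n) (hW : n < 2 ^ w) (R : ℕ) {Q : Memory → ℕ → Prop}
    {s₀ : Memory}
    {t : ℕ} (hcsW : (allArcs (nbrs I) n).length < 2 ^ w)
    (hQ : ∀ s' t', ArcsRep n s' (allArcs (nbrs I) n) →
      (∀ x < n, s'.arr 5 x = (nbrs I x).length) →
      Frame [12, 13, 14, 15, 17] [2, 3, 4, 5] s₀ s' → R ≤ t' → Q s' t')
    (hs : ArcsRep n s₀ []) (hcnt : ∀ x < n, s₀.arr 5 x = 0) (hn : s₀.var 0 = n)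
    (ht : 20 * (allArcs (nbrs I) n).length + 20 * n + R + 5 ≤ t) :
    Surely I w s₀ t addAllArcs Q := by
  have hG := isCoreGraph I
  refine Surely.seq (by omega) (Surely.of_pre (fun s => s = s₀.set 12 0) ?_ (t := t - 1)
    (by simp [Program.cost]; omega) ?_)
  · simp [Program.Pre]
  rintro s t' rfl ht'
  simp only [Program.cost] at ht'
  refine Surely.loop (fun s t => ∃ v ≤ n, ArcsRep n s (allArcs (nbrs I) v) ∧
    (∀ x < n, s.arr 5 x = (targets (allArcs (nbrs I) v) x).length) ∧
    Frame [12, 13, 14, 15, 17] [2, 3, 4, 5] s₀ s ∧ s.var 12 = v ∧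
    20 * ((allArcs (nbrs I) n).length - (allArcs (nbrs I) v).length) + 20 * (n - v) + R + 1 ≤ t)
    ?_ ⟨0, by omega, hs.congr (by simp) (by simp) (by simp) (by simp), by simpa [allArcs, targets]
      using hcnt,
      ⟨fun x hx => by simp at hx; simp [hx], fun a _ => by simp⟩, by simp, by omega⟩
  rintro s t ⟨v, hvn, hs, hcnt, hf, hv, ht⟩
  have hn' := (hf.var 0 (by simp)).trans hn
  refine ⟨Expr.fits_lt_var _ _ _ _ (by omega), by omega, fun h0 => ?_, fun h0 => ?_⟩
  · simp [hn', hv] at h0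
    obtain rfl : v = n := by omega
    refine hQ s _ hs (fun x hx => ?_) hf (by omega)
    rw [hcnt x hx, ← hits_univ, hits_targets_allArcs, if_pos hx, hits_univ]
  · simp [hn', hv] at h0
    have hmono := length_allArcs_mono (nbrs I) (Nat.succ_le_of_lt h0)
    have hlen : (allArcs (nbrs I) (v + 1)).length = _ :=
      (congrArg List.length (allArcs_succ _ _)).trans (length_pushArcs _ _ _)
    simp only [Nat.succ_eq_add_one, hlen] at hmono
    have hdn := hG.length_le v
    refine Surely.seq (by omega) (Surely.of_pre
      (fun s' => s' = (s.set 14 (nbrs I v).length).set 13 0) ?_ (by simp [Program.cost]; omega) ?_)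
    · generalize 2 ^ w = W at *
      simp [Program.Pre, hv, degreeQuery_eq]
      omega
    rintro s' t' rfl ht'
    simp only [Program.cost] at ht'
    refine Surely.seq (by omega) (surely_addNeighbors hW
      (20 * ((allArcs (nbrs I) n).length - (allArcs (nbrs I) (v + 1)).length) +
        20 * (n - (v + 1)) + R + 5)
      (s₀ := (s.set 14 (nbrs I v).length).set 13 0) (v := v) (cs := allArcs (nbrs I) v) h0
      (by simp [hv]) (by simp) (by omega) ?_ (hs.congr (by simp) (by simp) (by simp) (by simp))
      (by simpa using hcnt) Frame.rfl (by simp) (by omega))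
    intro s₂ t₂ h1 h2 h3 ht₂
    rw [← allArcs_succ] at h1 h2
    have hv₂ : s₂.var 12 = v := by rw [h3.var 12 (by simp)]; simp [hv]
    refine Surely.of_pre (fun s' => s' = s₂.set 12 (v + 1)) ?_ (by simp [Program.cost]; omega) ?_
    · generalize 2 ^ w = W at *
      simp [Program.Pre, hv₂]
      omega
    rintro s' t' rfl ht'
    simp only [Program.cost] at ht'
    refine ⟨v + 1, by omega, h1.congr (by simp) (by simp) (by simp) (by simp), by simpa using h2,
      ⟨fun x hx => ?_, fun a ha => ?_⟩, by simp, by omega⟩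
    · have h4 := h3.var x (by simp at hx; simp [hx])
      rw [← hf.var x hx]
      simp at hx
      simp [hx] at h4 ⊢
      exact h4
    · rw [← hf.arr a ha]
      simpa using h3.arr a ha

end

/-- The list of the first `m` entries of an array. -/
def arrList (a : ℕ → ℕ) (m : ℕ) : List ℕ := (List.range m).map a

theorem arrList_succ (a : ℕ → ℕ) (m : ℕ) : arrList a (m + 1) = arrList a m ++ [a m] := by
  simp [arrList, List.range_succ]

theorem arrList_congr {a a' : ℕ → ℕ} {m : ℕ} (h : ∀ i < m, a i = a' i) :
    arrList a m = arrList a' m :=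
  List.map_congr_left fun i hi => h i (List.mem_range.1 hi)

theorem arrList_prefix (a : ℕ → ℕ) {m m' : ℕ} (h : m ≤ m') : arrList a m <+: arrList a m' := by
  obtain ⟨d, rfl⟩ := Nat.exists_eq_add_of_le h
  exact ⟨(List.range d).map (fun i => a (m + i)), by simp [arrList, List.range_add]⟩

/-- Labels the remaining nodes with the level, puts those of too small degree on the stack, and
deletes removed nodes from the list of remaining nodes. -/
def scanRemaining : Program :=
  .loop ((Expr.var 21).lt (.var 20)) <|
    .seq (.assign 12 (.get 8 (.var 21))) <| .seq (.assign 21 (.var 21 + .lit 1)) <|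
    .cond (.get 6 (.var 12)) .skip <|
    .seq (.store 0 (.var 12) (.var 9)) <| .seq (.store 8 (.var 13) (.var 12)) <|
    .seq (.assign 13 (.var 13 + .lit 1)) <|
    .cond ((Expr.get 5 (.var 12)).lt (.var 8)) markNode .skip

/-- Peels with all thresholds `1, 2, …`. -/
def exactRounds : Program :=
  .loop (.var 20) <|
    .seq (.seq (.assign 21 (.lit 0)) <| .seq (.assign 13 (.lit 0)) <|
      .assign 8 (.var 9 + .lit 1)) <|
    .seq scanRemaining <| .seq (.assign 20 (.var 13)) <| .seq peel <| .assign 9 (.var 9 + .lit 1)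

/-- The exact algorithm. -/
def exactCores : Program :=
  .seq addAllArcs <| .seq (.assign 20 (.var 0)) exactRounds

/-- The state of the memory after the first `i` remaining nodes have been scanned. -/
structure ScanState (n τ k : ℕ) (cs : List (ℕ × ℕ)) (P : Finset ℕ) (s₀ s : Memory) (i : ℕ)
    (l : List ℕ) : Prop where
  arcs : ArcsRep n s cs
  state : PeelState n (· < n) τ cs s P l
  subset : ∀ x ∈ l, x ∈ arrList (s₀.arr 8) i
  keep : ∀ v ∈ arrList (s₀.arr 8) i, v ∉ P → v ∉ l → τ ≤ s.arr 5 v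
  size : s.var 13 = ((arrList (s₀.arr 8) i).filter (· ∉ P)).length
  rest : arrList (s.arr 8) (s.var 13) = (arrList (s₀.arr 8) i).filter (· ∉ P)
  unread : ∀ x, i ≤ x → s.arr 8 x = s₀.arr 8 x
  label : ∀ v ∈ arrList (s₀.arr 8) i, v ∉ P → s.arr 0 v = k
  old : ∀ v ∈ P, s.arr 0 v = s₀.arr 0 v
  frame : Frame [12, 13, 19, 21] [0, 6, 7, 8] s₀ s

section

variable {n : ℕ} {G : SimpleGraph (Fin n)} {I : IncidenceLists G} {w : ℕ} {cs : List (ℕ × ℕ)}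
  {P : Finset ℕ} {τ k : ℕ}

/-- The list is compacted in place: the write index never overtakes the read index, so unread
entries are intact. Labels are overwritten in every round, and the last one written is the core
number. -/
theorem surely_scanRemaining (hW : n < 2 ^ w) (hkW : k < 2 ^ w) {s₀ : Memory} {m : ℕ}
    (hm : s₀.var 20 = m) (hk : s₀.var 9 = k) (hτ : s₀.var 8 = τ)
    (hcnt : ∀ v < n, s₀.arr 5 v = hits (targets cs v) {x | x ∉ P})
    (hnodup : (arrList (s₀.arr 8) m).Nodup) (hlt : ∀ v ∈ arrList (s₀.arr 8) m, v < n)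
    (R : ℕ) {Q : Memory → ℕ → Prop}
    (hQ : ∀ s' t' l, ScanState n τ k cs P s₀ s' m l → R ≤ t' → Q s' t') {s : Memory} {t : ℕ}
    (h : ScanState n τ k cs P s₀ s 0 []) (hi : s.var 21 = 0) (hm0 : 0 < m)
    (ht : 30 * m + R + 1 ≤ t) :
    Surely I w s t scanRemaining Q := by
  have hmn : m ≤ n := by
    have := (List.subperm_of_subset hnodup (l₂ := List.range n)
      fun u hu => List.mem_range.2 (hlt u hu)).length_le
    simpa [arrList] using this
  refine Surely.loop (fun s t => ∃ i l, i ≤ m ∧ s.var 21 = i ∧ ScanState n τ k cs P s₀ s i l ∧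
    30 * (m - i) + R + 1 ≤ t) ?_ ⟨0, [], by omega, hi, h, by omega⟩
  rintro s t ⟨i, l, him, hi, h, ht⟩
  have hm' := (h.frame.var 20 (by simp)).trans hm
  have hk' := (h.frame.var 9 (by simp)).trans hk
  have hτ' := (h.frame.var 8 (by simp)).trans hτ
  refine ⟨Expr.fits_lt_var _ _ _ _ (by omega), by omega, fun h0 => ?_, fun h0 => ?_⟩
  · simp [hm', hi] at h0
    obtain rfl : i = m := by omega
    exact hQ _ _ l h (by omega)
  simp [hm', hi] at h0
  have hcost : Program.cost (Program.seq (.assign 12 (.get 8 (.var 21))) <|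
    .seq (.assign 21 (.var 21 + .lit 1)) <|
    .cond (.get 6 (.var 12)) .skip <|
    .seq (.store 0 (.var 12) (.var 9)) <| .seq (.store 8 (.var 13) (.var 12)) <|
    .seq (.assign 13 (.var 13 + .lit 1)) <|
    .cond ((Expr.get 5 (.var 12)).lt (.var 8)) markNode .skip) ≤ 28 := by decide
  obtain ⟨v, hv⟩ : ∃ v, v = s₀.arr 8 i := ⟨_, rfl⟩
  have hsv : s.arr 8 i = v := (h.unread i le_rfl).trans hv.symm
  have hsucc : arrList (s₀.arr 8) (i + 1) = arrList (s₀.arr 8) i ++ [v] := by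
    rw [arrList_succ, hv]
  have hpre := arrList_prefix (s₀.arr 8) (Nat.succ_le_of_lt h0)
  rw [Nat.succ_eq_add_one, hsucc] at hpre
  have hvm : v ∉ arrList (s₀.arr 8) i := by
    have := hnodup.sublist hpre.sublist
    rw [List.nodup_append] at this
    exact fun hmem => this.2.2 v hmem v (by simp) rfl
  have hvn : v < n := hlt v (hpre.mem (by simp))
  have hvl : v ∉ l := fun hl => hvm (h.subset v hl)
  have hmark := h.state.mark v hvn
  have hsize : s.var 13 ≤ i := by
    rw [h.size]
    exact (List.length_filter_le _ _).trans (by simp [arrList])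
  refine Surely.of_pre (fun s' => ∃ l', s'.var 21 = i + 1 ∧
    ScanState n τ k cs P s₀ s' (i + 1) l') ?_ (by omega) ?_
  swap
  · rintro s' t' ⟨l', h1, h2⟩ ht'
    exact ⟨i + 1, l', by omega, h1, h2, by omega⟩
  by_cases hvP : v ∈ P
  · rw [if_pos (Or.inl hvP)] at hmark
    have hfilter : (arrList (s₀.arr 8) (i + 1)).filter (· ∉ P) =
        (arrList (s₀.arr 8) i).filter (· ∉ P) := by simp [hsucc, hvP]
    generalize 2 ^ w = W at *
    simp [Program.Pre, hi, hsv, hmark]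
    and_intros
    all_goals try omega
    refine ⟨l, h.arcs.congr (by simp) (by simp) (by simp) (by simp),
      h.state.congr (by simp) (by simp) (by simp), ?_, ?_, ?_, ?_, ?_, ?_, ?_, ?_⟩
    · intro x hx
      rw [hsucc]
      exact List.mem_append_left _ (h.subset x hx)
    · intro x hx hxP hxl
      rw [hsucc, List.mem_append, List.mem_singleton] at hx
      rcases hx with hx | rfl
      · exact h.keep x hx hxP hxl
      · exact absurd hvP hxP
    · rw [hfilter]
      exact h.size
    · rw [hfilter]
      exact h.rest
    · exact fun x hx => h.unread x (by omega)
    · intro x hx hxP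
      rw [hsucc, List.mem_append, List.mem_singleton] at hx
      rcases hx with hx | rfl
      · exact h.label x hx hxP
      · exact absurd hvP hxP
    · exact h.old
    · exact ⟨fun x hx => by rw [← h.frame.var x hx]; simp at hx; simp [hx], h.frame.arr⟩
  · rw [if_neg (by tauto)] at hmark
    have hfilter : (arrList (s₀.arr 8) (i + 1)).filter (· ∉ P) =
        (arrList (s₀.arr 8) i).filter (· ∉ P) ++ [v] := by simp [hsucc, hvP]
    obtain ⟨j, hj⟩ : ∃ j, s.var 13 = j := ⟨_, rfl⟩
    have hrest := h.rest
    have hsz := h.size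
    rw [hj] at hrest hsz hsize
    have hcv : s.arr 5 v = hits (targets cs v) {x | x ∉ P} := by
      rw [h.frame.arr 5 (by simp), hcnt v hvn]
    set s₁ := ((((s.set 12 v).set 21 (i + 1)).put 0 v k).put 8 j v).set 13 (j + 1) with hs₁
    have harcs : ArcsRep n s₁ cs := h.arcs.congr (by simp [hs₁]) (by simp [hs₁]) (by simp [hs₁])
      (by simp [hs₁])
    have hstate : PeelState n (· < n) τ cs s₁ P l := h.state.congr (by simp [hs₁]) (by simp [hs₁])
      (by simp [hs₁])
    have hframe : Frame [12, 13, 19, 21] [0, 6, 7, 8] s₀ s₁ :=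
      ⟨fun x hx => by rw [← h.frame.var x hx]; simp at hx; simp [hs₁, hx],
        fun a ha => by rw [← h.frame.arr a ha]; simp at ha; simp [hs₁, ha]⟩
    have key : ∀ s' l', PeelState n (· < n) τ cs s' P l' → Frame [19] [6, 7] s₁ s' →
        (l' = v :: l ∨ l' = l ∧ τ ≤ s.arr 5 v) →
        ∃ l', s'.var 21 = i + 1 ∧ ScanState n τ k cs P s₀ s' (i + 1) l' := by
      intro s' l' h1 h2 h3
      have e13 : s'.var 13 = j + 1 := by rw [h2.var 13 (by simp)]; simp [hs₁]
      have e5 : s'.arr 5 = s.arr 5 := by rw [h2.arr 5 (by simp)]; simp [hs₁]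
      have e8 : s'.arr 8 = Function.update (s.arr 8) j v := by rw [h2.arr 8 (by simp)]; simp [hs₁]
      have e0 : s'.arr 0 = Function.update (s.arr 0) v k := by rw [h2.arr 0 (by simp)]; simp [hs₁]
      refine ⟨l', by rw [h2.var 21 (by simp)]; simp [hs₁], ?_, h1, ?_, ?_, ?_, ?_, ?_, ?_, ?_, ?_⟩
      · exact harcs.congr (h2.var 17 (by simp)) (h2.arr 2 (by simp)) (h2.arr 3 (by simp))
          (h2.arr 4 (by simp))
      · intro x hx
        rw [hsucc, List.mem_append, List.mem_singleton]
        rcases h3 with rfl | ⟨rfl, -⟩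
        · rcases List.mem_cons.1 hx with rfl | hx
          · exact Or.inr rfl
          · exact Or.inl (h.subset x hx)
        · exact Or.inl (h.subset x hx)
      · intro x hx hxP hxl
        rw [e5]
        rw [hsucc, List.mem_append, List.mem_singleton] at hx
        rcases h3 with rfl | ⟨rfl, hle⟩
        · rcases hx with hx | rfl
          · exact h.keep x hx hxP fun hl => hxl (List.mem_cons_of_mem _ hl)
          · exact absurd List.mem_cons_self hxl
        · rcases hx with hx | rfl
          · exact h.keep x hx hxP hxl
          · exact hle
      · rw [e13, hfilter, List.length_append, ← hsz]
        rfl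
      · rw [e13, arrList_succ, hfilter, ← hrest, e8]
        congr 1
        · exact arrList_congr fun x hx => by simp [hx.ne]
        · simp
      · intro x hx
        rw [e8, Function.update_of_ne (by omega)]
        exact h.unread x (by omega)
      · intro x hx hxP
        rw [e0]
        rw [hsucc, List.mem_append, List.mem_singleton] at hx
        by_cases hxv : x = v
        · simp [hxv]
        · simpa [hxv] using h.label x (by tauto) hxP
      · intro x hx
        rw [e0, Function.update_of_ne (by rintro rfl; exact hvP hx)]
        exact h.old x hx
      · exact hframe.trans h2
    have e1 : s₁.arr 5 = s.arr 5 := by simp [hs₁]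
    have e2 : s₁.var 12 = v := by simp [hs₁]
    have e3 : s₁.var 8 = τ := by simp [hs₁, hτ']
    generalize 2 ^ w = W at *
    simp [Program.Pre, hi, hsv, hmark, hj, hk', ← hs₁, e1, e2, e3, -exists_and_left]
    and_intros
    all_goals try omega
    · split_ifs <;> omega
    · intro hlt'
      refine (pre_markNode hstate e2 hvn hvn hvP hvl ?_ hW).mono ?_
      · intro S hS hvS
        have h5 := (hS v hvS).2
        have h7 : hits (targets cs v) {x | x ∈ S ∨ ¬ x < n} ≤
            hits (targets cs v) {x | x ∉ P} := by
          refine hits_mono _ fun a _ ha haP => ?_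
          rcases ha with ha | ha
          · exact (h.state.drop S hS a ha).1 haP
          · exact ha (h.state.done a haP).1
        omega
      · rintro s' ⟨h1, h2⟩
        exact key s' _ h1 h2 (Or.inl rfl)
    · intro hle
      exact key s₁ l hstate Frame.rfl (Or.inr ⟨rfl, hle⟩)

end

theorem mem_of_mem_targets {cs : List (ℕ × ℕ)} {v u : ℕ} (h : u ∈ targets cs v) : (v, u) ∈ cs := by
  induction cs with
  | nil => simp [targets] at h
  | cons c cs ih =>
    rw [targets] at h
    split_ifs at h with hc
    · rcases List.mem_cons.1 h with rfl | h
      · exact List.mem_cons.2 (Or.inl (by rw [← hc]))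
      · exact List.mem_cons_of_mem _ (ih h)
    · exact List.mem_cons_of_mem _ (ih h)

/-- The state of the memory in the exact algorithm when the nodes in `P`, with core number less
than `k`, have been removed. -/
structure ExactState (n : ℕ) (c : ℕ → ℕ) (cs : List (ℕ × ℕ)) (s₀ : Memory) (s : Memory) (k : ℕ)
    (P : Finset ℕ) : Prop where
  arcs : ArcsRep n s cs
  cnt : ∀ v < n, s.arr 5 v = hits (targets cs v) {x | x ∉ P}
  lt : ∀ v ∈ P, v < n
  notMem_iff : ∀ v < n, v ∉ P ↔ k ≤ c v
  mark : ∀ v < n, s.arr 6 v = if v ∈ P then 1 else 0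
  level : s.var 9 = k
  stack : s.var 19 = 0
  nodup : (arrList (s.arr 8) (s.var 20)).Nodup
  list_lt : ∀ v ∈ arrList (s.arr 8) (s.var 20), v < n
  complete : ∀ v < n, v ∉ P → v ∈ arrList (s.arr 8) (s.var 20)
  bound : ∀ v ∈ arrList (s.arr 8) (s.var 20), k ≤ c v + 1
  label : ∀ v ∈ P, s.arr 0 v = c v
  frame : Frame [8, 9, 12, 13, 15, 18, 19, 20, 21] [0, 5, 6, 7, 8] s₀ s

section

variable {n : ℕ} {G : SimpleGraph (Fin n)} {I : IncidenceLists G} {w : ℕ} {cs : List (ℕ × ℕ)}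
  {c : ℕ → ℕ} {nb : ℕ → List ℕ}

/-- After the peeling of round `k` exactly the nodes of core number above `k` remain, so the label
`k` is final for those removed in it. The list passed to the next round has at most as many entries
as there are nodes with `k ≤ c v`, and `∑ (c v + 1 - k)` falls by exactly this number. The sum
therefore pays for all later scans. -/
theorem surely_exactRounds (hG : IsCoreGraph n nb c) (hW : n + 2 < 2 ^ w)
    (hcsW : cs.length + 1 < 2 ^ w) (hcs : ∀ c ∈ cs, c.1 < n ∧ c.2 < n)
    (hhits : ∀ v S, hits (targets cs v) S = hits (nb v) S) (R : ℕ) {Q : Memory → ℕ → Prop}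
    {s₀ s : Memory} {t k : ℕ} {P : Finset ℕ} (h : ExactState n c cs s₀ s k P)
    (hQ : ∀ s' t', (∀ v < n, s'.arr 0 v = c v) →
      Frame [8, 9, 12, 13, 15, 18, 19, 20, 21] [0, 5, 6, 7, 8] s₀ s' → R ≤ t' → Q s' t')
    (ht : 40 * (n - P.card) + 20 * arcsTo cs {x | x ∉ P} +
      60 * (s.var 20 + ∑ v ∈ Finset.range n, (c v + 1 - k)) + R + 1 ≤ t) :
    Surely I w s t exactRounds Q := by
  refine Surely.loop (fun s t => ∃ k P, ExactState n c cs s₀ s k P ∧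
    40 * (n - P.card) + 20 * arcsTo cs {x | x ∉ P} +
      60 * (s.var 20 + ∑ v ∈ Finset.range n, (c v + 1 - k)) + R + 1 ≤ t) ?_ ⟨k, P, h, ht⟩
  rintro s t ⟨k, P, h, ht⟩
  refine ⟨trivial, by omega, fun h0 => ?_, fun h0 => ?_⟩
  · simp only [Expr.val_var] at h0
    refine hQ s _ (fun v hv => h.label v ?_) h.frame (by omega)
    by_contra hvP
    simpa [h0, arrList] using h.complete v hv hvP
  simp only [Expr.val_var] at h0
  obtain ⟨m, hm⟩ : ∃ m, s.var 20 = m := ⟨_, rfl⟩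
  obtain ⟨A, hA⟩ : ∃ A, A = arrList (s.arr 8) m := ⟨_, rfl⟩
  have hAm : A.length = m := by simp [hA, arrList]
  have hnodup := h.nodup
  have hlt := h.list_lt
  have hcomplete := h.complete
  have hbound := h.bound
  rw [hm] at h0 ht
  rw [hm, ← hA] at hnodup hlt hcomplete hbound
  -- The level remains a word: some node is still listed, and its core number is at least `k - 1`.
  have hk : k ≤ n + 1 := by
    obtain ⟨a, ha⟩ := List.exists_mem_of_length_pos (l := A) (by omega)
    have := hG.core_le_length (hlt a ha)
    have := hG.length_le a
    have := hbound a ha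
    omega
  have hlev := h.level
  refine Surely.seq (by omega) (Surely.of_pre
    (fun s' => s' = ((s.set 21 0).set 13 0).set 8 (k + 1)) ?_ (by simp [Program.cost]; omega) ?_)
  · generalize 2 ^ w = W at *
    simp [Program.Pre, hlev]
    omega
  rintro s₁ t₁ hs₁ ht₁
  simp only [Program.cost] at ht₁
  have hA₁ : arrList (s₁.arr 8) m = A := by simp [hs₁, hA]
  have hcnt₁ : ∀ v < n, s₁.arr 5 v = hits (targets cs v) {x | x ∉ P} := by simpa [hs₁] using h.cnt
  have hf₁ : Frame [8, 13, 21] [] s s₁ :=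
    ⟨fun x hx => by simp at hx; simp [hs₁, hx], fun a ha => by simp [hs₁]⟩
  have harcs₁ : ArcsRep n s₁ cs := h.arcs.congr (by simp [hs₁]) (by simp [hs₁])
      (by simp [hs₁]) (by simp [hs₁])
  -- All ends of arcs are active here, so an arc-stable set is stable in the graph itself and lies
  -- above level `k`.
  have hpos : ∀ S, ArcStable (· < n) (k + 1) cs S → ∀ v ∈ S, v ∉ P := by
    intro S hS v hv
    have hvn := (hS v hv).1
    have hle : k + 1 ≤ c v := by
      refine hG.le_core_of_stable (S := S) (fun u hu => ⟨(hS u hu).1, ?_⟩) hv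
      rw [← hhits]
      refine (hS u hu).2.trans (hits_mono _ fun a ha haS => ?_)
      rcases haS with haS | haS
      · exact haS
      · exact absurd (hcs _ (mem_of_mem_targets ha)).2 haS
    rw [h.notMem_iff v hvn]
    omega
  have hscan : ScanState n (k + 1) k cs P s₁ s₁ 0 [] :=
    { arcs := harcs₁
      state := ⟨by simp, by simp, fun x hx => ⟨h.lt x hx, h.lt x hx⟩, by simp [hs₁, h.stack],
        trivial, by simpa [hs₁] using h.mark, fun S hS v hv => ⟨hpos S hS v hv, by simp⟩⟩
      subset := by simp
      keep := by simp [arrList]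
      size := by simp [arrList, hs₁]
      rest := by simp [arrList, hs₁]
      unread := fun _ _ => rfl
      label := by simp [arrList]
      old := fun _ _ => rfl
      frame := Frame.rfl }
  refine Surely.seq (by omega) (surely_scanRemaining (k := k) (s₀ := s₁) (by omega) (by omega)
    (m := m)
    (by simp [hs₁, hm]) (by simp [hs₁, hlev]) (by simp [hs₁]) hcnt₁ (by rwa [hA₁]) (by rwa [hA₁])
    (t₁ - 1 - (30 * m + 1)) ?_ hscan (by simp [hs₁]) (by omega) (by omega))
  intro s₂ t₂ l h₂ ht₂
  obtain ⟨A', hA'⟩ : ∃ A', A' = A.filter (· ∉ P) := ⟨_, rfl⟩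
  have hrest := h₂.rest
  have hsize := h₂.size
  have hkeep := h₂.keep
  have hlabel := h₂.label
  rw [hA₁] at hrest hsize hkeep hlabel
  rw [← hA'] at hrest hsize
  have hA'mem : ∀ v, v ∈ A' ↔ v ∈ A ∧ v ∉ P := by simp [hA']
  refine Surely.seq (by omega) (Surely.of_pre
    (fun s' => s' = s₂.set 20 A'.length) ?_ (by simp [Program.cost]; omega) ?_)
  · have : A'.length ≤ A.length := hA' ▸ List.length_filter_le _ _
    have : A.length ≤ n := by
      simpa using (List.subperm_of_subset hnodup (l₂ := List.range n)
        fun u hu => List.mem_range.2 (hlt u hu)).length_le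
    generalize 2 ^ w = W at *
    simp [Program.Pre, hsize]
    omega
  rintro s₃ t₃ hs₃ ht₃
  simp only [Program.cost] at ht₃
  have hτ₃ : s₃.var 8 = k + 1 := by
    simp only [hs₃]
    rw [Memory.set_var, if_neg (by decide), h₂.frame.var 8 (by simp)]
    simp [hs₁]
  have hstate₃ : PeelInv n (· < n) (k + 1) cs s₃ s₃ P l :=
    { arcs := h₂.arcs.congr (by simp [hs₃]) (by simp [hs₃]) (by simp [hs₃]) (by simp [hs₃])
      state := h₂.state.congr (by simp [hs₃]) (by simp [hs₃]) (by simp [hs₃])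
      keep := fun v hv _ hvP hvl => by simpa [hs₃] using hkeep v (hcomplete v hv hvP) hvP hvl
      frame := Frame.rfl }
  have hlenA' : A'.length + ∑ v ∈ Finset.range n, (c v + 1 - (k + 1)) ≤
      ∑ v ∈ Finset.range n, (c v + 1 - k) := by
    have h1 : A'.length ≤ ((Finset.range n).filter fun v => k ≤ c v).card := by
      have h2 : A'.Nodup := hA' ▸ hnodup.filter _
      rw [← List.toFinset_card_of_nodup h2]
      refine Finset.card_le_card fun v hv => ?_
      rw [List.mem_toFinset, hA'mem] at hv
      rw [Finset.mem_filter, Finset.mem_range]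
      exact ⟨hlt v hv.1, (h.notMem_iff v (hlt v hv.1)).1 hv.2⟩
    rw [Finset.card_filter] at h1
    refine (Nat.add_le_add_right h1 _).trans ?_
    rw [← Finset.sum_add_distrib]
    refine Finset.sum_le_sum fun v _ => ?_
    split_ifs <;> omega
  refine Surely.seq (by omega) (surely_peel (act := (· < n)) (s₀ := s₃) (by omega) hcsW
    (fun c hc => ⟨(hcs c hc).1, (hcs c hc).1, (hcs c hc).2⟩) hτ₃
    (60 * (A'.length + ∑ v ∈ Finset.range n, (c v + 1 - (k + 1))) + R + 2) ?_ hstate₃ ?_ (by omega))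
  swap
  · intro v hv
    rw [← hcnt₁ v hv]
    simp only [hs₃, Memory.set_arr]
    rw [h₂.frame.arr 5 (by simp)]
  intro s₄ t₄ P' h₄ hcnt₄ ht₄
  have e8 : s₄.arr 8 = s₂.arr 8 := by rw [h₄.frame.arr 8 (by simp)]; simp [hs₃]
  have e0 : s₄.arr 0 = s₂.arr 0 := by rw [h₄.frame.arr 0 (by simp)]; simp [hs₃]
  have e20 : s₄.var 20 = A'.length := by rw [h₄.frame.var 20 (by simp)]; simp [hs₃]
  have e9 : s₄.var 9 = k := by
    rw [h₄.frame.var 9 (by simp)]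
    simp only [hs₃]
    rw [Memory.set_var, if_neg (by decide), h₂.frame.var 9 (by simp)]
    simp [hs₁, hlev]
  have hA₄ : arrList (s₄.arr 8) A'.length = A' := by rw [e8, ← hsize, hrest]
  have hpeeled : IsPeeled n (· < n) (k + 1) cs P' :=
    ⟨fun v hv => (h₄.state.done v hv).1, fun v hv hvn hvP => by
      rw [← hcnt₄ v hv]; exact h₄.keep v hv hvn hvP (by simp),
      fun S hS v hv => (h₄.state.drop S hS v hv).1⟩
  have hiff : ∀ v < n, v ∉ P' ↔ k + 1 ≤ c v := fun v hv => hpeeled.notMem_iff hG hhits hv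
  refine Surely.of_pre (fun s' => s' = s₄.set 9 (k + 1)) ?_ (by simp [Program.cost]; omega) ?_
  · generalize 2 ^ w = W at *
    simp [Program.Pre, e9]
    omega
  rintro s₅ t₅ hs₅ ht₅
  simp only [Program.cost] at ht₅
  have e20' : s₅.var 20 = A'.length := by simp [hs₅, e20]
  have hA₅ : arrList (s₅.arr 8) (s₅.var 20) = A' := by rw [e20']; simpa [hs₅] using hA₄
  refine ⟨k + 1, P', ?_, ?_⟩
  · constructor
    · exact h₄.arcs.congr (by simp [hs₅]) (by simp [hs₅]) (by simp [hs₅]) (by simp [hs₅])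
    · simpa [hs₅] using hcnt₄
    · exact hpeeled.active
    · exact hiff
    · simpa [hs₅] using h₄.state.mark
    · simp [hs₅]
    · simpa [hs₅] using h₄.state.size
    · rw [hA₅, hA']
      exact hnodup.filter _
    · rw [hA₅]
      exact fun v hv => hlt v ((hA'mem v).1 hv).1
    · rw [hA₅]
      refine fun v hv hvP => (hA'mem v).2 ?_
      have h1 : v ∉ P := (h.notMem_iff v hv).2 (by have := (hiff v hv).1 hvP; omega)
      exact ⟨hcomplete v hv h1, h1⟩
    · rw [hA₅]
      intro v hv
      have h1 := (hA'mem v).1 hv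
      have h2 := (h.notMem_iff v (hlt v h1.1)).1 h1.2
      omega
    · intro v hv
      have hvn := hpeeled.active v hv
      have h3 : s₅.arr 0 v = s₂.arr 0 v := by simp [hs₅, e0]
      rw [h3]
      by_cases hvP : v ∈ P
      · rw [h₂.old v hvP, ← h.label v hvP]
        simp [hs₁]
      · rw [hlabel v (hcomplete v hvn hvP) hvP]
        have h4 := (h.notMem_iff v hvn).1 hvP
        have h5 := mt (hiff v hvn).2 (not_not.2 hv)
        omega
    · have h6 : Frame [20] [] s₂ s₃ :=
        ⟨fun x hx => by simp at hx; simp [hs₃, hx], fun a ha => by simp [hs₃]⟩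
      have h7 : Frame [9] [] s₄ s₅ :=
        ⟨fun x hx => by simp at hx; simp [hs₅, hx], fun a ha => by simp [hs₅]⟩
      have h8 : Frame [8, 9, 12, 13, 15, 18, 19, 20, 21] [0, 5, 6, 7, 8] s₁ s₃ := h₂.frame.trans h6
      have h9 : Frame [8, 9, 12, 13, 15, 18, 19, 20, 21] [0, 5, 6, 7, 8] s₃ s₅ := h₄.frame.trans h7
      have h10 : Frame [8, 9, 12, 13, 15, 18, 19, 20, 21] [0, 5, 6, 7, 8] s s₃ := hf₁.trans h8
      have h11 : Frame [8, 9, 12, 13, 15, 18, 19, 20, 21] [0, 5, 6, 7, 8] s s₅ := h10.trans h9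
      exact h.frame.trans h11
  · rw [e20']
    omega

theorem surely_exactCores (hn0 : 0 < n) (hW : n + 2 < 2 ^ w) {M : ℕ}
    (hM : ∑ v ∈ Finset.range n, (nbrs I v).length = M) (hMW : M + 1 < 2 ^ w)
    (R : ℕ) {Q : Memory → ℕ → Prop} {s : Memory} {t : ℕ}
    (hn : s.var 0 = n) (h9 : s.var 9 = 0) (h17 : s.var 17 = 0) (h19 : s.var 19 = 0)
    (h2 : ∀ v < n, s.arr 2 v = 0) (h5 : ∀ v < n, s.arr 5 v = 0) (h6 : ∀ v < n, s.arr 6 v = 0)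
    (h8 : ∀ v < n, s.arr 8 v = v)
    (hQ : ∀ s' t', (∀ v < n, s'.arr 0 v = coreFun G v) → s'.arr 1 = s.arr 1 → R ≤ t' → Q s' t')
    (ht : 200 * (n + M) + R + 10 ≤ t) : Surely I w s t exactCores Q := by
  have hG := isCoreGraph I
  have hlen := length_allArcs (nbrs I) n
  rw [hM] at hlen
  have hcsn : ∀ x, n ≤ x → nbrs I x = [] := fun x hx => by simp [nbrs, not_lt.2 hx]
  have hcs : ∀ c ∈ allArcs (nbrs I) n, c.1 < n ∧ c.2 < n := fun c hc =>
    ⟨(mem_allArcs hc).1, hG.lt _ _ (mem_allArcs hc).2⟩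
  have hhits : ∀ v S, hits (targets (allArcs (nbrs I) n) v) S = hits (nbrs I v) S := by
    intro v S
    rw [hits_targets_allArcs]
    split_ifs with h
    · rfl
    · rw [hcsn v (by omega)]
      rfl
  refine Surely.seq (by omega) (surely_addAllArcs hn0 (by omega) (180 * (n + M) - 20 * n + R + 3)
    (by omega) ?_
    ⟨by simpa using h17, fun c cs' h => by simp at h, fun c cs' h => by simp at h,
      fun u hu => by simpa [lastArc] using h2 u hu⟩ h5 hn (by omega))
  intro s₁ t₁ harcs hcnt hf ht₁
  have hn₁ : s₁.var 0 = n := (hf.var 0 (by simp)).trans hn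
  refine Surely.seq (by omega) (Surely.of_pre (fun s' => s' = s₁.set 20 n) ?_
    (by simp [Program.cost]; omega) ?_)
  · generalize 2 ^ w = W at *
    simp [Program.Pre, hn₁]
    omega
  rintro s₂ t₂ hs₂ ht₂
  simp only [Program.cost] at ht₂
  have e8 : ∀ v < n, s₂.arr 8 v = v := by
    intro v hv
    simp only [hs₂, Memory.set_arr]
    rw [hf.arr 8 (by simp), h8 v hv]
  have eA : arrList (s₂.arr 8) (s₂.var 20) = List.range n := by
    have : s₂.var 20 = n := by simp [hs₂]
    rw [this, arrList_congr e8]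
    simp [arrList]
  have ev : ∀ x, x ∉ [12, 13, 14, 15, 17, 20] → s₂.var x = s.var x := by
    intro x hx
    rw [← hf.var x (by simp at hx; simp [hx])]
    simp at hx
    simp [hs₂, hx]
  have ea : ∀ a, a ∉ [2, 3, 4, 5] → s₂.arr a = s.arr a := by
    intro a ha
    rw [← hf.arr a ha]
    simp [hs₂]
  refine surely_exactRounds hG hW (by omega) hcs hhits R (s₀ := s₂) (k := 0) (P := ∅)
    ⟨harcs.congr (by simp [hs₂]) (by simp [hs₂]) (by simp [hs₂]) (by simp [hs₂]), ?_, by simp,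
      by simp, ?_, ?_, ?_, ?_, ?_, ?_, by simp, by simp, Frame.rfl⟩ ?_ ?_
  · intro v hv
    have : hits (nbrs I v) {x | x ∉ (∅ : Finset ℕ)} = (nbrs I v).length := by
      rw [← hits_univ]
      exact hits_congr _ (by simp)
    rw [hhits, this, ← hcnt v hv]
    simp [hs₂]
  · intro v hv
    rw [ea 6 (by simp), h6 v hv]
    simp
  · rw [ev 9 (by simp), h9]
  · rw [ev 19 (by simp), h19]
  · rw [eA]
    exact List.nodup_range
  · rw [eA]
    exact fun v hv => List.mem_range.1 hv
  · rw [eA]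
    exact fun v hv _ => List.mem_range.2 hv
  · intro s' t' h1 h3 h4
    refine hQ s' t' h1 ?_ h4
    rw [h3.arr 1 (by simp), ea 1 (by simp)]
  · have e20 : s₂.var 20 = n := by simp [hs₂]
    have h1 : arcsTo (allArcs (nbrs I) n) {x | x ∉ (∅ : Finset ℕ)} ≤ M := by
      rw [arcsTo]
      refine (hits_le_length _ _).trans ?_
      simp [hlen]
    -- Core numbers are at most degrees, so all scans together take linear time.
    have h3 : ∑ v ∈ Finset.range n, (coreFun G v + 1 - 0) ≤ M + n := by
      rw [← hM]
      calc _ ≤ ∑ v ∈ Finset.range n, ((nbrs I v).length + 1) := by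
            refine Finset.sum_le_sum fun v hv => ?_
            have := hG.core_le_length (Finset.mem_range.1 hv)
            omega
        _ = _ := by simp [Finset.sum_add_distrib]
    rw [e20]
    simp only [Finset.card_empty]
    omega

end

/-! ### Programs whose random choices are samples of neighbours -/

section

variable {n : ℕ} {G : SimpleGraph (Fin n)} (I : IncidenceLists G) (w : ℕ)

/-- The random choices of the execution of `p` from the memory `s` are choices of a random
neighbour for the nodes in `vs`. If `cs'` are the choices made, preceded by `cs`, then the final
memory and the number of unused steps satisfy `Q cs'`. -/
def Samples (s : Memory) (t : ℕ) (p : Program) (vs : List ℕ) (cs : List (ℕ × ℕ))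
    (Q : List (ℕ × ℕ) → Memory → ℕ → Prop) : Prop :=
  ∀ (f : Memory → ℕ → ℝ≥0∞) (F : List (ℕ × ℕ) → ℝ≥0∞),
    (∀ s' t' cs', t' ≤ t → Q cs' s' t' → f s' t' ≤ F cs') →
    wp I w p f s t ≤ sampleExpect (nbrs I) vs cs F

variable {I w} {s : Memory} {t : ℕ} {p q : Program} {vs vs' : List ℕ} {cs : List (ℕ × ℕ)}
  {Q Q' : List (ℕ × ℕ) → Memory → ℕ → Prop}

theorem Surely.samples (h : Surely I w s t p (Q cs)) : Samples I w s t p [] cs Q :=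
  fun f F hf => h f (F cs) fun s' t' ht h' => hf s' t' cs ht h'

theorem Samples.seq (ht : 0 < t) (h : Samples I w s (t - 1) p vs cs fun cs' s' t' =>
    Samples I w s' t' q vs' cs' Q) : Samples I w s t (.seq p q) (vs ++ vs') cs Q := by
  obtain ⟨t, rfl⟩ : ∃ t', t = t' + 1 := ⟨t - 1, by omega⟩
  intro f F hf
  rw [wp_seq, sampleExpect_append]
  exact h _ _ fun s' t' cs' ht' h' => h' f F fun s'' t'' cs'' ht'' h'' =>
    hf s'' t'' cs'' (by simp at ht'; omega) h''

/-- The invariant carries the requests not yet served, and each iteration serves a prefix of them.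
The list of requests is fixed before the first choice; only the sampled neighbours are random. -/
theorem Samples.loop {e : Expr} (Inv : List ℕ → List (ℕ × ℕ) → Memory → ℕ → Prop)
    (h : ∀ vs cs s t, Inv vs cs s t → e.Fits (2 ^ w) s ∧ 0 < t ∧
      (e.val s = 0 → vs = [] ∧ Q cs s (t - 1)) ∧
      (e.val s ≠ 0 → ∃ vs₁ vs₂, vs = vs₁ ++ vs₂ ∧ Samples I w s (t - 1) p vs₁ cs (Inv vs₂)))
    (h0 : Inv vs cs s t) : Samples I w s t (.loop e p) vs cs Q := by
  intro f F hf
  induction t using Nat.strong_induction_on generalizing s vs cs with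
  | _ t ih =>
    obtain ⟨he, ht, h1, h2⟩ := h vs cs s t h0
    obtain ⟨t, rfl⟩ : ∃ t', t = t' + 1 := ⟨t - 1, by omega⟩
    rw [wp_loop, Expr.eval_eq_val he]
    split_ifs with hv
    · obtain ⟨vs₁, vs₂, rfl, h3⟩ := h2 hv
      rw [sampleExpect_append]
      refine h3 _ _ fun s' t' cs' ht' h' => ?_
      simp only [Nat.add_sub_cancel] at ht'
      exact ih t' (by omega) h' fun s'' t'' cs'' ht'' h'' => hf s'' t'' cs'' (by omega) h''
    · obtain ⟨rfl, h3⟩ := h1 (by simpa using hv)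
      exact hf _ _ _ (by omega) h3

/-- The two steps subtracted are the unfolding of the composition and the random choice. -/
theorem Samples.random {x v : ℕ} {e : Expr} (he : e.Fits (2 ^ w) s)
    (h : e.val s = (nbrs I v).length)
    (h0 : 0 < (nbrs I v).length) (hW : (nbrs I v).length < 2 ^ w) (ht : 1 < t)
    (hp : ∀ r < (nbrs I v).length, Surely I w (s.set x r) (t - 2) p
      (Q ((v, (nbrs I v).getD r 0) :: cs))) :
    Samples I w s t (.seq (.random x e) p) [v] cs Q := by
  obtain ⟨t, rfl⟩ : ∃ t', t = t' + 2 := ⟨t - 2, by omega⟩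
  intro f F hf
  rw [wp_seq, wp_random _ _ _ _ _ he (by rwa [h]) (by rwa [h]), h, sampleExpect]
  exact avg_mono fun r hr => hp r hr _ _ fun s' t' ht' h' => hf s' t' _ (by simp at ht'; omega) h'

end

/-! ### One level of the sampling algorithm -/

/-- Draws random neighbours of the node in the variable `12`. -/
def drawSamples : Program :=
  .loop ((Expr.var 13).lt (.var 16)) <|
    .seq (.random 22 (.var 14)) <| .seq (.neighbor 15 (.var 12) (.var 22)) <|
    .seq addArc <| .assign 13 (.var 13 + .lit 1)

/-- Determines the number of samples for the node in the variable `12`. -/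
def sampleSize : Program :=
  .seq (.assign 16 (.lit 0)) <| .seq (.assign 13 (.lit 0)) <|
  .cond (.get 0 (.var 12)) .skip <|
  .seq (.degree 14 (.var 12)) <| .seq (.assign 16 (.var 14 * .var 7 / .var 9)) <|
  .cond ((Expr.var 11).lt (.var 10 + .var 16)) (.assign 16 (.lit 0))
    (.assign 10 (.var 10 + .var 16))

/-- Draws all samples for one level. -/
def drawAll : Program :=
  .seq (.assign 12 (.lit 0)) <| .loop ((Expr.var 12).lt (.var 0)) <|
    .seq sampleSize <| .seq drawSamples <| .assign 12 (.var 12 + .lit 1)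

/-- The state of the memory after the samples `cs` for the nodes less than `v` have been drawn. -/
structure DrawState (n B : ℕ) (q : ℕ → ℕ) (s₀ s : Memory) (v : ℕ) (cs : List (ℕ × ℕ)) : Prop where
  arcs : ArcsRep n s cs
  cnt : ∀ x < n, s.arr 5 x = (targets cs x).length
  mem : ∀ c ∈ cs, c.1 < n ∧ s₀.arr 0 c.1 = 0 ∧ c.2 < n
  total : s.var 10 = s₀.var 10 + cs.length
  le : s.var 10 ≤ B
  le_sum : s.var 10 ≤ s₀.var 10 + ∑ x ∈ Finset.range v, q x
  frame : Frame [10, 12, 13, 14, 15, 16, 17, 22] [2, 3, 4, 5] s₀ s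

section

variable {n : ℕ} {G : SimpleGraph (Fin n)} {I : IncidenceLists G} {w : ℕ}

theorem samples_drawSamples (hW : n < 2 ^ w) (R : ℕ) {Q : List (ℕ × ℕ) → Memory → ℕ → Prop}
    {s₀ : Memory} {t v r : ℕ} {cs : List (ℕ × ℕ)} (hvn : v < n) (hv : s₀.var 12 = v)
    (hd : s₀.var 16 ≠ 0 → s₀.var 14 = (nbrs I v).length ∧ 0 < (nbrs I v).length)
    (hr : s₀.var 16 = r) (hrW : cs.length + r + 1 < 2 ^ w)
    (hQ : ∀ cs' s' t', ArcsRep n s' cs' → (∀ x < n, s'.arr 5 x = (targets cs' x).length) →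
      (∀ c ∈ cs', c ∈ cs ∨ (c.1 = v ∧ c.2 < n ∧ r ≠ 0)) → cs'.length = cs.length + r →
      Frame [13, 15, 17, 22] [2, 3, 4, 5] s₀ s' → R ≤ t' → Q cs' s' t')
    (hs : ArcsRep n s₀ cs) (hcnt : ∀ x < n, s₀.arr 5 x = (targets cs x).length)
    (hj : s₀.var 13 = 0) (ht : 20 * r + R + 1 ≤ t) :
    Samples I w s₀ t drawSamples (List.replicate r v) cs Q := by
  have hG := isCoreGraph I
  refine Samples.loop (fun vs cs' s t => ∃ j ≤ r, vs = List.replicate (r - j) v ∧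
    ArcsRep n s cs' ∧ (∀ x < n, s.arr 5 x = (targets cs' x).length) ∧
    (∀ c ∈ cs', c ∈ cs ∨ (c.1 = v ∧ c.2 < n ∧ r ≠ 0)) ∧ cs'.length = cs.length + j ∧
    Frame [13, 15, 17, 22] [2, 3, 4, 5] s₀ s ∧ s.var 13 = j ∧ 20 * (r - j) + R + 1 ≤ t) ?_
    ⟨0, by omega, rfl, hs, hcnt, fun c hc => Or.inl hc, rfl, Frame.rfl, hj, by omega⟩
  rintro vs cs' s t ⟨j, hjr, rfl, hs, hcnt, hmem, hlen, hf, hj, ht⟩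
  have hv' := (hf.var 12 (by simp)).trans hv
  have hr' := (hf.var 16 (by simp)).trans hr
  have hdn := hG.length_le v
  refine ⟨Expr.fits_lt_var _ _ _ _ (by omega), by omega, fun h0 => ?_, fun h0 => ?_⟩
  · simp [hr', hj] at h0
    obtain rfl : j = r := by omega
    exact ⟨by simp, hQ cs' s _ hs hcnt hmem hlen hf (by omega)⟩
  simp [hr', hj] at h0
  obtain ⟨hd1, hd2⟩ := hd (by omega)
  have hd' := (hf.var 14 (by simp)).trans hd1
  refine ⟨[v], List.replicate (r - (j + 1)) v, ?_, Samples.random trivial hd' hd2 (by omega)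
    (by omega) fun i hi => ?_⟩
  · rw [List.singleton_append, ← List.replicate_succ]
    congr 1
    omega
  have hcost : Program.cost (Program.seq (.neighbor 15 (.var 12) (.var 22)) <|
      .seq addArc <| .assign 13 (.var 13 + .lit 1)) ≤ 15 := by decide
  have hu : (nbrs I v).getD i 0 = (nbrs I v)[i] := by simp [hi]
  have hun := hG.lt v _ (List.getElem_mem hi)
  rw [hu]
  refine Surely.of_pre (fun s' => ArcsRep n s' ((v, (nbrs I v)[i]) :: cs') ∧
    (∀ x < n, s'.arr 5 x = (targets ((v, (nbrs I v)[i]) :: cs') x).length) ∧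
    Frame [13, 15, 17, 22] [2, 3, 4, 5] s₀ s' ∧ s'.var 13 = j + 1) ?_ (by omega) ?_
  swap
  · rintro s' t' ⟨h1, h2, h3, h4⟩ ht'
    refine ⟨j + 1, by omega, rfl, h1, h2, ?_, by simp; omega, h3, h4, by omega⟩
    intro c hc
    rcases List.mem_cons.1 hc with rfl | hc
    · exact Or.inr ⟨rfl, hun, by omega⟩
    · exact hmem c hc
  generalize 2 ^ w = W at *
  have hv'' : (s.set 22 i).var 12 = v := by simp [hv']
  have hi'' : (s.set 22 i).var 22 = i := by simp
  simp only [Program.Pre, Expr.fits_var, Expr.val_var, hv'', hi'', neighborQuery_eq, hu, true_and]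
  refine ⟨by omega, (pre_addArc (v := v) (u := (nbrs I v)[i]) (s := (s.set 22 i).set 15 _)
    (hs.congr (by simp) (by simp) (by simp) (by simp)) (by simpa using hcnt) (by simp [hv'])
    (by simp) hvn hun hW (by omega)).mono ?_⟩
  rintro s' ⟨h1, h2, h3⟩
  have hj' : s'.var 13 = j := by rw [h3.var 13 (by simp)]; simp [hj]
  simp [hj']
  and_intros
  all_goals try omega
  · exact h1.congr (by simp) (by simp) (by simp) (by simp)
  · refine ⟨fun x hx => ?_, fun a ha => ?_⟩
    · rw [← hf.var x hx]
      have := h3.var x (by simp at hx; simp [hx])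
      simp at hx
      simpa [hx] using this
    · rw [← hf.arr a ha]
      simpa using h3.arr a ha

/-- Each unit of the budget carries 40 steps: 20 are available for drawing a sample and 20 are
handed on for removing its arc during the peeling. The term `n * L` in the word bound is needed
because a demand is computed and added to the total before it is compared with the budget. -/
theorem samples_drawAll {k L B : ℕ} {s₀ : Memory} (hn : s₀.var 0 = n) (hk : s₀.var 9 = k)
    (hL : s₀.var 7 = L) (hB : s₀.var 11 = B) (hW : B + n * L + n + 2 < 2 ^ w)
    {q : ℕ → ℕ} (hq : ∀ v < n, q v = if s₀.arr 0 v = 0 then (nbrs I v).length * L / k else 0)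
    (R : ℕ) {Q : List (ℕ × ℕ) → Memory → ℕ → Prop} {t : ℕ}
    (hs : ArcsRep n s₀ []) (hcnt : ∀ x < n, s₀.arr 5 x = 0) (hle : s₀.var 10 ≤ B)
    (hQ : ∀ cs s' t', DrawState n B q s₀ s' n cs →
      20 * cs.length + 40 * (B - s'.var 10) + R ≤ t' → Q cs s' t')
    (ht : 40 * n + 40 * (B - s₀.var 10) + R + 5 ≤ t) :
    Samples I w s₀ t drawAll (requests q B (s₀.var 10) (List.range' 0 n)) [] Q := by
  have hG := isCoreGraph I
  refine Samples.seq (vs := []) (by omega) (Surely.samples (Surely.of_pre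
    (fun s => s = s₀.set 12 0) ?_ (by simp [Program.cost]; omega) ?_))
  · simp [Program.Pre]
  rintro s t' rfl ht'
  simp only [Program.cost] at ht'
  refine Samples.loop (fun vs cs s t => ∃ v ≤ n,
    vs = requests q B (s.var 10) (List.range' v (n - v)) ∧ DrawState n B q s₀ s v cs ∧
    s.var 12 = v ∧ 40 * (n - v) + 20 * cs.length + 40 * (B - s.var 10) + R + 1 ≤ t) ?_
    ⟨0, by omega, by simp, ⟨hs.congr (by simp) (by simp) (by simp) (by simp),
      by simpa [targets] using hcnt, by simp, by simp, by simpa using hle, by simp,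
      ⟨fun x hx => by simp at hx; simp [hx], fun a _ => by simp⟩⟩, by simp, by simp; omega⟩
  rintro vs cs s t ⟨v, hvn, rfl, h, hv, ht⟩
  have hn' := (h.frame.var 0 (by simp)).trans hn
  have hk' := (h.frame.var 9 (by simp)).trans hk
  have hL' := (h.frame.var 7 (by simp)).trans hL
  have hB' := (h.frame.var 11 (by simp)).trans hB
  have ha0 := h.frame.arr 0 (by simp)
  refine ⟨Expr.fits_lt_var _ _ _ _ (by omega), by omega, fun h0 => ?_, fun h0 => ?_⟩
  · simp [hn', hv] at h0
    obtain rfl : v = n := by omega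
    exact ⟨by simp [requests], hQ cs s _ h (by omega)⟩
  simp [hn', hv] at h0
  obtain ⟨T, hT⟩ : ∃ T, s.var 10 = T := ⟨_, rfl⟩
  obtain ⟨r, hr⟩ : ∃ r, r = if T + q v ≤ B then q v else 0 := ⟨_, rfl⟩
  have hrange : List.range' v (n - v) = v :: List.range' (v + 1) (n - (v + 1)) := by
    rw [show n - v = n - (v + 1) + 1 by omega, List.range'_succ]
  have hvs : requests q B T (List.range' v (n - v)) =
      List.replicate r v ++ requests q B (T + r) (List.range' (v + 1) (n - (v + 1))) := by
    rw [hrange, requests]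
    split_ifs with h1
    · rw [hr, if_pos h1]
    · rw [hr, if_neg h1]
      simp
  have htot := h.total
  have hleB := h.le
  have hsum := h.le_sum
  rw [hT] at htot hleB hsum ht ⊢
  have hd : (nbrs I v).length ≤ n := hG.length_le v
  have hdL : (nbrs I v).length * L ≤ n * L := Nat.mul_le_mul_right L hd
  have hdLk : (nbrs I v).length * L / k ≤ (nbrs I v).length * L := Nat.div_le_self _ _
  have hqv := hq v h0
  refine ⟨_, _, hvs, Samples.seq (vs := []) (by omega) (Surely.samples (Surely.of_pre
    (fun s₁ => s₁.var 16 = r ∧ s₁.var 13 = 0 ∧ s₁.var 10 = T + r ∧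
      (r ≠ 0 → s₁.var 14 = (nbrs I v).length ∧ 0 < (nbrs I v).length ∧ s₀.arr 0 v = 0) ∧
      Frame [10, 13, 14, 16] [] s s₁) ?_ ?_ ?_))⟩
  · have hfr : ∀ x, s.arr x = s.arr x := fun _ => rfl
    generalize 2 ^ w = W at *
    simp [sampleSize, Program.Pre, hv, ha0, degreeQuery_eq, hL', hk', hT, hB']
    and_intros
    all_goals try omega
    · intro h1
      rw [if_neg h1] at hqv
      have hr0 : r = 0 := by rw [hr, hqv]; simp
      refine ⟨hr0.symm, by omega, fun h => absurd hr0 h, ?_⟩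
      exact ⟨fun x hx => by simp at hx; simp [hx], fun a ha => by simp⟩
    · intro h1
      rw [if_pos h1] at hqv
      and_intros
      all_goals try omega
      · split_ifs <;> omega
      · intro h2
        have hr0 : r = 0 := by rw [hr, if_neg (by omega)]
        refine ⟨by omega, hr0.symm, by omega, fun h => absurd hr0 h, ?_⟩
        exact ⟨fun x hx => by simp at hx; simp [hx], fun a ha => by simp⟩
      · intro h2
        have hr0 : r = q v := by rw [hr, if_pos (by omega)]
        refine ⟨by omega, by omega, fun h3 => ⟨?_, h1⟩, ?_⟩
        · by_contra hcon
          have : (nbrs I v).length = 0 := by omega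
          rw [this] at hqv
          simp at hqv
          omega
        · exact ⟨fun x hx => by simp at hx; simp [hx], fun a ha => by simp⟩
  · have : Program.cost sampleSize ≤ 15 := by decide
    omega
  rintro s₁ t₁ ⟨e16, e13, e10, e14, hf₁⟩ ht₁
  have hcost : Program.cost sampleSize ≤ 15 := by decide
  have hrB : T + r ≤ B := by rw [hr]; split_ifs <;> omega
  have hrq : r ≤ q v := by rw [hr]; split_ifs <;> omega
  rw [← List.append_nil (List.replicate r v)]
  refine Samples.seq (by omega) (samples_drawSamples (by omega)
    (40 * (n - (v + 1)) + 20 * (cs.length + r) + 40 * (B - (T + r)) + R + 3)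
    h0 ((hf₁.var 12 (by simp)).trans hv) (fun h1 => ?_) e16 (by omega) ?_
    (h.arcs.congr (hf₁.var 17 (by simp)) (hf₁.arr 2 (by simp)) (hf₁.arr 3 (by simp))
      (hf₁.arr 4 (by simp))) ?_ e13 (by omega))
  · have := e14 (by omega)
    exact ⟨this.1, this.2.1⟩
  swap
  · rw [hf₁.arr 5 (by simp)]
    exact h.cnt
  intro cs₂ s₂ t₂ harcs₂ hcnt₂ hmem₂ hlen₂ hf₂ ht₂
  have e12 : s₂.var 12 = v := by rw [hf₂.var 12 (by simp), hf₁.var 12 (by simp), hv]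
  have e10' : s₂.var 10 = T + r := by rw [hf₂.var 10 (by simp), e10]
  refine Surely.samples (Surely.of_pre (fun s' => s' = s₂.set 12 (v + 1)) ?_
    (by simp [Program.cost]; omega) ?_)
  · generalize 2 ^ w = W at *
    simp [Program.Pre, e12]
    omega
  rintro s₃ t₃ hs₃ ht₃
  simp only [Program.cost] at ht₃
  have e10'' : s₃.var 10 = T + r := by simp [hs₃, e10']
  refine ⟨v + 1, by omega, by rw [e10''], ?_, by simp [hs₃], by omega⟩
  constructor
  · exact harcs₂.congr (by simp [hs₃]) (by simp [hs₃]) (by simp [hs₃]) (by simp [hs₃])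
  · simpa [hs₃] using hcnt₂
  · intro c hc
    rcases hmem₂ c hc with hc | ⟨hc1, hc2, hc3⟩
    · exact h.mem c hc
    · rw [hc1]
      exact ⟨h0, (e14 hc3).2.2, hc2⟩
  · omega
  · omega
  · rw [Finset.sum_range_succ]
    omega
  · have h6 : Frame [12] [] s₂ s₃ :=
        ⟨fun x hx => by simp at hx; simp [hs₃, hx], fun a ha => by simp [hs₃]⟩
    have h7 : Frame [10, 12, 13, 14, 15, 16, 17, 22] [2, 3, 4, 5] s₁ s₃ := hf₂.trans h6
    have h8 : Frame [10, 12, 13, 14, 15, 16, 17, 22] [2, 3, 4, 5] s s₃ := hf₁.trans h7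
    exact h.frame.trans h8

end

/-- Removes all unlabelled nodes of too small degree. -/
def scanAll : Program :=
  .seq (.seq (.assign 12 (.lit 0)) (.assign 19 (.lit 0))) <| .loop ((Expr.var 12).lt (.var 0)) <|
    .seq (.cond (.get 0 (.var 12)) .skip <|
      .cond ((Expr.get 5 (.var 12)).lt (.var 8)) markNode .skip) <|
    .assign 12 (.var 12 + .lit 1)

/-- Labels the remaining nodes, and prepares the memory for the next level. -/
def finishLevel : Program :=
  .seq (.seq (.assign 12 (.lit 0)) <| .seq (.assign 17 (.lit 0)) (.assign 13 (.var 9))) <|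
  .seq (.assign 9 (.var 9 - .lit 1 - .var 9 / (.var 2 + .lit 2))) <|
  .loop ((Expr.var 12).lt (.var 0)) <|
    .seq (.cond (.get 0 (.var 12)) .skip <|
      .cond (.get 6 (.var 12)) .skip (.store 0 (.var 12) (.var 13))) <|
    .seq (.store 2 (.var 12) (.lit 0)) <| .seq (.store 5 (.var 12) (.lit 0)) <|
    .seq (.store 6 (.var 12) (.lit 0)) (.assign 12 (.var 12 + .lit 1))

/-- One level of the sampling algorithm. -/
def level : Program := .seq drawAll <| .seq scanAll <| .seq peel finishLevel

/-- The state of the memory of the sampling algorithm at the beginning of level `k`. -/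
structure LevelState (n b L τ B : ℕ) (s : Memory) (k : ℕ) : Prop where
  nodes : s.var 0 = n
  accuracy : s.var 2 = b
  rate : s.var 7 = L
  threshold : s.var 8 = τ
  budget : s.var 11 = B
  level : s.var 9 = k
  le : s.var 10 ≤ B
  arcs : s.var 17 = 0
  head : ∀ v < n, s.arr 2 v = 0
  cnt : ∀ v < n, s.arr 5 v = 0
  mark : ∀ v < n, s.arr 6 v = 0
  den : ∀ v < n, s.arr 1 v = 1

section

variable {n : ℕ} {G : SimpleGraph (Fin n)} {I : IncidenceLists G} {w : ℕ}

/-- Prepares the peeling with `P = ∅`. A node with fewer than `τ` arcs altogether lies in no stable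
set, whatever the ends of its arcs. -/
theorem surely_scanAll (hW : n + 1 < 2 ^ w) {τ : ℕ} {cs : List (ℕ × ℕ)} (R : ℕ)
    {Q : Memory → ℕ → Prop} {s₀ : Memory} {t : ℕ} (hn : s₀.var 0 = n) (hτ : s₀.var 8 = τ)
    (hs : ArcsRep n s₀ cs) (hcnt : ∀ v < n, s₀.arr 5 v = (targets cs v).length)
    (hmark : ∀ v < n, s₀.arr 6 v = 0)
    (hQ : ∀ s' t' l, PeelInv n (fun v => v < n ∧ s₀.arr 0 v = 0) τ cs s₀ s' ∅ l →
      (∀ v < n, s'.arr 5 v = (targets cs v).length) → R ≤ t' → Q s' t')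
    (ht : 20 * n + R + 6 ≤ t) : Surely I w s₀ t scanAll Q := by
  refine Surely.seq (by omega) (Surely.of_pre
    (fun s => s = (s₀.set 12 0).set 19 0) ?_ (by simp [Program.cost]; omega) ?_)
  · simp [Program.Pre]
  rintro s t' rfl ht'
  simp only [Program.cost] at ht'
  refine Surely.loop (fun s t => ∃ v l, v ≤ n ∧ ArcsRep n s cs ∧
    PeelState n (fun v => v < n ∧ s₀.arr 0 v = 0) τ cs s ∅ l ∧ (∀ x ∈ l, x < v) ∧
    (∀ x < v, s₀.arr 0 x = 0 → x ∉ l → τ ≤ s.arr 5 x) ∧ s.arr 5 = s₀.arr 5 ∧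
    Frame [12, 15, 18, 19] [5, 6, 7] s₀ s ∧ s.var 12 = v ∧ 20 * (n - v) + R + 1 ≤ t) ?_
    ⟨0, [], by omega, hs.congr (by simp) (by simp) (by simp) (by simp),
      ⟨by simp, by simp, by simp, by simp, trivial, by simpa using hmark, by simp⟩, by simp, by
        simp,
      by simp, ⟨fun x hx => by simp at hx; simp [hx], fun a _ => by simp⟩, by simp, by omega⟩
  rintro s t ⟨v, l, hvn, hs, hP, hl, hkeep, h5, hf, hv, ht⟩
  have hn' := (hf.var 0 (by simp)).trans hn
  have hτ' := (hf.var 8 (by simp)).trans hτ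
  have ha0 := hf.arr 0 (by simp)
  refine ⟨Expr.fits_lt_var _ _ _ _ (by omega), by omega, fun h0 => ?_, fun h0 => ?_⟩
  · simp [hn', hv] at h0
    obtain rfl : v = n := by omega
    refine hQ s _ l ⟨hs, hP, ?_, hf⟩ ?_ (by omega)
    · exact fun x hx h1 _ h3 => hkeep x hx h1.2 h3
    · rwa [h5]
  simp [hn', hv] at h0
  have hcost : Program.cost (Program.seq (.cond (.get 0 (.var 12)) .skip <|
      .cond ((Expr.get 5 (.var 12)).lt (.var 8)) markNode .skip) <|
    .assign 12 (.var 12 + .lit 1)) ≤ 18 := by decide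
  have hvl : v ∉ l := fun h => (hl v h).false
  obtain ⟨Post, hPost⟩ : ∃ Post : Memory → Prop, Post = fun s' => ∃ l', ArcsRep n s' cs ∧
    PeelState n (fun v => v < n ∧ s₀.arr 0 v = 0) τ cs s' ∅ l' ∧ (∀ x ∈ l', x < v + 1) ∧
    (∀ x < v + 1, s₀.arr 0 x = 0 → x ∉ l' → τ ≤ s'.arr 5 x) ∧ s'.arr 5 = s₀.arr 5 ∧
    Frame [12, 15, 18, 19] [5, 6, 7] s₀ s' ∧ s'.var 12 = v + 1 := ⟨_, rfl⟩
  refine Surely.of_pre Post ?_ (by omega) ?_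
  swap
  · rw [hPost]
    rintro s' t' ⟨l', h1, h2, h3, h4, h5, h6, h7⟩ ht'
    exact ⟨v + 1, l', by omega, h1, h2, h3, h4, h5, h6, h7, by omega⟩
  have key : ∀ s' l', PeelState n (fun v => v < n ∧ s₀.arr 0 v = 0) τ cs s' ∅ l' →
      Frame [19] [6, 7] s s' → (l' = v :: l ∨ l' = l ∧ (s₀.arr 0 v = 0 → τ ≤ s.arr 5 v)) →
      s'.var 12 = v ∧ Post (s'.set 12 (v + 1)) := by
    rw [hPost]
    intro s' l' h1 h2 h3
    refine ⟨by rw [h2.var 12 (by simp), hv], l', ?_, h1.congr (by simp) (by simp) (by simp), ?_,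
      ?_, ?_, ?_, by simp⟩
    · exact hs.congr (by simp [h2.var 17]) (by simp [h2.arr 2]) (by simp [h2.arr 3])
        (by simp [h2.arr 4])
    · rcases h3 with rfl | ⟨rfl, -⟩
      · intro x hx
        rcases List.mem_cons.1 hx with rfl | hx
        · omega
        · exact (hl x hx).trans (by omega)
      · exact fun x hx => (hl x hx).trans (by omega)
    · intro x hx hx0 hxl
      rw [Memory.set_arr, h2.arr 5 (by simp)]
      rcases h3 with rfl | ⟨rfl, h3⟩
      · simp only [List.mem_cons, not_or] at hxl
        exact hkeep x (by omega) hx0 hxl.2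
      · rcases Nat.lt_succ_iff_lt_or_eq.1 hx with hx | rfl
        · exact hkeep x hx hx0 hxl
        · exact h3 hx0
    · rw [Memory.set_arr, h2.arr 5 (by simp), h5]
    · have h6 : Frame [12] [] s' (s'.set 12 (v + 1)) :=
        ⟨fun x hx => by simp at hx; simp [hx], fun a ha => by simp⟩
      have h7 : Frame [12, 15, 18, 19] [5, 6, 7] s (s'.set 12 (v + 1)) := h2.trans h6
      exact hf.trans h7
  have hc5 := hcnt v h0
  have h5v : s.arr 5 v = s₀.arr 5 v := by rw [h5]
  generalize 2 ^ w = W at *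
  simp only [Program.Pre, Expr.fits_get, Expr.fits_var, Expr.val_get, Expr.val_var, hv, ha0,
    true_and,
    Expr.fits_lt, Expr.val_lt, hτ', Expr.fits_add, Expr.fits_lit, Expr.val_add, Expr.val_lit, ne_eq]
  have hrest : ∀ s' : Memory, s'.var 12 = v ∧ Post (s'.set 12 (v + 1)) →
      (1 < W ∧ s'.var 12 + 1 < W) ∧ s'.var 12 + 1 < W ∧ Post (s'.set 12 (s'.var 12 + 1)) :=
    fun s' ⟨h12, h⟩ =>
    ⟨⟨by omega, by omega⟩, by omega, by rw [h12]; exact h⟩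
  refine ⟨fun h1 => by
    simpa only [hv] using hrest _ (key s l hP Frame.rfl (Or.inr ⟨rfl, fun h => absurd h h1⟩)), fun
      h1 => ⟨?_, fun h2 => ?_, fun h2 => ?_⟩⟩
  · split_ifs <;> omega
  · refine (pre_markNode hP hv h0 ⟨h0, h1⟩ (by simp) hvl ?_ (by omega)).mono ?_
    · intro S hS hvS
      have h6 := (hS v hvS).2
      have h7 := hits_le_length (targets cs v) {u | u ∈ S ∨ ¬ (u < n ∧ s₀.arr 0 u = 0)}
      have : s.arr 5 v < τ := by by_contra hcon; simp [hcon] at h2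
      omega
    · rintro s' ⟨h3, h4⟩
      exact hrest _ (key s' _ h3 h4 (Or.inl rfl))
  · have : τ ≤ s.arr 5 v := by by_contra hcon; simp [not_le.1 hcon] at h2
    simpa only [hv] using hrest _ (key s l hP Frame.rfl (Or.inr ⟨rfl, fun _ => this⟩))

/-- Only heads, counters and marks are cleared. With no arcs present, `ArcsRep` does not constrain
the links and starts, and the next scan begins with an empty stack. -/
theorem surely_finishLevel {b L τ B k : ℕ} (hW : n + k + b + 2 < 2 ^ w) {P : Finset ℕ}
    (R : ℕ) {Q : Memory → ℕ → Prop} {s₀ : Memory} {t : ℕ} (hn : s₀.var 0 = n) (hb : s₀.var 2 = b)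
    (hL : s₀.var 7 = L) (hτ : s₀.var 8 = τ) (hB : s₀.var 11 = B) (hk : s₀.var 9 = k)
    (hle : s₀.var 10 ≤ B) (hden : ∀ v < n, s₀.arr 1 v = 1)
    (hmark : ∀ v < n, s₀.arr 6 v = if v ∈ P then 1 else 0)
    (hQ : ∀ s' t', LevelState n b L τ B s' (nextLevel b k) →
      (∀ v < n, s'.arr 0 v = if s₀.arr 0 v = 0 ∧ v ∉ P then k else s₀.arr 0 v) →
      s'.var 10 = s₀.var 10 → R ≤ t' → Q s' t')
    (ht : 20 * n + R + 10 ≤ t) : Surely I w s₀ t finishLevel Q := by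
  refine Surely.seq (by omega) (Surely.of_pre
    (fun s => s = ((s₀.set 12 0).set 17 0).set 13 k) ?_ (by simp [Program.cost]; omega) ?_)
  · generalize 2 ^ w = W at *
    simp [Program.Pre, hk]
    omega
  rintro s₁ t₁ hs₁ ht₁
  simp only [Program.cost] at ht₁
  refine Surely.seq (by omega) (Surely.of_pre
    (fun s => s = s₁.set 9 (nextLevel b k)) ?_ (by simp [Program.cost]; omega) ?_)
  · have h9 : s₁.var 9 = k := by simp [hs₁, hk]
    have h2 : s₁.var 2 = b := by simp [hs₁, hb]
    have := Nat.div_le_self k (b + 2)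
    generalize 2 ^ w = W at *
    simp [Program.Pre, h9, h2, nextLevel]
    generalize k / (b + 2) = d at *
    omega
  rintro s t' rfl ht'
  simp only [Program.cost] at ht'
  refine Surely.loop (fun s t => ∃ v ≤ n,
    (∀ x < n, s.arr 0 x = if x < v ∧ s₀.arr 0 x = 0 ∧ x ∉ P then k else s₀.arr 0 x) ∧
    (∀ x < v, s.arr 2 x = 0 ∧ s.arr 5 x = 0 ∧ s.arr 6 x = 0) ∧
    (∀ x < n, v ≤ x → s.arr 6 x = if x ∈ P then 1 else 0) ∧
    Frame [12] [0, 2, 5, 6] (s₁.set 9 (nextLevel b k)) s ∧ s.var 12 = v ∧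
    20 * (n - v) + R + 1 ≤ t) ?_
    ⟨0, by omega, by simp [hs₁], by simp, by simpa [hs₁] using hmark, Frame.rfl, by simp [hs₁], by
      omega⟩
  rintro s t ⟨v, hvn, h0, hz, hm, hf, hv, ht⟩
  have e : ∀ x, x ∉ [12] → s.var x = _ := hf.var
  have hn' : s.var 0 = n := by rw [e 0 (by simp)]; simp [hs₁, hn]
  have hk' : s.var 13 = k := by rw [e 13 (by simp)]; simp [hs₁]
  refine ⟨Expr.fits_lt_var _ _ _ _ (by omega), by omega, fun h => ?_, fun h => ?_⟩
  · simp [hn', hv] at h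
    obtain rfl : v = n := by omega
    have e10 : s.var 10 = s₀.var 10 := by rw [e 10 (by simp)]; simp [hs₁]
    refine hQ s _ ⟨hn', ?_, ?_, ?_, ?_, ?_, by rwa [e10], ?_, fun x hx => (hz x hx).1,
      fun x hx => (hz x hx).2.1, fun x hx => (hz x hx).2.2, fun x hx => ?_⟩ ?_ e10 (by omega)
    · rw [e 2 (by simp)]; simp [hs₁, hb]
    · rw [e 7 (by simp)]; simp [hs₁, hL]
    · rw [e 8 (by simp)]; simp [hs₁, hτ]
    · rw [e 11 (by simp)]; simp [hs₁, hB]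
    · rw [e 9 (by simp)]; simp
    · rw [e 17 (by simp)]; simp [hs₁]
    · rw [hf.arr 1 (by simp)]
      simpa [hs₁] using hden x hx
    · intro x hx
      rw [h0 x hx]
      simp [hx]
  simp [hn', hv] at h
  have hcost : Program.cost (Program.seq (.cond (.get 0 (.var 12)) .skip <|
      .cond (.get 6 (.var 12)) .skip (.store 0 (.var 12) (.var 13))) <|
    .seq (.store 2 (.var 12) (.lit 0)) <| .seq (.store 5 (.var 12) (.lit 0)) <|
    .seq (.store 6 (.var 12) (.lit 0)) (.assign 12 (.var 12 + .lit 1))) ≤ 18 := by decide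
  have hv0 := h0 v h
  rw [if_neg (by simp)] at hv0
  have hv6 := hm v h le_rfl
  have key : ∀ s', Frame [] [0] s s' → s'.arr 0 =
      Function.update (s.arr 0) v (if s₀.arr 0 v = 0 ∧ v ∉ P then k else s₀.arr 0 v) →
      ∀ s'', s'' = (((s'.put 2 v 0).put 5 v 0).put 6 v 0).set 12 (v + 1) →
      (∀ x < n, s''.arr 0 x = if x < v + 1 ∧ s₀.arr 0 x = 0 ∧ x ∉ P then k else s₀.arr 0 x) ∧
      (∀ x < v + 1, s''.arr 2 x = 0 ∧ s''.arr 5 x = 0 ∧ s''.arr 6 x = 0) ∧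
      (∀ x < n, v + 1 ≤ x → s''.arr 6 x = if x ∈ P then 1 else 0) ∧
      Frame [12] [0, 2, 5, 6] (s₁.set 9 (nextLevel b k)) s'' ∧ s''.var 12 = v + 1 := by
    intro s' h1 h2 s'' hs''
    have e2 := h1.arr 2 (by simp)
    have e5 := h1.arr 5 (by simp)
    have e6 := h1.arr 6 (by simp)
    refine ⟨?_, ?_, ?_, ?_, by simp [hs'']⟩
    · intro x hx
      by_cases hxv : x = v
      · subst hxv
        simp [hs'', h2]
      · have : x < v + 1 ↔ x < v := by omega
        simp only [this, ← h0 x hx]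
        simp [hs'', h2, hxv]
    · intro x hx
      by_cases hxv : x = v
      · simp [hs'', hxv]
      · have := hz x (by omega)
        simpa [hs'', hxv, e2, e5, e6] using this
    · intro x hx hx'
      have : x ≠ v := by omega
      simpa [hs'', this, e6] using hm x hx (by omega)
    · have h6 : Frame [12] [2, 5, 6] s' s'' :=
        ⟨fun x hx => by simp at hx; simp [hs'', hx], fun a ha => by simp at ha; simp [hs'', ha]⟩
      have h7 : Frame [12] [0, 2, 5, 6] s s'' := h1.trans h6
      exact hf.trans h7
  refine Surely.of_pre (fun s'' =>
      (∀ x < n, s''.arr 0 x = if x < v + 1 ∧ s₀.arr 0 x = 0 ∧ x ∉ P then k else s₀.arr 0 x) ∧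
      (∀ x < v + 1, s''.arr 2 x = 0 ∧ s''.arr 5 x = 0 ∧ s''.arr 6 x = 0) ∧
      (∀ x < n, v + 1 ≤ x → s''.arr 6 x = if x ∈ P then 1 else 0) ∧
      Frame [12] [0, 2, 5, 6] (s₁.set 9 (nextLevel b k)) s'' ∧ s''.var 12 = v + 1) ?_ (by omega) ?_
  swap
  · rintro s' t' ⟨h1, h2, h3, h4, h5⟩ ht'
    exact ⟨v + 1, by omega, h1, h2, h3, h4, h5, by omega⟩
  -- A node that was labelled earlier or has been peeled keeps its entry, which amounts to
  -- overwriting the entry by its own value.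
  have key1 : ∀ (hne : ¬ (s₀.arr 0 v = 0 ∧ v ∉ P)), _ := fun hne => key s Frame.rfl
    (by rw [if_neg hne, ← hv0, Function.update_eq_self]) _ rfl
  have key2 : ∀ (hne : s₀.arr 0 v = 0 ∧ v ∉ P), _ := fun hne => key (s.put 0 v k)
    ⟨fun x hx => by simp, fun a ha => by simp at ha; simp [ha]⟩
    (by rw [if_pos hne]; simp) _ rfl
  generalize 2 ^ w = W at *
  simp only [Program.Pre, Expr.fits_get, Expr.fits_var, Expr.val_get, Expr.val_var, hv, true_and,
    Expr.fits_add, Expr.fits_lit, Expr.val_add, Expr.val_lit, ne_eq, hv0, hv6, hk',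
    Memory.put_var, Memory.set_var]
  refine ⟨fun h1 => ?_, fun h1 => ⟨fun h2 => ?_, fun h2 => ?_⟩⟩
  · exact ⟨by omega, by omega, by omega, by omega, by omega, by omega, by omega, by omega, key1
        (by tauto)⟩
  · have : v ∈ P := by by_contra hcon; simp [hcon] at h2
    exact ⟨by omega, by omega, by omega, by omega, by omega, by omega, by omega, by omega, key1
      (by tauto)⟩
  · have : v ∉ P := by by_contra hcon; simp [hcon] at h2
    exact ⟨by omega, by omega, by omega, by omega, by omega, by omega, by omega, by omega, by
      omega, key2 ⟨h1, this⟩⟩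

/-- Whatever is sampled, the level ends in a regular state. The outcome of the peeling is exposed
only through `IsPeeled`, which separates the probabilistic argument from the data structures. -/
theorem samples_level {b L τ B k : ℕ} (hW : B + n * L + n + k + b + 2 < 2 ^ w)
    {q : ℕ → ℕ} {s₀ : Memory}
    (hq : ∀ v < n, q v = if s₀.arr 0 v = 0 then (nbrs I v).length * L / k else 0)
    (R : ℕ) {Q : List (ℕ × ℕ) → Memory → ℕ → Prop} {t : ℕ} (hs : LevelState n b L τ B s₀ k)
    (hQ : ∀ cs s' t' P, LevelState n b L τ B s' (nextLevel b k) →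
      (∀ c ∈ cs, c.1 < n ∧ s₀.arr 0 c.1 = 0 ∧ c.2 < n) →
      IsPeeled n (fun v => v < n ∧ s₀.arr 0 v = 0) τ cs P →
      (∀ v < n, s'.arr 0 v = if s₀.arr 0 v = 0 ∧ v ∉ P then k else s₀.arr 0 v) →
      s'.var 10 ≤ s₀.var 10 + ∑ x ∈ Finset.range n, q x → 40 * (B - s'.var 10) + R ≤ t' →
      Q cs s' t')
    (ht : 130 * n + 40 * (B - s₀.var 10) + R + 40 ≤ t) :
    Samples I w s₀ t level (requests q B (s₀.var 10) (List.range' 0 n)) [] Q := by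
  rw [← List.append_nil (requests _ _ _ _)]
  refine Samples.seq (by omega) (samples_drawAll hs.nodes hs.level hs.rate hs.budget (by omega) hq
    (90 * n + R + 30) ⟨by simpa using hs.arcs, fun c cs' h => by simp at h, fun c cs' h => by
      simp at h,
      fun u hu => by simpa [lastArc] using hs.head u hu⟩ hs.cnt hs.le ?_ (by omega))
  intro cs s₁ t₁ h₁ ht₁
  have ha0 := h₁.frame.arr 0 (by simp)
  have hlen : cs.length ≤ B := by
    have := h₁.total
    have := h₁.le
    omega
  refine Surely.samples (Surely.seq (by omega) (surely_scanAll (by omega)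
    (20 * cs.length + 40 * (B - s₁.var 10) + 70 * n + R + 20)
    ((h₁.frame.var 0 (by simp)).trans hs.nodes) ((h₁.frame.var 8 (by simp)).trans hs.threshold)
      h₁.arcs
    h₁.cnt (by rw [h₁.frame.arr 6 (by simp)]; exact hs.mark) ?_ (by omega)))
  intro s₂ t₂ l h₂ hcnt₂ ht₂
  rw [ha0] at h₂
  have e : ∀ x, x ∉ [10, 12, 13, 14, 15, 16, 17, 18, 19, 22] → s₂.var x = s₀.var x := by
    intro x hx
    rw [h₂.frame.var x (by simp at hx; simp [hx]), h₁.frame.var x (by simp at hx; simp [hx])]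
  refine Surely.seq (by omega) (surely_peel (s₀ := s₁) (by omega) (by omega)
    (fun c hc => ⟨(h₁.mem c hc).1, ⟨(h₁.mem c hc).1, (h₁.mem c hc).2.1⟩, (h₁.mem c hc).2.2⟩)
    ((h₁.frame.var 8 (by simp)).trans hs.threshold)
    (40 * (B - s₁.var 10) + 30 * n + R + 12) ?_ h₂ ?_ ?_)
  swap
  · intro v hv
    rw [hcnt₂ v hv, ← hits_univ]
    exact hits_congr _ (by simp)
  swap
  · have : arcsTo cs {x | x ∉ (∅ : Finset ℕ)} ≤ cs.length := by
      rw [arcsTo]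
      exact (hits_le_length _ _).trans (by simp)
    rw [Finset.card_empty]
    omega
  intro s₃ t₃ P h₃ hcnt₃ ht₃
  have e₃ : ∀ x, x ∉ [10, 12, 13, 14, 15, 16, 17, 18, 19, 22] → s₃.var x = s₀.var x := by
    intro x hx
    rw [h₃.frame.var x (by simp at hx; simp [hx]), h₁.frame.var x (by simp at hx; simp [hx])]
  have e10 : s₃.var 10 = s₁.var 10 := h₃.frame.var 10 (by simp)
  have ea : ∀ a, a ∉ [2, 3, 4, 5, 6, 7] → s₃.arr a = s₀.arr a := by
    intro a ha
    rw [h₃.frame.arr a (by simp at ha; simp [ha]), h₁.frame.arr a (by simp at ha; simp [ha])]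
  refine surely_finishLevel (P := P) (by omega) (40 * (B - s₁.var 10) + R)
    ((e₃ 0 (by simp)).trans hs.nodes)
    ((e₃ 2 (by simp)).trans hs.accuracy) ((e₃ 7 (by simp)).trans hs.rate)
    ((e₃ 8 (by simp)).trans hs.threshold) ((e₃ 11 (by simp)).trans hs.budget)
    ((e₃ 9 (by simp)).trans hs.level) (by rw [e10]; exact h₁.le)
    (by rw [ea 1 (by simp)]; exact hs.den) (by simpa using h₃.state.mark) ?_ (by omega)
  intro s₄ t₄ h₄ hl₄ ht₄ hR₄
  rw [ea 0 (by simp)] at hl₄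
  refine hQ cs s₄ t₄ P h₄ h₁.mem ⟨fun v hv => (h₃.state.done v hv).2, fun v hv hact hvP => ?_,
    fun S hS v hv => (h₃.state.drop S hS v hv).1⟩ hl₄ ?_ ?_
  · rw [← hcnt₃ v hv]
    exact h₃.keep v hv hact hvP (by simp)
  · rw [ht₄, e10]
    exact h₁.le_sum
  · rw [ht₄, e10]
    exact hR₄

end

/-! ### The sequence of levels and its failure probability -/

/-- All levels of the sampling algorithm. -/
def levels : Program := .loop (.var 9) level

/-- The labels of all nodes are approximately correct, except for the nodes without label, which
have small core number. -/
structure GoodLabels (n : ℕ) (c : ℕ → ℕ) (b k : ℕ) (lab : ℕ → ℕ) : Prop where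
  unlabelled : ∀ v < n, lab v = 0 → c v * b ≤ (b + 1) * k
  upper : ∀ v < n, lab v ≠ 0 → c v * b ≤ (b + 1) * lab v
  lower : ∀ v < n, lab v ≠ 0 → lab v * b ≤ c v * (b + 1)
  level : ∀ v < n, lab v ≠ 0 → k ≤ lab v

/-- For a newly labelled node the upper bound on its core number was known from being unlabelled
before, and the lower bound comes from `IsPeeled.le_core`. A node left unlabelled has core number
below `k` by `IsPeeled.core_lt`, and `core_nextLevel` compares this with the next level. -/
theorem GoodLabels.next {n b k τ : ℕ} {c ρ lab lab' : ℕ → ℕ}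
    {cs : List (ℕ × ℕ)} {P : Finset ℕ} (hk : 1 ≤ k)
    (h : GoodLabels n c b k lab) (hρ : ∀ v < n, ∀ u < n, ρ u ≤ ρ v → c u ≤ c v)
    (hcs : ∀ c ∈ cs, c.2 < n)
    (hP : IsPeeled n (fun v => v < n ∧ lab v = 0) τ cs P)
    (hgood : GoodSample n c ρ (fun v => v < n ∧ lab v = 0) b k τ cs)
    (hlab : ∀ v < n, lab' v = if lab v = 0 ∧ v ∉ P then k else lab v) :
    GoodLabels n c b (nextLevel b k) lab' := by
  have h1 : ∀ v < n, lab' v = 0 → c v < k := by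
    intro v hv h0
    rw [hlab v hv] at h0
    split_ifs at h0 with h1
    · omega
    · exact hP.core_lt (fun v hv => hv.1) hgood (by tauto)
  have h2 : ∀ v < n, lab v = 0 → lab' v ≠ 0 → lab' v = k ∧ v ∉ P := by
    intro v hv h0 h3
    rw [hlab v hv] at h3 ⊢
    split_ifs at h3 ⊢ with h4
    · exact ⟨rfl, h4.2⟩
    · exact absurd h0 h3
  have h3 : ∀ v < n, lab v ≠ 0 → lab' v = lab v := by
    intro v hv h0
    rw [hlab v hv, if_neg (by tauto)]
  refine ⟨fun v hv h0 => core_nextLevel (h1 v hv h0), fun v hv h0 => ?_, fun v hv h0 => ?_,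
    fun v hv h0 => ?_⟩
  all_goals
    by_cases hl : lab v = 0
    on_goal 2 => rw [h3 v hv hl]
    on_goal 1 => obtain ⟨h4, h5⟩ := h2 v hv hl h0; rw [h4]
  · exact h.unlabelled v hv hl
  · exact h.upper v hv hl
  -- Inactive nodes have a label of at least `k` that is correct from below, so they are not of too
  -- small core number at level `k`.
  · refine hP.le_core hgood hρ (fun v u hu => hcs _ (mem_of_mem_targets hu)) ?_ hv h5
    intro u hu hact
    have hlu : lab u ≠ 0 := by tauto
    exact (Nat.mul_le_mul_right _ (h.level u hu hlu)).trans (h.lower u hu hlu)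
  · exact h.lower v hv hl
  · exact (nextLevel_lt (by omega)).le
  · exact (nextLevel_lt (by omega)).le.trans (h.level v hv hl)

section

variable {n : ℕ} {G : SimpleGraph (Fin n)} {I : IncidenceLists G} {w : ℕ}

theorem Samples.surely {s : Memory} {t : ℕ} {p : Program} {vs : List ℕ} {cs : List (ℕ × ℕ)}
    {Q : List (ℕ × ℕ) → Memory → ℕ → Prop} (h : Samples I w s t p vs cs Q) :
    Surely I w s t p fun s' t' => ∃ cs', Q cs' s' t' :=
  fun f x hf => (h f (fun _ => x) fun s' t' cs' ht h' => hf s' t' ht ⟨cs', h'⟩).trans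
    (sampleExpect_const_le _ _ _)

/-- Time bound without any assumption on the labels: after a bad sample nothing is known about them,
but the cap on the samples still limits the work. -/
theorem surely_levels {b L τ B k : ℕ} (hW : B + n * L + n + n + b + 2 < 2 ^ w) (hkn : k ≤ n)
    {s : Memory} {t : ℕ} (R : ℕ) {Q : Memory → ℕ → Prop} (hs : LevelState n b L τ B s k)
    (hQ : ∀ s' t', LevelState n b L τ B s' 0 → R ≤ t' → Q s' t')
    (ht : (130 * n + 50) * numLevels b k + 40 * (B - s.var 10) + R + 1 ≤ t) :
    Surely I w s t levels Q := by
  refine Surely.loop (fun s t => ∃ k ≤ n, LevelState n b L τ B s k ∧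
    (130 * n + 50) * numLevels b k + 40 * (B - s.var 10) + R + 1 ≤ t) ?_ ⟨k, hkn, hs, ht⟩
  rintro s t ⟨k, hkn, hs, ht⟩
  refine ⟨trivial, by omega, fun h0 => ?_, fun h0 => ?_⟩
  · rw [Expr.val_var, hs.level] at h0
    subst h0
    exact hQ s _ hs (by omega)
  rw [Expr.val_var, hs.level] at h0
  have hlev : numLevels b k = numLevels b (nextLevel b k) + 1 := by
    rw [numLevels, dif_neg h0]
  rw [hlev, Nat.mul_succ] at ht
  refine (samples_level (k := k) (by omega) (q := fun v => if s.arr 0 v = 0 then _ else 0)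
    (fun v _ => rfl) ((130 * n + 50) * numLevels b (nextLevel b k) + R + 1) hs
    (Q := fun _ s t => ∃ k ≤ n, LevelState n b L τ B s k ∧
    (130 * n + 50) * numLevels b k + 40 * (B - s.var 10) + R + 1 ≤ t) ?_ (by omega)).surely.mono ?_
  · intro cs s' t' P h1 _ _ _ _ h2
    exact ⟨_, (nextLevel_lt h0).le.trans hkn, h1, by omega⟩
  · rintro s' t' _ ⟨_, h⟩
    exact h

/-- Here `f` measures failure. A good sample leads to the induction hypothesis at the next level;
after a bad one the trivial bound `1` is used, with termination from `surely_levels`. Each level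
adds one term `n * failure`, and `nextLevel b k + 1 ≤ k` turns this into the factor `k`. -/
theorem wp_levels_le {b p g k : ℕ} (hg : 1 ≤ g) (hb : 1 ≤ b)
    (hW : budget n b p g + n * rate b p g + n + n + b + 2 < 2 ^ w) (hkn : k ≤ n) {ρ : ℕ → ℕ}
    (hρ : ∀ v < n, hits (nbrs I v) {u | ρ v ≤ ρ u} ≤ coreFun G v ∧
      ∀ u < n, ρ u ≤ ρ v → coreFun G u ≤ coreFun G v)
    {s : Memory} {t : ℕ} (f : Memory → ℕ → ℝ≥0∞)
    (hs : LevelState n b (rate b p g) (threshold b p g) (budget n b p g) s k)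
    (hf : ∀ s' t', LevelState n b (rate b p g) (threshold b p g) (budget n b p g) s' 0 → f s' t' ≤
      1)
    (hf0 : ∀ s' t', LevelState n b (rate b p g) (threshold b p g) (budget n b p g) s' 0 →
      GoodLabels n (coreFun G) b 0 (s'.arr 0) → f s' t' = 0)
    (hlab : GoodLabels n (coreFun G) b k (s.arr 0))
    (htot : (s.var 10 : ℝ) ≤ spent n (nbrs I) (coreFun G) b p g k)
    (ht : (130 * n + 50) * numLevels b k + 40 * (budget n b p g - s.var 10) + 1 ≤ t) :
    wp I w levels f s t ≤ k * (n * ENNReal.ofReal (failure p g)) := by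
  have hG := isCoreGraph I
  induction k using Nat.strong_induction_on generalizing s t with
  | _ k ih =>
  obtain ⟨t, rfl⟩ : ∃ t', t = t' + 1 := ⟨t - 1, by omega⟩
  rw [levels, wp_loop, Expr.eval_eq_val (e := .var 9) trivial, Expr.val_var, hs.level]
  rcases Nat.eq_zero_or_pos k with rfl | hk
  · simp [hf0 s t hs hlab]
  rw [if_pos hk.ne']
  have hlev : numLevels b k = numLevels b (nextLevel b k) + 1 := by
    rw [numLevels, dif_neg hk.ne']
  rw [hlev, Nat.mul_succ] at ht
  have hlt : nextLevel b k < k := nextLevel_lt hk.ne'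
  classical
  let act : ℕ → Prop := fun v => v < n ∧ s.arr 0 v = 0
  let q : ℕ → ℕ := fun v => if act v then (nbrs I v).length * rate b p g / k else 0
  have hstep : (s.var 10 : ℝ) + ((∑ v ∈ Finset.range n, q v : ℕ) : ℝ) ≤
      spent n (nbrs I) (coreFun G) b p g (nextLevel b k) := by
    have := spent_step hG (p := p) (g := g) (act := act) hb hk fun v hv hv0 => hlab.unlabelled v hv
      hv0.2
    refine le_trans ?_ this
    push_cast
    gcongr
    simp only [q]
    split_ifs <;> simp
  -- As long as all earlier levels were good, the cap is not exceeded, and every active node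
  -- receives its full sample.
  have hB : s.var 10 + ∑ v ∈ Finset.range n, q v ≤ budget n b p g := by
    exact_mod_cast hstep.trans (spent_le_budget hG)
  have hmap : ((List.range' 0 n).map q).sum = ∑ v ∈ Finset.range n, q v := by
    rw [← List.range_eq_range', Finset.sum_range, ← List.sum_ofFn]
    congr 1
    rw [List.ofFn_eq_map, ← List.map_coe_finRange_eq_range, List.map_map]
    rfl
  refine ((samples_level (by omega) (q := q) ?_ ((130 * n + 50) * numLevels b (nextLevel b k) + 1)
    hs
    (Q := fun cs s' t' => ∃ P,
      LevelState n b (rate b p g) (threshold b p g) (budget n b p g) s' (nextLevel b k) ∧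
      (∀ c ∈ cs, c.1 < n ∧ s.arr 0 c.1 = 0 ∧ c.2 < n) ∧ IsPeeled n act (threshold b p g) cs P ∧
      (∀ v < n, s'.arr 0 v = if s.arr 0 v = 0 ∧ v ∉ P then k else s.arr 0 v) ∧
      s'.var 10 ≤ s.var 10 + ∑ x ∈ Finset.range n, q x ∧ 40 * (budget n b p g - s'.var 10) +
        ((130 * n + 50) * numLevels b (nextLevel b k) + 1) ≤ t')
    (fun cs s' t' P h1 h2 h3 h4 h5 h6 => ⟨P, h1, h2, h3, h4, h5, h6⟩) (by omega))
    _ (fun cs => if GoodSample n (coreFun G) ρ act b k (threshold b p g) cs then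
      ((nextLevel b k : ℕ) : ℝ≥0∞) * (n * ENNReal.ofReal (failure p g)) else 1) ?_).trans ?_
  · intro v hv
    simp [q, act, hv]
  · rintro s' t' cs ht' ⟨P, h1, h2, h3, h4, h5, h6⟩
    split_ifs with hgood
    · refine ih _ hlt (hlt.le.trans hkn) h1 ?_ ?_ (by omega)
      · exact hlab.next hk (fun v hv => (hρ v hv).2) (fun c hc => (h2 c hc).2.2) h3 hgood h4
      · refine le_trans ?_ hstep
        exact_mod_cast h5
    · exact surely_levels hW (hlt.le.trans hkn) 0 h1 (fun s'' t'' h _ => h) (by omega) f 1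
        fun s'' t'' _ h => hf s'' t'' h
  · refine (sampleExpect_goodSample_le hG hg hk (fun v hv => (hρ v hv).1) _ ?_ _).trans ?_
    · intro v hv hact
      rw [count_requests List.nodup_range' (by rw [hmap]; exact hB) (by simpa using hv)]
      exact if_pos hact
    · have : ((nextLevel b k : ℕ) : ℝ≥0∞) + 1 ≤ k := by exact_mod_cast hlt
      calc _ = (((nextLevel b k : ℕ) : ℝ≥0∞) + 1) * (n * ENNReal.ofReal (failure p g)) := by ring
        _ ≤ _ := by gcongr

end

/-! ### Set-up and the choice between the two algorithms -/

/-- Computes the sum of all degrees, and initializes the arrays. -/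
def readDegrees : Program :=
  .loop ((Expr.var 12).lt (.var 0)) <|
    .seq (.degree 14 (.var 12)) <| .seq (.assign 6 (.var 6 + .var 14)) <|
    .seq (.store 1 (.var 12) (.lit 1)) <| .seq (.store 8 (.var 12) (.var 12)) <|
    .assign 12 (.var 12 + .lit 1)

/-- Computes the number of binary digits of the number of nodes. -/
def countDigits : Program :=
  .seq (.seq (.assign 5 (.lit 1)) (.assign 20 (.var 0))) <|
  .loop ((Expr.lit 1).lt (.var 20)) <|
    .seq (.assign 20 (.var 20 / .lit 2)) (.assign 5 (.var 5 + .lit 1))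

/-- Computes the parameters of the sampling algorithm. -/
def setParameters : Program :=
  .seq (.assign 21 (.lit 8 * (.lit 2 * .var 2 + .lit 1) * (.var 3 + .lit 3) * .var 5)) <|
  .seq (.assign 7 (.lit 2 * (.var 2 + .lit 1) * .var 21)) <|
  .seq (.assign 8 ((.lit 2 * .var 2 + .lit 1) * .var 21)) <|
  .seq (.assign 11 (.lit 8 * .var 7 * (.var 2 + .lit 2) * .var 0)) (.assign 9 (.var 0))

/-- The algorithm. -/
def approxCores : Program :=
  .seq readDegrees <| .seq countDigits <|
  .cond ((Expr.var 0 * .var 5).lt (.var 6)) (.seq setParameters levels) exactCores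

section

variable {n : ℕ} {G : SimpleGraph (Fin n)} {I : IncidenceLists G} {w : ℕ}

theorem surely_readDegrees {M : ℕ} (hM : ∑ v ∈ Finset.range n, (nbrs I v).length = M)
    (hW : n + M + 1 < 2 ^ w) (R : ℕ) {Q : Memory → ℕ → Prop} {s₀ : Memory} {t : ℕ}
    (hn : s₀.var 0 = n) (h6 : s₀.var 6 = 0) (h12 : s₀.var 12 = 0)
    (hQ : ∀ s' t', s'.var 6 = M → (∀ v < n, s'.arr 1 v = 1 ∧ s'.arr 8 v = v) →
      Frame [6, 12, 14] [1, 8] s₀ s' → R ≤ t' → Q s' t')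
    (ht : 20 * n + R + 1 ≤ t) : Surely I w s₀ t readDegrees Q := by
  refine Surely.loop (fun s t => ∃ v ≤ n, s.var 12 = v ∧
    s.var 6 = ∑ x ∈ Finset.range v, (nbrs I x).length ∧
    (∀ x < v, s.arr 1 x = 1 ∧ s.arr 8 x = x) ∧ Frame [6, 12, 14] [1, 8] s₀ s ∧
    20 * (n - v) + R + 1 ≤ t) ?_ ⟨0, by omega, h12, h6, by simp, Frame.rfl, by omega⟩
  rintro s t ⟨v, hvn, hv, h6, ha, hf, ht⟩
  have hn' := (hf.var 0 (by simp)).trans hn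
  refine ⟨Expr.fits_lt_var _ _ _ _ (by omega), by omega, fun h0 => ?_, fun h0 => ?_⟩
  · simp [hn', hv] at h0
    obtain rfl : v = n := by omega
    exact hQ s _ (h6.trans hM) ha hf (by omega)
  simp [hn', hv] at h0
  have hle : ∑ x ∈ Finset.range v, (nbrs I x).length + (nbrs I v).length ≤ M := by
    rw [← Finset.sum_range_succ, ← hM]
    exact Finset.sum_le_sum_of_subset (Finset.range_subset_range.2 h0)
  have hcost : Program.cost (Program.seq (.degree 14 (.var 12)) <|
    .seq (.assign 6 (.var 6 + .var 14)) <|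
    .seq (.store 1 (.var 12) (.lit 1)) <| .seq (.store 8 (.var 12) (.var 12)) <|
    .assign 12 (.var 12 + .lit 1)) ≤ 18 := by decide
  refine Surely.of_pre (fun s' => s' = ((((s.set 14 (nbrs I v).length).set 6
    (∑ x ∈ Finset.range v, (nbrs I x).length + (nbrs I v).length)).put 1 v 1).put 8 v v).set 12
      (v + 1)) ?_ (by omega) ?_
  · generalize 2 ^ w = W at *
    simp [Program.Pre, hv, degreeQuery_eq, h6]
    omega
  rintro s₁ t₁ hs₁ ht₁
  refine ⟨v + 1, by omega, by simp [hs₁], ?_, ?_, ?_, by omega⟩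
  · rw [Finset.sum_range_succ]
    simp [hs₁]
  · intro x hx
    by_cases hxv : x = v
    · simp [hs₁, hxv]
    · simpa [hs₁, hxv] using ha x (by omega)
  · exact ⟨fun x hx => by rw [← hf.var x hx]; simp at hx; simp [hs₁, hx],
      fun a ha => by rw [← hf.arr a ha]; simp at ha; simp [hs₁, ha]⟩

theorem surely_countDigits (hn0 : 0 < n) (hW : n + 2 < 2 ^ w) (R : ℕ) {Q : Memory → ℕ → Prop}
    {s₀ : Memory} {t : ℕ} (hn : s₀.var 0 = n)
    (hQ : ∀ s' t', s'.var 5 = Nat.log 2 n + 1 → Frame [5, 20] [] s₀ s' → R ≤ t' → Q s' t')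
    (ht : 5 * Nat.log 2 n + R + 5 ≤ t) : Surely I w s₀ t countDigits Q := by
  refine Surely.seq (by omega) (Surely.of_pre
    (fun s => s = (s₀.set 5 1).set 20 n) ?_ (by simp [Program.cost]; omega) ?_)
  · generalize 2 ^ w = W at *
    simp [Program.Pre, hn]
    omega
  rintro s t' rfl ht'
  simp only [Program.cost] at ht'
  refine Surely.loop (fun s t => ∃ x ≤ n, 0 < x ∧ s.var 20 = x ∧
    s.var 5 + Nat.log 2 x = Nat.log 2 n + 1 ∧ Frame [5, 20] [] s₀ s ∧
    5 * Nat.log 2 x + R + 1 ≤ t) ?_ ⟨n, le_rfl, hn0, by simp, by simp; omega,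
      ⟨fun x hx => by simp at hx; simp [hx], fun a ha => by simp⟩, by omega⟩
  rintro s t ⟨x, hxn, hx0, hx, hlog, hf, ht⟩
  refine ⟨⟨by simp only [Expr.Fits]; omega, trivial, ?_⟩, by omega, fun h0 => ?_, fun h0 => ?_⟩
  · simp only [BinOp.eval]
    split_ifs <;> omega
  · simp [hx] at h0
    obtain rfl : x = 1 := by omega
    exact hQ s _ (by simpa using hlog) hf (by omega)
  simp [hx] at h0
  have hstep := Nat.log_of_one_lt_of_le (b := 2) (by norm_num) h0
  have hlt := Nat.log_lt_self 2 (x := n) hn0.ne'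
  refine Surely.of_pre (fun s' => s' = (s.set 20 (x / 2)).set 5 (s.var 5 + 1)) ?_
    (by simp [Program.cost]; omega) ?_
  · generalize 2 ^ w = W at *
    simp [Program.Pre, hx]
    omega
  rintro s₁ t₁ hs₁ ht₁
  simp only [Program.cost] at ht₁
  refine ⟨x / 2, by omega, by omega, by simp [hs₁], by simp [hs₁]; omega, ?_, by omega⟩
  exact ⟨fun x hx => by rw [← hf.var x hx]; simp at hx; simp [hs₁, hx],
      fun a ha => by rw [← hf.arr a ha]; simp [hs₁]⟩

/-- The budget dominates the intermediate products, so one bound excludes overflow in all of them.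
-/
theorem pre_setParameters {W b p g : ℕ} (hn0 : 0 < n) (hg : 0 < g) {s : Memory} (hn : s.var 0 = n)
    (hb : s.var 2 = b) (hp : s.var 3 = p) (h5 : s.var 5 = g) (hW : budget n b p g + n < W) :
    setParameters.Pre I W s fun s' => s' = ((((s.set 21 (scale b p g)).set 7 (rate b p g)).set 8
      (threshold b p g)).set 11 (budget n b p g)).set 9 n := by
  have e1 : budget n b p g = 8 * rate b p g * (b + 2) * n := rfl
  have e2 : rate b p g = 2 * (b + 1) * scale b p g := rfl
  have e3 : threshold b p g = (2 * b + 1) * scale b p g := rfl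
  have e4 : scale b p g = 8 * (2 * b + 1) * (p + 3) * g := rfl
  have f1 : 8 * rate b p g * (b + 2) ≤ budget n b p g := Nat.le_mul_of_pos_right _ hn0
  have f2 : 8 * rate b p g ≤ 8 * rate b p g * (b + 2) := Nat.le_mul_of_pos_right _ (by omega)
  have f3 : 2 * scale b p g ≤ rate b p g := by
    rw [e2, Nat.mul_right_comm]
    exact Nat.le_mul_of_pos_right _ (by omega)
  have f4 : threshold b p g ≤ rate b p g := by
    rw [e2, e3]
    exact Nat.mul_le_mul_right _ (by omega)
  have f5 : 8 * (2 * b + 1) * (p + 3) ≤ scale b p g := Nat.le_mul_of_pos_right _ hg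
  have f6 : 8 * (2 * b + 1) ≤ 8 * (2 * b + 1) * (p + 3) := Nat.le_mul_of_pos_right _ (by omega)
  have f7 : p + 3 ≤ 8 * (2 * b + 1) * (p + 3) := Nat.le_mul_of_pos_left _ (by omega)
  simp [setParameters, Program.Pre, hn, hb, hp, h5]
  rw [← e4, ← e2, ← e3, ← e1]
  and_intros
  all_goals first | omega | rfl

theorem wp_seq_le {p q : Program} {f : Memory → ℕ → ℝ≥0∞} {s : Memory} {t : ℕ} {x : ℝ≥0∞}
    (ht : 0 < t) (h : Surely I w s (t - 1) p fun s' t' => wp I w q f s' t' ≤ x) :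
    wp I w (.seq p q) f s t ≤ x := by
  obtain ⟨t, rfl⟩ : ∃ t', t = t' + 1 := ⟨t - 1, by omega⟩
  rw [wp_seq]
  exact h _ _ fun _ _ _ h => h

theorem wp_cond_le {e : Expr} {p q : Program} {f : Memory → ℕ → ℝ≥0∞} {s : Memory} {t : ℕ}
    {x : ℝ≥0∞} (he : e.Fits (2 ^ w) s) (ht : 0 < t)
    (hp : e.val s ≠ 0 → wp I w p f s (t - 1) ≤ x) (hq : e.val s = 0 → wp I w q f s (t - 1) ≤ x) :
    wp I w (.cond e p q) f s t ≤ x := by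
  obtain ⟨t, rfl⟩ : ∃ t', t = t' + 1 := ⟨t - 1, by omega⟩
  rw [wp_succ, step, PMF.expect_pure, Expr.eval_eq_val he, expectRun_singleton]
  split_ifs with h
  · exact hp h
  · exact hq (by simpa using h)

/-- The exact branch contributes no failure. The sampling branch starts at level `n`, which bounds
every core number, and this gives the first factor `n`. -/
theorem wp_approxCores_le {b p g M : ℕ} (hn0 : 0 < n) (hb : 1 ≤ b) (hg : g = Nat.log 2 n + 1)
    (hM : ∑ v ∈ Finset.range n, (nbrs I v).length = M)
    (hW : budget n b p g + n * rate b p g + n + n + b + M + n * g + 2 < 2 ^ w)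
    {s : Memory} {t : ℕ} (hn : s.var 0 = n) (h2 : s.var 2 = b) (h3 : s.var 3 = p)
    (hvar : ∀ x, 5 ≤ x → s.var x = 0) (harr : ∀ a x, s.arr a x = 0)
    (f : Memory → ℝ≥0∞) (hf : ∀ s', f s' ≤ 1)
    (hf0 : ∀ s', (∀ v < n, s'.arr 1 v = 1 ∧ coreFun G v * b ≤ (b + 1) * s'.arr 0 v ∧
      s'.arr 0 v * b ≤ coreFun G v * (b + 1)) → f s' = 0)
    (ht1 : M ≤ n * g → 300 * (n + M) + 100 ≤ t)
    (ht2 : n * g < M → 300 * n + (130 * n + 50) * numLevels b n + 40 * budget n b p g + 100 ≤ t) :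
    wp I w approxCores (fun s _ => f s) s t ≤ n * (n * ENNReal.ofReal (failure p g)) := by
  have hG := isCoreGraph I
  have hlog := Nat.log_lt_self 2 (x := n) hn0.ne'
  have hgn : g ≤ n := by omega
  have hng : n ≤ n * g := Nat.le_mul_of_pos_right _ (by omega)
  have ht : 25 * n + 30 ≤ t := by
    by_cases h : M ≤ n * g
    · have := ht1 h
      omega
    · have := ht2 (by omega)
      omega
  refine wp_seq_le (by omega) (surely_readDegrees hM (by omega) (t - 20 * n - 2) hn
    (hvar 6 (by omega))
    (hvar 12 (by omega)) ?_ (by omega))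
  intro s₁ t₁ h₁ ha₁ hf₁ ht₁
  have hn₁ := (hf₁.var 0 (by simp)).trans hn
  refine wp_seq_le (by omega) (surely_countDigits hn0 (by omega) (t - 25 * n - 10) hn₁ ?_
    (by omega))
  intro s₂ t₂ h₂ hf₂ ht₂
  rw [← hg] at h₂
  have e : ∀ x, x ∉ [5, 6, 12, 14, 20] → s₂.var x = s.var x := by
    intro x hx
    rw [hf₂.var x (by simp at hx; simp [hx]), hf₁.var x (by simp at hx; simp [hx])]
  have ea : ∀ a, a ∉ [1, 8] → s₂.arr a = s.arr a := by
    intro a ha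
    rw [hf₂.arr a (by simp), hf₁.arr a ha]
  have ea' : ∀ v < n, s₂.arr 1 v = 1 ∧ s₂.arr 8 v = v := by
    rw [hf₂.arr 1 (by simp), hf₂.arr 8 (by simp)]
    exact ha₁
  have h6 : s₂.var 6 = M := (hf₂.var 6 (by simp)).trans h₁
  have hn₂ := (e 0 (by simp)).trans hn
  refine wp_cond_le ⟨⟨trivial, trivial, ?_⟩, trivial, ?_⟩ (by omega) (fun hc => ?_) fun hc => ?_
  · simp only [BinOp.eval, Expr.val_var, hn₂, h₂]
    omega
  · simp only [BinOp.eval]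
    split_ifs <;> omega
  · simp [hn₂, h₂, h6] at hc
    have ht2 := ht2 hc
    refine wp_seq_le (by omega) (Surely.of_pre _ (pre_setParameters (b := b) (p := p) (g := g) hn0
      (by omega) hn₂ ((e 2 (by simp)).trans h2) ((e 3 (by simp)).trans h3) h₂ (by omega))
      (by simp [setParameters, Program.cost]; omega) ?_)
    rintro s₃ t₃ hs₃ ht₃
    simp only [setParameters, Program.cost] at ht₃
    obtain ⟨ρ, hρ⟩ := hG.exists_degeneracy_order
    have e₃ : ∀ x, x ∉ [5, 6, 7, 8, 9, 11, 12, 14, 20, 21] → s₃.var x = s.var x := by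
      intro x hx
      rw [← e x (by simp at hx; simp [hx])]
      simp at hx
      simp [hs₃, hx]
    have ea₃ : ∀ a, s₃.arr a = s₂.arr a := fun a => by simp [hs₃]
    have hz : ∀ a, a ∉ [1, 8] → ∀ v, s₃.arr a v = 0 := by
      intro a ha v
      rw [ea₃, ea a ha, harr]
    have e10 : s₃.var 10 = 0 := (e₃ 10 (by simp)).trans (hvar 10 (by omega))
    refine wp_levels_le (p := p) (g := g) (by omega) hb (by omega) le_rfl hρ (fun s _ => f s)
      ⟨(e₃ 0 (by simp)).trans hn, (e₃ 2 (by simp)).trans h2, by simp [hs₃], by simp [hs₃],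
        by simp [hs₃], by simp [hs₃], by omega, (e₃ 17 (by simp)).trans (hvar 17 (by omega)),
        fun v _ => hz 2 (by simp) v, fun v _ => hz 5 (by simp) v, fun v _ => hz 6 (by simp) v,
        fun v hv => by rw [ea₃]; exact (ea' v hv).1⟩ (fun s' _ _ => hf s') ?_ ?_ ?_ (by omega)
    · intro s' _ h1 h2
      refine hf0 s' fun v hv => ⟨h1.den v hv, ?_⟩
      by_cases hl : s'.arr 0 v = 0
      -- At level `0` an unlabelled node has core number `0`, so the initial value `0` of its label
      -- is exact.
      · have := h2.unlabelled v hv hl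
        simp [hl] at this ⊢
        tauto
      · exact ⟨h2.upper v hv hl, h2.lower v hv hl⟩
    · refine ⟨fun v hv _ => ?_, fun v _ h => absurd (hz 0 (by simp) v) h,
        fun v _ h => absurd (hz 0 (by simp) v) h, fun v _ h => absurd (hz 0 (by simp) v) h⟩
      have h1 := (hG.core_le_length hv).trans (hG.length_le v)
      rw [Nat.mul_comm]
      exact Nat.mul_le_mul (by omega) h1
    · rw [e10, Nat.cast_zero, spent]
      positivity
  · simp [hn₂, h₂, h6] at hc
    have ht1 := ht1 hc
    refine surely_exactCores hn0 (by omega) hM (by omega) 0 hn₂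
      ((e 9 (by simp)).trans (hvar 9 (by omega)))
      ((e 17 (by simp)).trans (hvar 17 (by omega))) ((e 19 (by simp)).trans (hvar 19 (by omega)))
      (fun v _ => by rw [ea 2 (by simp), harr]) (fun v _ => by rw [ea 5 (by simp), harr])
      (fun v _ => by rw [ea 6 (by simp), harr]) (fun v hv => (ea' v hv).2)
      (Q := fun s' _ => f s' = 0) ?_ (by omega) _ _ ?_
    · intro s' t' h1 h3 _
      refine hf0 s' fun v hv => ⟨by rw [h3]; exact (ea' v hv).1, ?_⟩
      rw [h1 v hv]
      exact ⟨by rw [Nat.mul_comm]; exact Nat.mul_le_mul_right _ (by omega),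
        Nat.mul_le_mul_left _ (by omega)⟩
    · intro s' t' _ h
      rw [h]
      exact zero_le

end

/-! ### Bounds for word length, running time and failure probability -/

/-- A factor for the values that occur in the algorithm. -/
def wordFactor (b p : ℕ) : ℕ :=
  8 * (2 * (b + 1) * (8 * (2 * b + 1) * (p + 3))) * (b + 2) +
    2 * (b + 1) * (8 * (2 * b + 1) * (p + 3)) + b + p + 10

/-- All values are at most `wordFactor * n²`; moreover `n < 2 ^ g` and `wordFactor < 2 ^
wordFactor`. -/
theorem fits_word {n b p g M w : ℕ} (hn : 0 < n) (hg : g = Nat.log 2 n + 1) (hM : M ≤ n * n)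
    (hw : (wordFactor b p + 2) * g ≤ w) :
    budget n b p g + n * rate b p g + n + n + b + M + n * g + 2 + p < 2 ^ w := by
  have hlog := Nat.log_lt_self 2 (x := n) hn.ne'
  have hgn : g ≤ n := by omega
  have h1 : rate b p g ≤ 2 * (b + 1) * (8 * (2 * b + 1) * (p + 3)) * n := by
    have : rate b p g = 2 * (b + 1) * (8 * (2 * b + 1) * (p + 3)) * g := by
      unfold rate scale
      ring
    rw [this]
    exact Nat.mul_le_mul_left _ hgn
  have h3 : n ≤ n * n := Nat.le_mul_of_pos_right _ hn
  have h4 : n * g ≤ n * n := Nat.mul_le_mul_left _ hgn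
  have h5 : 1 ≤ n * n := by omega
  have h6 : budget n b p g ≤ 8 * (2 * (b + 1) * (8 * (2 * b + 1) * (p + 3))) * (b + 2) * (n * n) :=
    by
    unfold budget
    calc _ ≤ 8 * (2 * (b + 1) * (8 * (2 * b + 1) * (p + 3)) * n) * (b + 2) * n := by gcongr
      _ = _ := by ring
  have h7 : n * rate b p g ≤ 2 * (b + 1) * (8 * (2 * b + 1) * (p + 3)) * (n * n) := by
    calc _ ≤ n * (2 * (b + 1) * (8 * (2 * b + 1) * (p + 3)) * n) := by gcongr
      _ = _ := by ring
  have h8 : b + p ≤ (b + p) * (n * n) := Nat.le_mul_of_pos_right _ h5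
  have h9 : budget n b p g + n * rate b p g + n + n + b + M + n * g + 2 + p ≤
      wordFactor b p * (n * n) := by
    have : wordFactor b p * (n * n) =
      8 * (2 * (b + 1) * (8 * (2 * b + 1) * (p + 3))) * (b + 2) * (n * n) +
      2 * (b + 1) * (8 * (2 * b + 1) * (p + 3)) * (n * n) + (b + p) * (n * n) + 10 * (n * n) := by
      unfold wordFactor
      ring
    omega
  have hn2 : n < 2 ^ g := hg ▸ Nat.lt_pow_succ_log_self (by norm_num) n
  have h10 : wordFactor b p < 2 ^ wordFactor b p := Nat.lt_two_pow_self
  calc _ ≤ wordFactor b p * (n * n) := h9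
    _ < 2 ^ wordFactor b p * (2 ^ g * 2 ^ g) := by
      refine Nat.mul_lt_mul_of_lt_of_le h10 (Nat.mul_le_mul hn2.le hn2.le) (by positivity)
    _ = 2 ^ (wordFactor b p + (g + g)) := by rw [pow_add, pow_add]
    _ ≤ 2 ^ w := by
      refine Nat.pow_le_pow_right (by norm_num) (le_trans ?_ hw)
      have : wordFactor b p ≤ wordFactor b p * g := Nat.le_mul_of_pos_right _ (by omega)
      rw [Nat.add_mul]
      omega

theorem log_le_digits {n g : ℕ} (hn : 0 < n) (hg : g = Nat.log 2 n + 1) : Real.log n ≤ g := by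
  have h1 : (n : ℝ) ≤ 2 ^ g := by
    exact_mod_cast (hg ▸ Nat.lt_pow_succ_log_self (by norm_num) n : n < 2 ^ g).le
  have h0 : (0 : ℝ) < n := by exact_mod_cast hn
  calc Real.log n ≤ Real.log (2 ^ g) := Real.log_le_log h0 h1
    _ = g * Real.log 2 := Real.log_pow _ _
    _ ≤ g * 1 := by
      gcongr
      have := Real.log_two_lt_d9
      linarith
    _ = g := mul_one _

theorem digits_le_log {n g : ℕ} (hn : 0 < n) (hg : g = Nat.log 2 n + 1) :
    (g : ℝ) ≤ 1 + 2 * Real.log n := by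
  have h1 : (2 : ℝ) ^ Nat.log 2 n ≤ n := by exact_mod_cast Nat.pow_log_le_self 2 hn.ne'
  have h2 := Real.log_le_log (by positivity) h1
  rw [Real.log_pow] at h2
  have h3 := Real.log_two_gt_d9
  have h4 : (0 : ℝ) ≤ Nat.log 2 n := Nat.cast_nonneg _
  rw [hg]
  push_cast
  nlinarith

/-- A factor for the running time. -/
def timeFactor (b p : ℕ) : ℕ :=
  900 + 180 * (b + 3) + 320 * (2 * (b + 1) * (8 * (2 * b + 1) * (p + 3))) * (b + 2)

/-- There are at most `(b + 3) g` levels of linear cost, and the budget is a constant times `n g`.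
-/
theorem sampled_time_le {n b p g : ℕ} (hn : 0 < n) (hg : g = Nat.log 2 n + 1) :
    300 * n + (130 * n + 50) * numLevels b n + 40 * budget n b p g + 100 ≤
      timeFactor b p * (n + n * g) := by
  have hlev : numLevels b n ≤ (b + 3) * g := by
    have h1 := numLevels_le b (k := n) hn
    have h2 := log_le_digits hn hg
    have h3 : (1 : ℝ) ≤ g := by exact_mod_cast (by omega : 1 ≤ g)
    have : (numLevels b n : ℝ) ≤ ((b + 3) * g : ℕ) := by
      push_cast
      have h4 : ((b : ℝ) + 2) * Real.log n ≤ (b + 2) * g := by gcongr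
      nlinarith
    exact_mod_cast this
  have hbud : budget n b p g = 8 * (2 * (b + 1) * (8 * (2 * b + 1) * (p + 3))) * (b + 2) * (n * g)
    := by
    unfold budget rate scale
    ring
  have h5 : (130 * n + 50) * numLevels b n ≤ 180 * (b + 3) * (n * g) := by
    calc _ ≤ (180 * n) * ((b + 3) * g) := Nat.mul_le_mul (by omega) hlev
      _ = _ := by ring
  have h6 : timeFactor b p * (n + n * g) = timeFactor b p * n + 900 * (n * g) +
      180 * (b + 3) * (n * g) +
      40 * (8 * (2 * (b + 1) * (8 * (2 * b + 1) * (p + 3))) * (b + 2) * (n * g)) := by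
    unfold timeFactor
    ring
  have h7 : 900 * n ≤ timeFactor b p * n := Nat.mul_le_mul_right _ (by unfold timeFactor; omega)
  omega

/-- The factor 3 comes from `g ≤ 1 + 2 log n` and from the degree sum being twice the number of
edges. -/
theorem time_le_real {n m g A : ℕ} (hn : 0 < n) (hg : g = Nat.log 2 n + 1) :
    ((A * (n + min (2 * m) (n * g)) : ℕ) : ℝ) ≤
      3 * A * (n + min (m : ℝ) (n * Real.log n)) := by
  have h1 := digits_le_log hn hg
  have h0 : (0 : ℝ) ≤ n := Nat.cast_nonneg _
  have hmin : ((min (2 * m) (n * g) : ℕ) : ℝ) ≤ n + 2 * min (m : ℝ) (n * Real.log n) := by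
    rcases le_total (m : ℝ) (n * Real.log n) with h | h
    · rw [min_eq_left h]
      calc ((min (2 * m) (n * g) : ℕ) : ℝ) ≤ (2 * m : ℕ) := by exact_mod_cast min_le_left _ _
        _ ≤ _ := by push_cast; linarith
    · rw [min_eq_right h]
      calc ((min (2 * m) (n * g) : ℕ) : ℝ) ≤ (n * g : ℕ) := by exact_mod_cast min_le_right _ _
        _ ≤ _ := by push_cast; nlinarith
  have h2 : 0 ≤ min (m : ℝ) (n * Real.log n) :=
    le_min (Nat.cast_nonneg _) (mul_nonneg h0 (Real.log_natCast_nonneg n))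
  rw [Nat.cast_mul, Nat.cast_add]
  calc (A : ℝ) * (n + (min (2 * m) (n * g) : ℕ))
      ≤ A * (3 * (n + min (m : ℝ) (n * Real.log n))) := by
        gcongr
        linarith
    _ = _ := by ring

/-- As `g ≥ log n`, one failure has probability at most `n ^ (-(p + 3))`; the union bound uses up
two of the three extra powers. -/
theorem failure_le {n g p : ℕ} {c : ℝ} (hn : 0 < n) (hg : g = Nat.log 2 n + 1) (hc : c ≤ p) :
    (n : ℝ) * (n * failure p g) ≤ 1 / (n : ℝ) ^ c := by
  have h0 : (0 : ℝ) < n := by exact_mod_cast hn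
  have hlog := log_le_digits hn hg
  have hlog0 := Real.log_natCast_nonneg n
  rw [le_div_iff₀ (by positivity), Real.rpow_def_of_pos h0, failure]
  nth_rw 1 2 [← Real.exp_log h0]
  rw [← Real.exp_add, ← Real.exp_add, ← Real.exp_add]
  refine Real.exp_le_one_iff.2 ?_
  have h1 : Real.log n * c ≤ g * p := by
    calc Real.log n * c ≤ Real.log n * p := by gcongr
      _ ≤ g * p := by gcongr
  have h2 : (0 : ℝ) ≤ g := Nat.cast_nonneg _
  nlinarith

/-! ### From the verified program to the theorem -/

section

variable {n : ℕ} {G : SimpleGraph (Fin n)} {I : IncidenceLists G} {w : ℕ}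

/-- Accuracy `1 / b` with `b` the denominator of `ε` is enough, because a positive `ε` has numerator
at least `1`. -/
theorem correctLabels_of_le {ε : ℚ} (hε : 0 < ε) {s : Memory}
    (h : ∀ v < n, s.arr 1 v = 1 ∧ coreFun G v * ε.den ≤ (ε.den + 1) * s.arr 0 v ∧
      s.arr 0 v * ε.den ≤ coreFun G v * (ε.den + 1)) : CorrectLabels G (ε : ℝ) s := by
  intro v
  obtain ⟨h1, h2, h3⟩ := h v v.2
  have hv : coreFun G v = G.coreNumber v := by simp [coreFun]
  rw [hv] at h2 h3
  have hb : (0 : ℝ) < ε.den := by exact_mod_cast ε.den_pos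
  have hε' : (1 : ℝ) / ε.den ≤ ε := by
    rw [Rat.cast_def]
    gcongr
    exact_mod_cast Rat.num_pos.2 hε
  have h4 : (ε.den : ℝ) + 1 ≤ ε.den * (1 + ε) := by
    rw [div_le_iff₀ hb] at hε'
    linarith
  have hε0 : (0 : ℝ) < 1 + ε := by
    have : (0 : ℝ) < 1 / ε.den := by positivity
    linarith
  have h2' : (G.coreNumber v : ℝ) * ε.den ≤ (ε.den + 1) * s.arr 0 v := by exact_mod_cast h2
  have h3' : (s.arr 0 v : ℝ) * ε.den ≤ G.coreNumber v * (ε.den + 1) := by exact_mod_cast h3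
  rw [h1, Nat.cast_one, div_one]
  refine ⟨one_pos, ?_, ?_⟩
  · rw [div_le_iff₀ hε0]
    refine le_of_mul_le_mul_right ?_ hb
    calc _ ≤ _ := h2'
      _ ≤ (ε.den * (1 + ε)) * s.arr 0 v := by gcongr
      _ = _ := by ring
  · refine le_of_mul_le_mul_right ?_ hb
    calc _ ≤ _ := h3'
      _ ≤ G.coreNumber v * (ε.den * (1 + ε)) := by gcongr
      _ = _ := by ring

/-- One unfinished configuration of positive probability would already make the expectation
infinite. -/
theorem eq_nil_of_expect_ne_top {μ : PMF Config} {f : Memory → ℝ≥0∞}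
    (h : μ.expect (fun c => if c.1 = [] then f c.2 else ⊤) ≠ ⊤) {cfg : Config}
      (hc : cfg ∈ μ.support) :
    cfg.1 = [] := by
  by_contra hne
  have := ENNReal.ne_top_of_tsum_ne_top h cfg
  dsimp only at this
  rw [if_neg hne, ENNReal.mul_top ((PMF.mem_support_iff _ _).1 hc)] at this
  exact this rfl

open scoped Classical in
theorem expect_run_approxCores_le {ε c : ℚ} (hn0 : 0 < n)
    (hw : (wordFactor ε.den c.num.natAbs + 2) * (Nat.log 2 n + 1) ≤ w) (hε : 0 < ε) :
    (run I w (timeFactor ε.den c.num.natAbs *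
      (n + min (2 * G.edgeSet.ncard) (n * (Nat.log 2 n + 1)))) (init w approxCores n ε c)).expect
      (fun cfg => if cfg.1 = [] then (if CorrectLabels G (ε : ℝ) cfg.2 then 0 else 1) else ⊤) ≤
      n * (n * ENNReal.ofReal (failure c.num.natAbs (Nat.log 2 n + 1))) := by
  have hM := sum_length_nbrs I
  have hMn : 2 * G.edgeSet.ncard ≤ n * n := by
    rw [← hM]
    calc _ ≤ ∑ v ∈ Finset.range n, n := Finset.sum_le_sum fun v _ => (isCoreGraph I).length_le v
      _ = n * n := by simp
  have hW := fits_word (p := c.num.natAbs) hn0 rfl hMn hw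
  have hb : 1 ≤ ε.den := ε.den_pos
  rw [init, expect_run (f := fun s => if CorrectLabels G (ε : ℝ) s then 0 else 1)]
  refine wp_approxCores_le hn0 hb rfl hM (by omega) ?_ ?_ ?_ ?_ (fun a x => rfl) _ ?_ ?_ ?_ ?_
  · exact Nat.mod_eq_of_lt (by omega : n < 2 ^ w)
  · exact Nat.mod_eq_of_lt (by omega : ε.den < 2 ^ w)
  · exact Nat.mod_eq_of_lt (by omega : c.num.natAbs < 2 ^ w)
  · intro x hx
    obtain ⟨y, rfl⟩ := Nat.exists_eq_add_of_le' hx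
    simp
  · intro s'
    split_ifs <;> simp
  · intro s' h
    exact if_pos (correctLabels_of_le hε h)
  · intro h
    rw [min_eq_left h]
    have : 900 * (n + 2 * G.edgeSet.ncard) ≤ timeFactor ε.den c.num.natAbs *
        (n + 2 * G.edgeSet.ncard) := Nat.mul_le_mul_right _ (by unfold timeFactor; omega)
    omega
  · intro h
    rw [min_eq_right h.le]
    exact sampled_time_le hn0 rfl

theorem card_le_of_no_isolated (hdeg : ∀ v, ∃ u, G.Adj v u) : n ≤ 2 * G.edgeSet.ncard := by
  classical
  have h := G.sum_degrees_eq_twice_card_edges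
  rw [← G.coe_edgeFinset, Set.ncard_coe_finset, ← h]
  calc n = ∑ v : Fin n, 1 := by simp
    _ ≤ _ := Finset.sum_le_sum fun v _ => by
      obtain ⟨u, hu⟩ := hdeg v
      exact Nat.succ_le_of_lt ((G.degree_pos_iff_exists_adj v).2 ⟨u, hu⟩)

end

end QueryRAM

theorem theorem1 :
    ∃ (P : QueryRAM.Program) (K : ℝ),
      ∀ ε c : ℚ, 0 < ε → ε ≤ 1 → 0 < c →
        ∃ (κ : ℕ) (C : ℝ),
          ∀ n : ℕ, 0 < n →
            ∀ (G : SimpleGraph (Fin n)) (I : IncidenceLists G) (w : ℕ),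
              κ * (Nat.log 2 n + 1) ≤ w →
                ∃ t : ℕ,
                  (t : ℝ) ≤ C * (n + min (G.edgeSet.ncard : ℝ) (n * Real.log n)) ∧
                  ((∀ v, ∃ u, G.Adj v u) →
                    (t : ℝ) ≤ C * min (G.edgeSet.ncard : ℝ) (n * Real.log n)) ∧
                  (∀ cfg ∈ (QueryRAM.run I w t (QueryRAM.init w P n ε c)).support,
                    cfg.1 = []) ∧
                  1 - K / (n : ℝ) ^ (c : ℝ) ≤
                    ((QueryRAM.run I w t (QueryRAM.init w P n ε c)).toOuterMeasure
                      {cfg | QueryRAM.CorrectLabels G (ε : ℝ) cfg.2}).toReal := by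
  classical
  -- The integer confidence is the numerator of `c`, which is at least `c`. The constant 9 is the 3
  -- of `time_le_real` times another 3 needed when no node is isolated.
  refine ⟨QueryRAM.approxCores, 1, fun ε c hε _ hc =>
    ⟨QueryRAM.wordFactor ε.den c.num.natAbs + 2, 9 * QueryRAM.timeFactor ε.den c.num.natAbs,
      fun n hn G I w hw => ⟨QueryRAM.timeFactor ε.den c.num.natAbs *
        (n + min (2 * G.edgeSet.ncard) (n * (Nat.log 2 n + 1))), ?_, fun hdeg => ?_, fun cfg hcfg
          => ?_, ?_⟩⟩⟩
  · refine (QueryRAM.time_le_real hn rfl).trans ?_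
    have h0 : (0 : ℝ) ≤ n := Nat.cast_nonneg _
    have h1 : 0 ≤ min (G.edgeSet.ncard : ℝ) (n * Real.log n) :=
      le_min (Nat.cast_nonneg _) (mul_nonneg h0 (Real.log_natCast_nonneg n))
    gcongr
    norm_num
  · refine (QueryRAM.time_le_real hn rfl).trans ?_
    have hn2 : 2 ≤ n := by
      obtain ⟨u, hu⟩ := hdeg ⟨0, hn⟩
      have h1 := G.ne_of_adj hu
      have h2 : (u : ℕ) ≠ 0 := fun h => h1 (Fin.ext h.symm)
      omega
    have hlog : (1 : ℝ) / 2 ≤ Real.log n := by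
      have h1 := Real.log_two_gt_d9
      have h2 := Real.log_le_log (by norm_num) (by exact_mod_cast hn2 : (2 : ℝ) ≤ n)
      linarith
    have h3 : (n : ℝ) ≤ 2 * G.edgeSet.ncard := by
      exact_mod_cast QueryRAM.card_le_of_no_isolated hdeg
    -- Without isolated nodes `n ≤ 2 m`, and `n ≥ 2` gives `log n ≥ 1 / 2`. So the additive `n` is
    -- at most twice the minimum.
    have h4 : (n : ℝ) / 2 ≤ min (G.edgeSet.ncard : ℝ) (n * Real.log n) :=
      le_min (by linarith) (by nlinarith [(Nat.cast_nonneg n : (0 : ℝ) ≤ n)])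
    calc _ ≤ 3 * (QueryRAM.timeFactor ε.den c.num.natAbs : ℝ) *
          (3 * min (G.edgeSet.ncard : ℝ) (n * Real.log n)) := by
          gcongr
          linarith
      _ = _ := by ring
  · refine QueryRAM.eq_nil_of_expect_ne_top
      (f := fun s => if QueryRAM.CorrectLabels G (ε : ℝ) s then 0 else 1) (ne_top_of_le_ne_top ?_
      (QueryRAM.expect_run_approxCores_le hn hw hε)) hcfg
    exact ENNReal.mul_ne_top (by simp) (ENNReal.mul_ne_top (by simp) (by simp))
  · refine PMF.le_one_sub_of_expect_le _ _ ?_ (by positivity)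
      ((QueryRAM.expect_run_approxCores_le hn hw hε).trans ?_)
    · intro cfg hcfg
      have : ¬ QueryRAM.CorrectLabels G (ε : ℝ) cfg.2 := hcfg
      rw [if_neg this]
      split_ifs <;> simp
    · have hcp : (c : ℝ) ≤ c.num.natAbs := by
        have h1 : ((c.num.natAbs : ℕ) : ℝ) = (c.num : ℝ) := by
          rw [Nat.cast_natAbs, abs_of_nonneg (Rat.num_nonneg.2 hc.le)]
        rw [h1, Rat.cast_def]
        refine div_le_self ?_ ?_
        · exact_mod_cast Rat.num_nonneg.2 hc.le
        · exact_mod_cast c.den_pos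
      rw [← ENNReal.ofReal_natCast, ← ENNReal.ofReal_mul (by positivity),
        ← ENNReal.ofReal_mul (by positivity)]
      exact ENNReal.ofReal_le_ofReal (QueryRAM.failure_le hn rfl hcp)
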